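/- Let $f,w:\{1,\dots,n\}\to\mathbb R$ with all $w_i>0$, let $\delta>0$ and $U=\max_i|f_i|$. For $p>1$ the $L_p$ isotonic regression of $(f,w)$ is the non-decreasing $g$ that minimizes $\sum_i w_i|f_i-g_i|^p$; $\mathrm{strict}_{\downarrow1}(f)$ is its limit as $p\searrow1$. For a finite non-empty family $S$ of values $y$ with weights $w_y>0$, let $\mathrm{mean}_{\downarrow1}(S)$ be the limit, as $p\searrow 1$, of the minimizer $c$ of $\sum_{y\in S}w_y|y-c|^p$. Time is the number of steps on a real RAM on which each arithmetic operation, real power, comparison and array access costs one step. **Algorithm.** The vertices are grouped into blocks of consecutive vertices; each block has a vertical extent, with ends $a\le b$. Initially every vertex is a block with extent $[\min f,\max f]$. In an iteration a splitting value $\hat y$ is chosen for each extent that is to be split. For each block $S$ with this extent one computes from its original data values the total weight $W$, the weights $S_<,S_=,S_>$ of the data values less than, equal to, greater than $\hat y$, and the products $P_<,P_>$ of $|\hat y-y|^{w_y}$ over its data values $y<\hat y$ and $y>\hat y$ respectively. A block is then partitioned, that is, its extent becomes $(a,\hat y)$, the point $\hat y$, or $(\hat y,b)$, as follows. If $S_=>0$: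 the point if $S_<,S_><W/2$; otherwise $(a,\hat y)$ if $S_<\ge W/2$, and $(\hat y,b)$ if not. If $S_==0$ and $S_<=S_>$ (Jackson's formula): the point if $P_<=P_>$, $(a,\hat y)$ if $P_<>P_>$, $(\hat y,b)$ if $P_<<P_>$. If $S_==0$ and $S_<\ne S_>$: $(a,\hat y)$ if $S_<>W/2$, and $(\hat y,b)$ if not. The blocks are processed from left to right (pool adjacent violators): as long as the new extent of the preceding block is above the new extent of the current one, the two unpartitioned blocks are merged, sums being added and products multiplied, and the union is partitioned. In the first phase $\hat y$ is the median of the distinct data values of $f$ remaining in the extent (which are sorted once at the start by merge sort), until no data values remain in any extent; in the second phase $\hat y=(a+b)/2$, until $b-a\le\delta$ for every block. The output is, for every vertex $i$, the extent with ends $a_i\le b_i$ of its block. **Claim.** 1. For every non-empty $S$ as above, $\mathrm{mean}_{\downarrow1}(S)$ exists and is unique. For every $\hat y$, one pass over the original data values of a block computes its sums and products, merging maintains them, and the partitioning rule decides from them correctly whether $\mathrm{mean}_{\downarrow1}(S)$ is less than, equal to, or greater than $\hat y$. 2. For all $n,f,w,\delta$ as above, $g=\mathrm{strict}_{\downarrow1}(f)$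 exists and is unique, the algorithm halts, and its output satisfies $a_i\le g_i\le b_i$ and $b_i-a_i\le\delta$ for all $i$, with $(a_i)$ and $(b_i)$ non-decreasing; if $g_i$ is one of the values of $f$, then $a_i=b_i=g_i$. 3. The worst-case time is $\Theta(n\log\max\{n,U/\delta\})$: there are absolute constants $c,C>0$ such that for $n\ge2$ the time is at most $C\,n\log\max\{n,U/\delta\}$ on every input, and for all $n\ge3$, $U\ge0$ and $\delta>0$ there is an input with $\max_i|f_i|=U$ on which the time is at least $c\,n\log\max\{n,U/\delta\}$. -/

import Mathlib

open Filter Topology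

noncomputable section

namespace StrictIso

/-! ### Isotonic regression and its limit as `p ↘ 1` -/

/-- The weighted `L_p` error `∑ w(v) |f(v) - g(v)|^p` (without the `p`-th root). -/
def lpError {V : Type*} [Fintype V] (p : ℝ) (f w g : V → ℝ) : ℝ :=
  ∑ v, w v * |f v - g v| ^ p

/-- `g` is an `L_p` isotonic regression of the weighted function `(f, w)`. -/
def IsLpRegression {V : Type*} [Fintype V] [Preorder V] (p : ℝ) (f w g : V → ℝ) : Prop :=
  Monotone g ∧ ∀ h : V → ℝ, Monotone h → lpError p f w g ≤ lpError p f w h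

/-- `g` is the limit of `L_p` isotonic regressions of `(f, w)` as `p` decreases to `1`. -/
def IsStrictDownOne {V : Type*} [Fintype V] [Preorder V] (f w g : V → ℝ) : Prop :=
  ∃ r : ℝ → V → ℝ, (∀ p, 1 < p → IsLpRegression p f w (r p)) ∧
    Tendsto r (𝓝[>] 1) (𝓝 g)

/-- `c` is a weighted `L_p` mean of the finite family `S` of pairs (value, weight). -/
def IsLpMean (p : ℝ) (S : List (ℝ × ℝ)) (c : ℝ) : Prop :=
  ∀ z : ℝ, (S.map fun q => q.2 * |q.1 - c| ^ p).sum ≤ (S.map fun q => q.2 * |q.1 - z| ^ p).sum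

/-- `c` is the limit of weighted `L_p` means of `S` as `p` decreases to `1`. -/
def IsMeanDownOne (S : List (ℝ × ℝ)) (c : ℝ) : Prop :=
  ∃ m : ℝ → ℝ, (∀ p, 1 < p → IsLpMean p S (m p)) ∧ Tendsto m (𝓝[>] 1) (𝓝 c)

/-! ### Step counting

A unit-cost real RAM. Computations carry a step counter and may diverge (`none`).
Every arithmetic operation, power, comparison and array access on reals or indices is one step,
and so is every call of a program function; that step pays for the bounded amount of pattern
matching and record or list-cell construction which the body of the function performs. -/

/-- Possibly divergent computations with a step counter. -/
abbrev RAM := StateT ℕ Option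

def tick : RAM Unit := fun t => some ((), t + 1)

def addR (x y : ℝ) : RAM ℝ := do tick; pure (x + y)
def subR (x y : ℝ) : RAM ℝ := do tick; pure (x - y)
def mulR (x y : ℝ) : RAM ℝ := do tick; pure (x * y)
def halfR (x : ℝ) : RAM ℝ := do tick; pure (x / 2)
def powR (x y : ℝ) : RAM ℝ := do tick; pure (x ^ y)
def ltR (x y : ℝ) : RAM Bool := do tick; pure (decide (x < y))
def leR (x y : ℝ) : RAM Bool := do tick; pure (decide (x ≤ y))
def addN (i j : ℕ) : RAM ℕ := do tick; pure (i + j)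
def predN (i : ℕ) : RAM ℕ := do tick; pure (i - 1)
def halfN (i : ℕ) : RAM ℕ := do tick; pure (i / 2)
def ltN (i j : ℕ) : RAM Bool := do tick; pure (decide (i < j))
def readA (A : Array ℝ) (i : ℕ) : RAM ℝ := do tick; pure (A.getD i 0)

/-! ### Sorting the distinct data values -/

/-- Deal a list alternately into two lists. -/
def split : List ℝ → RAM (List ℝ × List ℝ)
  | [] => do tick; pure ([], [])
  | x :: l => do
    tick
    let (p, q) ← split l
    pure (x :: q, p)

/-- Merge two strictly increasing lists, keeping one copy of common values. -/
def merge (xs ys : List ℝ) : RAM (List ℝ) := do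
  tick
  match xs, ys with
  | [], ys => pure ys
  | x :: xs, [] => pure (x :: xs)
  | x :: xs, y :: ys =>
    if ← ltR x y then
      let r ← merge xs (y :: ys)
      pure (x :: r)
    else if ← ltR y x then
      let r ← merge (x :: xs) ys
      pure (y :: r)
    else
      merge xs (y :: ys)
  partial_fixpoint

/-- Merge sort; the result lists the distinct values in increasing order. -/
def sortDistinct (l : List ℝ) : RAM (List ℝ) := do
  tick
  match l with
  | [] => pure []
  | [x] => pure [x]
  | x :: y :: l => do
    let (p, q) ← split (x :: y :: l)
    let p' ← sortDistinct p
    let q' ← sortDistinct q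
    merge p' q'
  partial_fixpoint

/-- The data values of a list of pairs (value, weight). -/
def values : List (ℝ × ℝ) → RAM (List ℝ)
  | [] => do tick; pure []
  | (y, _) :: l => do
    tick
    let r ← values l
    pure (y :: r)

/-- Write a list into an array. -/
def fillArray : List ℝ → Array ℝ → RAM (Array ℝ)
  | [], A => do tick; pure A
  | x :: l, A => do
    tick
    fillArray l (A.push x)

/-! ### Boxes and their partitioning -/

/-- A box: `len` consecutive vertices (the boxes are kept in the order of the vertices, so the
lengths determine the horizontal extents) and the vertical extent from `a` to `b`.
The data values that are still candidates inside the extent are those with ranks `lo ≤ k < hi`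
in the sorted array of distinct data values. -/
structure Box where
  len : ℕ
  a : ℝ
  b : ℝ
  lo : ℕ
  hi : ℕ

/-- A splitting value `y` for a vertical extent; the candidates below it are those of rank
`< hiBelow`, and those above it have rank `≥ loAbove`. -/
structure Cut where
  y : ℝ
  hiBelow : ℕ
  loAbove : ℕ

/-- The numbers kept for a block relative to a splitting value `ŷ`: the total weight `W`, the
weights `Slt`, `Seq`, `Sgt` of the data values `< ŷ`, `= ŷ`, `> ŷ`, and the products `Plt`, `Pgt`
of `|ŷ - y|^w` over the data values `y < ŷ` and `y > ŷ`. -/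
@[ext] structure Stats where
  W : ℝ
  Slt : ℝ
  Seq : ℝ
  Sgt : ℝ
  Plt : ℝ
  Pgt : ℝ

/-- The statistics of the weighted data values `S` relative to `y`, as mathematical quantities. -/
def Stats.of (y : ℝ) (S : List (ℝ × ℝ)) : Stats where
  W := (S.map Prod.snd).sum
  Slt := ((S.filter fun q => decide (q.1 < y)).map Prod.snd).sum
  Seq := ((S.filter fun q => decide (q.1 = y)).map Prod.snd).sum
  Sgt := ((S.filter fun q => decide (y < q.1)).map Prod.snd).sum
  Plt := ((S.filter fun q => decide (q.1 < y)).map fun q => |y - q.1| ^ q.2).prod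
  Pgt := ((S.filter fun q => decide (y < q.1)).map fun q => |y - q.1| ^ q.2).prod

def Stats.empty : Stats := ⟨0, 0, 0, 0, 1, 1⟩

/-- Add one data point to the statistics. -/
def addPoint (y v w : ℝ) (s : Stats) : RAM Stats := do
  tick
  let W ← addR s.W w
  if ← ltR v y then
    let S ← addR s.Slt w
    let d ← subR y v
    let e ← powR d w
    let P ← mulR s.Plt e
    pure { s with W := W, Slt := S, Plt := P }
  else if ← ltR y v then
    let S ← addR s.Sgt w
    let d ← subR v y
    let e ← powR d w
    let P ← mulR s.Pgt e
    pure { s with W := W, Sgt := S, Pgt := P }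
  else
    let S ← addR s.Seq w
    pure { s with W := W, Seq := S }

/-- Read the next `k` points of the original data, accumulating their statistics relative
to `y`; the unread data are returned as well. -/
def scan (y : ℝ) : ℕ → List (ℝ × ℝ) → Stats → RAM (Stats × List (ℝ × ℝ))
  | k + 1, (v, w) :: data, s => do
    tick
    let s' ← addPoint y v w s
    scan y k data s'
  | _, data, s => do tick; pure (s, data)

/-- Pass over the next `k` data points. -/
def skip : ℕ → List (ℝ × ℝ) → RAM (List (ℝ × ℝ))
  | k + 1, _ :: data => do tick; skip k data
  | _, data => do tick; pure data

/-- The statistics of the union of two adjacent blocks, in constant time. -/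
def mergeStats (s t : Stats) : RAM Stats := do
  tick
  let W ← addR s.W t.W
  let L ← addR s.Slt t.Slt
  let E ← addR s.Seq t.Seq
  let G ← addR s.Sgt t.Sgt
  let P ← mulR s.Plt t.Plt
  let Q ← mulR s.Pgt t.Pgt
  pure ⟨W, L, E, G, P, Q⟩

/-- Decide from its statistics whether the regression value of a block is below, at, or above
the splitting value. -/
def locate (s : Stats) : RAM Ordering := do
  tick
  let half ← halfR s.W
  if ← ltR 0 s.Seq then
    if (← ltR s.Slt half) && (← ltR s.Sgt half) then pure .eq
    else if ← leR half s.Slt then pure .lt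
    else pure .gt
  else if (← leR s.Slt s.Sgt) && (← leR s.Sgt s.Slt) then
    if ← ltR s.Pgt s.Plt then pure .lt
    else if ← ltR s.Plt s.Pgt then pure .gt
    else pure .eq
  else if ← ltR half s.Slt then pure .lt
  else pure .gt

/-- A block during one iteration: its box before the partitioning, the splitting value of this
iteration (`none` if the box is not to be partitioned) and its statistics. -/
structure Block where
  box : Box
  cut : Option Cut
  stats : Stats

/-- The box that results from partitioning a block. -/
def partitionBlock (B : Block) : RAM Box := do
  tick
  match B.cut with
  | none => pure B.box
  | some c =>
    match ← locate B.stats with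
    | .lt => pure { B.box with b := c.y, hi := c.hiBelow }
    | .eq => pure { B.box with a := c.y, b := c.y, lo := 0, hi := 0 }
    | .gt => pure { B.box with a := c.y, lo := c.loAbove }

/-! ### Pool adjacent violators -/

/-- Whether the vertical extent of `X` is above that of `Y`. -/
def isAbove (X Y : Box) : RAM Bool := do
  tick
  pure ((← leR Y.b X.a) && (← ltR Y.a X.b))

/-- The unpartitioned union of two adjacent blocks with the same vertical extent. -/
def mergeBlocks (A B : Block) : RAM Block := do
  tick
  let s ← mergeStats A.stats B.stats
  let k ← addN A.box.len B.box.len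
  pure { B with box := { B.box with len := k }, stats := s }

/-- Partition the block `B` and compare it with its predecessors (on a stack, nearest first, each
with the box that its partitioning gave); as long as the predecessor is above, merge the two
unpartitioned blocks and partition the union. -/
def pool (B : Block) : List (Block × Box) → RAM (List (Block × Box))
  | [] => do
    tick
    let X ← partitionBlock B
    pure [(B, X)]
  | (A, Y) :: stack => do
    tick
    let X ← partitionBlock B
    if ← isAbove Y X then
      let C ← mergeBlocks A B
      pool C stack
    else
      pure ((B, X) :: (A, Y) :: stack)

/-- Pool all blocks from left to right. Blocks from different sequences (different vertical
extents) are never merged, since the extents of a later sequence lie above. -/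
def poolAll : List Block → List (Block × Box) → RAM (List (Block × Box))
  | [], stack => do tick; pure stack
  | B :: blocks, stack => do
    tick
    let stack' ← pool B stack
    poolAll blocks stack'

/-- The boxes on the stack, from left to right. -/
def unstack : List (Block × Box) → List Box → RAM (List Box)
  | [], acc => do tick; pure acc
  | (_, X) :: stack, acc => do tick; unstack stack (X :: acc)

/-! ### Iterations -/

/-- Choose the splitting values and compute the statistics of all blocks from the original data. -/
def prepare (pick : Box → RAM (Option Cut)) : List Box → List (ℝ × ℝ) → RAM (List Block)
  | [], _ => do tick; pure []
  | X :: boxes, data => do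
    tick
    match ← pick X with
    | none =>
      let rest ← skip X.len data
      let r ← prepare pick boxes rest
      pure (⟨X, none, Stats.empty⟩ :: r)
    | some c =>
      let (s, rest) ← scan c.y X.len data Stats.empty
      let r ← prepare pick boxes rest
      pure (⟨X, some c, s⟩ :: r)

/-- Whether some box is still to be partitioned. -/
def anyActive (pick : Box → RAM (Option Cut)) : List Box → RAM Bool
  | [] => do tick; pure false
  | X :: boxes => do
    tick
    match ← pick X with
    | none => anyActive pick boxes
    | some _ => pure true

/-- Repeat the iteration (partition all boxes, pool adjacent violators) while some box is to be
partitioned. -/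
def iterations (pick : Box → RAM (Option Cut)) (data : List (ℝ × ℝ)) (boxes : List Box) :
    RAM (List Box) := do
  tick
  if ← anyActive pick boxes then
    let blocks ← prepare pick boxes data
    let stack ← poolAll blocks []
    let boxes' ← unstack stack []
    iterations pick data boxes'
  else
    pure boxes
  partial_fixpoint

/-- Split at the median of the data values in the extent, if there are any. -/
def pickData (A : Array ℝ) (X : Box) : RAM (Option Cut) := do
  tick
  if ← ltN X.lo X.hi then
    let s ← addN X.lo X.hi
    let m ← halfN s
    let y ← readA A m
    let m' ← addN m 1
    pure (some ⟨y, m, m'⟩)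
  else
    pure none

/-- Split at the midpoint of the extent, if it is longer than `δ`. -/
def pickMid (δ : ℝ) (X : Box) : RAM (Option Cut) := do
  tick
  let d ← subR X.b X.a
  if ← ltR δ d then
    let s ← addR X.a X.b
    let y ← halfR s
    pure (some ⟨y, X.hi, X.lo⟩)
  else
    pure none

/-- Every data point in its own box, the vertical extent being the range `[a, b]` of the data. -/
def initBoxes (a b : ℝ) (m : ℕ) : List (ℝ × ℝ) → RAM (List Box)
  | [] => do tick; pure []
  | _ :: data => do
    tick
    let r ← initBoxes a b m data
    pure (⟨1, a, b, 0, m⟩ :: r)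

/-- `k` copies of `z` in front of `l`. -/
def replicateOnto (z : ℝ × ℝ) (l : List (ℝ × ℝ)) : ℕ → RAM (List (ℝ × ℝ))
  | 0 => do tick; pure l
  | k + 1 => do
    tick
    let r ← replicateOnto z l k
    pure (z :: r)

/-- For every vertex, the vertical extent of its box. -/
def output : List Box → RAM (List (ℝ × ℝ))
  | [] => do tick; pure []
  | X :: boxes => do
    tick
    let r ← output boxes
    replicateOnto (X.a, X.b) r X.len

/-- The algorithm: partitioning at data values, then by halving the remaining extents until all
of them have length at most `δ`. The input lists value and weight of the vertices in order; the
output lists for every vertex the lower and the upper end of its vertical extent. -/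
def strictAlg (data : List (ℝ × ℝ)) (δ : ℝ) : RAM (List (ℝ × ℝ)) := do
  tick
  let vals ← values data
  let sorted ← sortDistinct vals
  let A ← fillArray sorted #[]
  let a ← readA A 0
  let last ← predN A.size
  let b ← readA A last
  let boxes ← initBoxes a b A.size data
  let boxes₁ ← iterations (pickData A) data boxes
  let boxes₂ ← iterations (pickMid δ) data boxes₁
  output boxes₂

/-- Value and weight of the vertices of a linear order, in order. -/
def dataOf {n : ℕ} (f w : Fin n → ℝ) : List (ℝ × ℝ) := List.ofFn fun i => (f i, w i)

/-- The computation `c` halts with result `x` after exactly `t` steps. -/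
def HaltsWith {α : Type} (c : RAM α) (x : α) (t : ℕ) : Prop := c.run 0 = some (x, t)

end StrictIso

end

open StrictIso

/-!
The derivative of `∑ w |c - y| ^ p` in `c` is a multiple of `∑ w sign (c - y) |c - y| ^ (p - 1)`.
Expanding `x ^ q = 1 + q log x + o(q)` at `q = p - 1 = 0`, its sign for `p` close to `1` is that of
the difference of the weights below and above `c` or, if these agree, of the corresponding sums of
`w log |c - y|`, except that at a data value the weight of this value absorbs a small difference.
Hence the minimizers converge as `p ↘ 1`, and the sums and products of a block decide on which side
of a splitting value the limit lies.

Cluster points of the `L_p` regressions `g` satisfy min-max conditions: lowering or raising `g` on a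
block that borders a level set does not pay, so the limit mean of the block bounds the level. Two
functions with these conditions agree, so the regressions converge. On every block of the algorithm
the limit is constant: by the conditions two adjacent violating blocks have the same regression
value, and once no violators are left, the regression value of a block lies on the same side of the
splitting value as its limit mean.

Every iteration takes linear time, as each merge removes a block. Data values leave the extents
after `log₂ n` iterations, after which extents are halved. For the lower bound, three vertices with
regression value `U / 3` force `log₂ (U / δ)` halvings, since in the `k`-th iteration the ends of
extents are multiples of `U / 2 ^ k`.
-/

namespace StrictIso

/-! ### Weighted sums over a family -/

/-- A family of pairs (value, weight) of which a weighted mean can be taken. -/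
structure IsPosFamily (S : List (ℝ × ℝ)) : Prop where
  ne_nil : S ≠ []
  weight_pos : ∀ r ∈ S, 0 < r.2

/-- The family with all values negated; it exchanges the data below and above a point. -/
def reflect (S : List (ℝ × ℝ)) : List (ℝ × ℝ) := S.map fun r => (-r.1, r.2)

/-- The sum `∑ w φ(y - v)` over the pairs `(v, w)` of the family. -/
noncomputable def weightedSum (φ : ℝ → ℝ) (S : List (ℝ × ℝ)) (y : ℝ) : ℝ :=
  (S.map fun r => r.2 * φ (y - r.1)).sum

section WeightedSum

variable {φ ψ : ℝ → ℝ} {S : List (ℝ × ℝ)} {y : ℝ}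

theorem weight_pos_reflect (hw : ∀ r ∈ S, 0 < r.2) : ∀ r ∈ reflect S, 0 < r.2 := by
  simpa only [reflect, List.forall_mem_map] using hw

theorem IsPosFamily.reflect (hS : IsPosFamily S) : IsPosFamily (reflect S) :=
  ⟨by simpa [StrictIso.reflect] using hS.ne_nil, weight_pos_reflect hS.weight_pos⟩

@[simp]
theorem weightedSum_nil : weightedSum φ [] y = 0 := rfl

@[simp]
theorem weightedSum_cons (r : ℝ × ℝ) :
    weightedSum φ (r :: S) y = r.2 * φ (y - r.1) + weightedSum φ S y := by
  simp [weightedSum]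

theorem weightedSum_reflect :
    weightedSum φ (reflect S) (-y) = weightedSum (fun x => φ (-x)) S y := by
  simp only [weightedSum, reflect, List.map_map, Function.comp_def]
  congr! 5
  ring

theorem weightedSum_reflect_of_odd (hφ : φ.Odd) :
    weightedSum φ (reflect S) (-y) = -weightedSum φ S y := by
  induction S with
  | nil => simp [reflect]
  | cons r S ih =>
    simp only [reflect, List.map_cons, weightedSum_cons] at ih ⊢
    rw [ih, show -y - -r.1 = -(y - r.1) by ring, hφ]
    ring

theorem weightedSum_nonneg (hφ : ∀ x, 0 ≤ φ x) (hw : ∀ r ∈ S, 0 < r.2) :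
    0 ≤ weightedSum φ S y := by
  refine List.sum_nonneg (List.forall_mem_map.2 fun r hr => ?_)
  exact mul_nonneg (hw r hr).le (hφ _)

theorem weightedSum_lt_weightedSum (hS : IsPosFamily S) {x : ℝ}
    (h : ∀ r ∈ S, φ (x - r.1) < ψ (y - r.1)) : weightedSum φ S x < weightedSum ψ S y :=
  List.sum_lt_sum_of_ne_nil hS.ne_nil _ _ fun r hr =>
    mul_lt_mul_of_pos_left (h r hr) (hS.weight_pos r hr)

theorem weightedSum_pos (hS : IsPosFamily S) (h : ∀ r ∈ S, 0 < φ (y - r.1)) :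
    0 < weightedSum φ S y := by
  simpa [weightedSum] using weightedSum_lt_weightedSum (φ := 0) (x := y) hS h

theorem weightedSum_strictMono (hS : IsPosFamily S) (hφ : StrictMono φ) :
    StrictMono (weightedSum φ S) := fun _ _ hxy =>
  weightedSum_lt_weightedSum hS fun _ _ => hφ (sub_lt_sub_right hxy _)

theorem hasDerivAt_weightedSum (hφ : ∀ x, HasDerivAt φ (ψ x) x) (y : ℝ) :
    HasDerivAt (weightedSum φ S) (weightedSum ψ S y) y := by
  induction S with
  | nil => exact hasDerivAt_const y (0 : ℝ)
  | cons r S ih =>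
    simp only [weightedSum_cons, funext fun y => weightedSum_cons (φ := φ) (S := S) (y := y) r]
    exact (((hφ _).comp_sub_const y r.1).const_mul r.2).add ih

theorem hasDerivAt_weightedSum_param {Φ : ℝ → ℝ → ℝ} {t : ℝ}
    (hΦ : ∀ x, HasDerivAt (fun s => Φ s x) (ψ x) t) :
    HasDerivAt (fun s => weightedSum (Φ s) S y) (weightedSum ψ S y) t := by
  induction S with
  | nil => simpa using hasDerivAt_const t (0 : ℝ)
  | cons r S ih =>
    simp only [weightedSum_cons]
    exact ((hΦ _).const_mul _).add ih

theorem continuousAt_weightedSum (hφ : ∀ x ≠ 0, ContinuousAt φ x) (hy : ∀ r ∈ S, r.1 ≠ y) :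
    ContinuousAt (weightedSum φ S) y :=
  tendsto_list_sum S fun r hr => ((hφ _ (sub_ne_zero.2 (hy r hr).symm)).comp
    (f := fun x => x - r.1) (by fun_prop)).tendsto.const_mul r.2

theorem tendsto_sub_nhdsLT (v y : ℝ) : Tendsto (fun x => x - v) (𝓝[<] y) (𝓝[<] (y - v)) := by
  refine ContinuousWithinAt.tendsto_nhdsWithin (by fun_prop) fun x hx => ?_
  exact sub_lt_sub_right (Set.mem_Iio.1 hx) v

theorem tendsto_weightedSum_summand_atTop (h0 : Tendsto φ (𝓝[<] 0) atTop) {w : ℝ} (hw : 0 < w)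
    (y : ℝ) : Tendsto (fun x => w * φ (x - y)) (𝓝[<] y) atTop := by
  refine (h0.comp ?_).const_mul_atTop hw
  simpa using tendsto_sub_nhdsLT y y

theorem tendsto_weightedSum_nhdsLT_atTop (hφ : ∀ x ≠ 0, ContinuousAt φ x)
    (h0 : Tendsto φ (𝓝[<] 0) atTop) (hw : ∀ r ∈ S, 0 < r.2) (hy : ∃ r ∈ S, r.1 = y) :
    Tendsto (weightedSum φ S) (𝓝[<] y) atTop := by
  induction S with
  | nil => simp at hy
  | cons r S ih =>
    rw [List.forall_mem_cons] at hw
    rw [funext fun x => weightedSum_cons (φ := φ) (S := S) (y := x) r]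
    by_cases hSy : ∃ r ∈ S, r.1 = y
    · specialize ih hw.2 hSy
      by_cases hr : r.1 = y
      · subst hr
        exact (tendsto_weightedSum_summand_atTop h0 hw.1 _).atTop_add_atTop ih
      · have hc : ContinuousAt (fun x => r.2 * φ (x - r.1)) y := continuousAt_const.mul
          ((hφ _ (sub_ne_zero.2 (Ne.symm hr))).comp (f := fun x => x - r.1) (by fun_prop))
        exact (hc.tendsto.mono_left nhdsWithin_le_nhds).add_atTop ih
    · obtain rfl : r.1 = y := by simpa [hSy] using hy
      push Not at hSy
      exact (tendsto_weightedSum_summand_atTop h0 hw.1 _).atTop_add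
        ((continuousAt_weightedSum hφ hSy).tendsto.mono_left nhdsWithin_le_nhds)

end WeightedSum

/-! ### Slopes of the `L_p` error as `p ↘ 1` -/

/-- The odd function `sign x |x|^q`, up to a factor the derivative of `|x|^(q + 1)`. -/
noncomputable def signPow (q x : ℝ) : ℝ := (SignType.sign x : ℝ) * |x| ^ q

/-- The odd function `sign x log |x|`, the derivative of `signPow q x` in `q` at `q = 0`. -/
noncomputable def signLog (x : ℝ) : ℝ := (SignType.sign x : ℝ) * Real.log |x|

/-- The slope at `y` of the `L_{q+1}` error of `S`, up to the factor `q + 1`. -/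
noncomputable def errorSlope (q : ℝ) : List (ℝ × ℝ) → ℝ → ℝ := weightedSum (signPow q)

/-- The weight of the values below `y` minus that of the values above `y`. -/
noncomputable def signSum : List (ℝ × ℝ) → ℝ → ℝ := weightedSum fun x => (SignType.sign x : ℝ)

/-- The derivative of `errorSlope q S y` in `q` at `q = 0`. -/
noncomputable def logSum : List (ℝ × ℝ) → ℝ → ℝ := weightedSum signLog

/-- The weight of the values equal to `y`. -/
noncomputable def eqSum : List (ℝ × ℝ) → ℝ → ℝ := weightedSum fun x => if x = 0 then 1 else 0

theorem signPow_odd (q : ℝ) : (signPow q).Odd := fun x => by simp [signPow, Left.sign_neg]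

theorem signLog_odd : signLog.Odd := fun x => by simp [signLog, Left.sign_neg]

theorem signPow_of_nonneg {q x : ℝ} (hq : 0 < q) (hx : 0 ≤ x) : signPow q x = x ^ q := by
  rcases hx.eq_or_lt with rfl | hx
  · simp [signPow, hq.ne']
  · simp [signPow, sign_pos hx, abs_of_pos hx]

theorem signPow_pos {q x : ℝ} (hx : 0 < x) : 0 < signPow q x := by
  rw [signPow, sign_pos hx, SignType.coe_one, one_mul]
  positivity

theorem signPow_strictMono {q : ℝ} (hq : 0 < q) : StrictMono (signPow q) :=
  strictMono_of_odd_strictMonoOn_nonneg (signPow_odd q) fun x hx y hy hxy => by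
    rw [signPow_of_nonneg hq hx, signPow_of_nonneg hq hy]
    exact Real.rpow_lt_rpow hx hxy hq

theorem hasDerivAt_abs_rpow_add_one {q : ℝ} (hq : 0 < q) (x : ℝ) :
    HasDerivAt (fun x : ℝ => |x| ^ (q + 1)) ((q + 1) * signPow q x) x := by
  convert hasDerivAt_abs_rpow x (p := q + 1) (by linarith) using 1
  rcases eq_or_ne x 0 with rfl | hx
  · simp [signPow]
  · have hpow : |x| ^ q = |x| ^ (q + 1 - 2) * |x| := by
      rw [← Real.rpow_add_one (abs_ne_zero.2 hx)]
      ring_nf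
    rw [signPow, hpow]
    linear_combination (q + 1) * |x| ^ (q + 1 - 2) * sign_mul_abs x

theorem hasDerivAt_signPow_zero (x : ℝ) :
    HasDerivAt (fun q => signPow q x) (signLog x) 0 := by
  unfold signPow signLog
  rcases eq_or_ne x 0 with rfl | hx
  · simpa using hasDerivAt_const (0 : ℝ) (0 : ℝ)
  · have h := (Real.hasStrictDerivAt_const_rpow (abs_pos.2 hx) 0).hasDerivAt
    simpa using h.const_mul (SignType.sign x : ℝ)

theorem continuousAt_signLog {x : ℝ} (hx : x ≠ 0) : ContinuousAt signLog x := by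
  have hsign : ContinuousAt (fun x : ℝ => ((SignType.sign x : SignType) : ℝ)) x :=
    (continuous_of_discreteTopology (f := SignType.cast)).continuousAt.comp
      (continuousAt_sign_of_ne_zero hx)
  exact hsign.mul (continuous_abs.continuousAt.log (abs_ne_zero.2 hx))

theorem tendsto_signLog_nhdsLT_zero : Tendsto signLog (𝓝[<] 0) atTop := by
  refine (tendsto_neg_atBot_atTop.comp Real.tendsto_log_nhdsLT_zero).congr' ?_
  filter_upwards [self_mem_nhdsWithin] with x hx
  simp [signLog, sign_neg (Set.mem_Iio.1 hx)]

theorem eventually_nhdsLT_signLog_lt {x : ℝ} (hx : x ≠ 0) :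
    ∀ᶠ y in 𝓝[<] x, signLog y < signLog x := by
  rcases hx.lt_or_gt with hx | hx
  · filter_upwards [self_mem_nhdsWithin] with y hy
    have hyx : y < x := hy
    have := Real.log_lt_log (neg_pos.2 hx) (neg_lt_neg hyx)
    simpa [signLog, sign_neg hx, sign_neg (hyx.trans hx), Real.log_neg_eq_log] using this
  · filter_upwards [Ioo_mem_nhdsLT hx] with y hy
    simpa [signLog, sign_pos hx, sign_pos hy.1] using Real.log_lt_log hy.1 hy.2

section Slopes

variable {S : List (ℝ × ℝ)} {q y : ℝ}

theorem errorSlope_reflect : errorSlope q (reflect S) (-y) = -errorSlope q S y :=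
  weightedSum_reflect_of_odd (signPow_odd q)

theorem signSum_reflect : signSum (reflect S) (-y) = -signSum S y :=
  weightedSum_reflect_of_odd fun x => by simp [Left.sign_neg]

theorem logSum_reflect : logSum (reflect S) (-y) = -logSum S y :=
  weightedSum_reflect_of_odd signLog_odd

theorem eqSum_reflect : eqSum (reflect S) (-y) = eqSum S y := by
  simp [eqSum, weightedSum_reflect]

theorem errorSlope_strictMono (hq : 0 < q) (hS : IsPosFamily S) : StrictMono (errorSlope q S) :=
  weightedSum_strictMono hS (signPow_strictMono hq)

theorem errorSlope_zero : errorSlope 0 S y = signSum S y := by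
  simp [errorSlope, signSum, weightedSum, signPow]

theorem hasDerivAt_errorSlope_zero (S : List (ℝ × ℝ)) (y : ℝ) :
    HasDerivAt (fun q => errorSlope q S y) (logSum S y) 0 :=
  hasDerivAt_weightedSum_param hasDerivAt_signPow_zero

theorem eventually_errorSlope_pos_of_signSum_pos (h : 0 < signSum S y) :
    ∀ᶠ q in 𝓝[>] (0 : ℝ), 0 < errorSlope q S y := by
  rw [← errorSlope_zero] at h
  exact ((hasDerivAt_errorSlope_zero S y).continuousAt.eventually
    (lt_mem_nhds h)).filter_mono nhdsWithin_le_nhds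

theorem eventually_errorSlope_pos_of_logSum_pos (h0 : signSum S y = 0) (h : 0 < logSum S y) :
    ∀ᶠ q in 𝓝[>] (0 : ℝ), 0 < errorSlope q S y := by
  have hd := (hasDerivAt_errorSlope_zero S y).tendsto_slope.mono_left
    (nhdsWithin_mono (0 : ℝ) fun x (hx : 0 < x) => hx.ne')
  filter_upwards [hd.eventually (lt_mem_nhds h), self_mem_nhdsWithin] with q hq hq0
  rw [slope_def_field, errorSlope_zero, h0, sub_zero, sub_zero] at hq
  exact (div_pos_iff_of_pos_right hq0).1 hq

theorem eventually_errorSlope_neg_of_reflect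
    (h : ∀ᶠ q in 𝓝[>] (0 : ℝ), 0 < errorSlope q (reflect S) (-y)) :
    ∀ᶠ q in 𝓝[>] (0 : ℝ), errorSlope q S y < 0 := by
  simpa only [errorSlope_reflect, neg_pos] using h

theorem eventually_errorSlope_neg_of_signSum_neg (h : signSum S y < 0) :
    ∀ᶠ q in 𝓝[>] (0 : ℝ), errorSlope q S y < 0 :=
  eventually_errorSlope_neg_of_reflect <| eventually_errorSlope_pos_of_signSum_pos <| by
    rwa [signSum_reflect, neg_pos]

theorem eventually_errorSlope_neg_of_logSum_neg (h0 : signSum S y = 0) (h : logSum S y < 0) :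
    ∀ᶠ q in 𝓝[>] (0 : ℝ), errorSlope q S y < 0 :=
  eventually_errorSlope_neg_of_reflect <| eventually_errorSlope_pos_of_logSum_pos
    (by rw [signSum_reflect, h0, neg_zero]) (by rwa [logSum_reflect, neg_pos])

theorem eventually_nhdsLT_sign_sub (v y : ℝ) : ∀ᶠ x in 𝓝[<] y,
    (SignType.sign (x - v) : ℝ) = SignType.sign (y - v) - if y - v = 0 then 1 else 0 := by
  rcases lt_trichotomy v y with h | rfl | h
  · filter_upwards [Ioo_mem_nhdsLT h] with x hx
    simp [sign_pos (sub_pos.2 h), sign_pos (sub_pos.2 hx.1), (sub_pos.2 h).ne']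
  · filter_upwards [self_mem_nhdsWithin] with x hx
    simp [sign_neg (sub_neg.2 (Set.mem_Iio.1 hx))]
  · filter_upwards [self_mem_nhdsWithin] with x hx
    simp [sign_neg (sub_neg.2 h), sign_neg (sub_neg.2 (hx.trans h)), (sub_neg.2 h).ne]

theorem eventually_nhdsLT_signSum_eq (S : List (ℝ × ℝ)) (y : ℝ) :
    ∀ᶠ x in 𝓝[<] y, signSum S x = signSum S y - eqSum S y := by
  induction S with
  | nil => simp [signSum, eqSum]
  | cons r S ih =>
    filter_upwards [ih, eventually_nhdsLT_sign_sub r.1 y] with x hS hr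
    simp only [signSum, eqSum, weightedSum_cons] at hS ⊢
    rw [hS, hr]
    ring

theorem eqSum_nonneg (hw : ∀ r ∈ S, 0 < r.2) (y : ℝ) : 0 ≤ eqSum S y :=
  weightedSum_nonneg (fun x => by positivity) hw

theorem eqSum_pos_iff (hw : ∀ r ∈ S, 0 < r.2) : 0 < eqSum S y ↔ ∃ r ∈ S, r.1 = y := by
  induction S with
  | nil => simp [eqSum]
  | cons r S ih =>
    rw [List.forall_mem_cons] at hw
    have hS := eqSum_nonneg hw.2 y
    simp only [List.exists_mem_cons_iff, ← ih hw.2, eqSum, weightedSum_cons] at hS ⊢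
    by_cases hr : r.1 = y
    · simp [hr, add_pos_of_pos_of_nonneg hw.1 hS]
    · simp [hr, sub_eq_zero, Ne.symm hr]

theorem ne_of_eqSum_eq_zero (hw : ∀ r ∈ S, 0 < r.2) (h : eqSum S y = 0) : ∀ r ∈ S, r.1 ≠ y :=
  fun r hr hy => ((eqSum_pos_iff hw).2 ⟨r, hr, hy⟩).ne' h

theorem eventually_nhdsLT_logSum_pos (hw : ∀ r ∈ S, 0 < r.2) (h : 0 < eqSum S y ∨ 0 < logSum S y) :
    ∀ᶠ x in 𝓝[<] y, 0 < logSum S x := by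
  have hcont : ∀ x ≠ 0, ContinuousAt signLog x := fun _ => continuousAt_signLog
  by_cases hy : 0 < eqSum S y
  · exact (tendsto_weightedSum_nhdsLT_atTop hcont tendsto_signLog_nhdsLT_zero hw
      ((eqSum_pos_iff hw).1 hy)).eventually_gt_atTop 0
  · have hne := ne_of_eqSum_eq_zero hw ((eqSum_nonneg hw y).antisymm' (not_lt.1 hy))
    exact ((continuousAt_weightedSum hcont hne).eventually
      (lt_mem_nhds (h.resolve_left hy))).filter_mono nhdsWithin_le_nhds

theorem eventually_nhdsLT_logSum_lt (hS : IsPosFamily S) (h0 : eqSum S y = 0) :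
    ∀ᶠ x in 𝓝[<] y, logSum S x < logSum S y := by
  have hterm : ∀ r ∈ S, ∀ᶠ x in 𝓝[<] y, signLog (x - r.1) < signLog (y - r.1) := fun r hr => by
    have hne : y - r.1 ≠ 0 := sub_ne_zero.2 (ne_of_eqSum_eq_zero hS.weight_pos h0 r hr).symm
    exact (tendsto_sub_nhdsLT r.1 y).eventually (eventually_nhdsLT_signLog_lt hne)
  filter_upwards [(Filter.eventually_all_finite (List.finite_toSet S)).2 hterm] with x hx
  exact weightedSum_lt_weightedSum hS hx

end Slopes

/-! ### The limit mean -/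

/-- The condition under which the partitioning rule puts the limit mean of `S` below `y`. The
condition for above is the same one for `reflect S` and `-y`. -/
def LiesBelow (S : List (ℝ × ℝ)) (y : ℝ) : Prop :=
  eqSum S y < signSum S y ∨ (eqSum S y = signSum S y ∧ (0 < eqSum S y ∨ 0 < logSum S y))

/-- The condition under which the partitioning rule puts the limit mean of `S` at `y`. -/
def LiesAt (S : List (ℝ × ℝ)) (y : ℝ) : Prop :=
  |signSum S y| < eqSum S y ∨ (eqSum S y = 0 ∧ signSum S y = 0 ∧ logSum S y = 0)

/-- The limit, as `p ↘ 1`, of the weighted `L_p` means of `S`: the point where the slopes of the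
`L_p` errors for small `p > 1` change sign. -/
noncomputable def limMean (S : List (ℝ × ℝ)) : ℝ :=
  sSup {y | ∀ᶠ q in 𝓝[>] (0 : ℝ), errorSlope q S y < 0}

section LimMean

variable {S : List (ℝ × ℝ)} {x y : ℝ}

theorem liesBelow_or_liesAt_or_liesBelow_reflect (hw : ∀ r ∈ S, 0 < r.2) (y : ℝ) :
    LiesBelow S y ∨ LiesAt S y ∨ LiesBelow (reflect S) (-y) := by
  simp only [LiesBelow, LiesAt, signSum_reflect, eqSum_reflect, logSum_reflect, neg_pos, abs_lt]
  have h0 := eqSum_nonneg hw y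
  grind

theorem LiesAt.reflect (h : LiesAt S y) : LiesAt (reflect S) (-y) := by
  simpa [LiesAt, signSum_reflect, eqSum_reflect, logSum_reflect] using h

theorem LiesBelow.exists_errorSlope_pos (hw : ∀ r ∈ S, 0 < r.2) (h : LiesBelow S y) :
    ∃ x < y, ∀ᶠ q in 𝓝[>] (0 : ℝ), 0 < errorSlope q S x := by
  have key : ∀ᶠ x in 𝓝[<] y, ∀ᶠ q in 𝓝[>] (0 : ℝ), 0 < errorSlope q S x := by
    rcases h with h | ⟨h, hlog⟩
    · filter_upwards [eventually_nhdsLT_signSum_eq S y] with x hx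
      exact eventually_errorSlope_pos_of_signSum_pos (by linarith)
    · filter_upwards [eventually_nhdsLT_signSum_eq S y, eventually_nhdsLT_logSum_pos hw hlog]
        with x hx hxlog
      exact eventually_errorSlope_pos_of_logSum_pos (by linarith) hxlog
  obtain ⟨x, hx, hxy⟩ := (key.and self_mem_nhdsWithin).exists
  exact ⟨x, hxy, hx⟩

theorem LiesAt.eventually_errorSlope_neg (hS : IsPosFamily S) (h : LiesAt S y) (hxy : x < y) :
    ∀ᶠ q in 𝓝[>] (0 : ℝ), errorSlope q S x < 0 := by
  have key : ∀ᶠ x in 𝓝[<] y, ∀ᶠ q in 𝓝[>] (0 : ℝ), errorSlope q S x < 0 := by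
    rcases h with h | ⟨heq, hsign, hlog⟩
    · filter_upwards [eventually_nhdsLT_signSum_eq S y] with x hx
      exact eventually_errorSlope_neg_of_signSum_neg (by linarith [le_abs_self (signSum S y)])
    · filter_upwards [eventually_nhdsLT_signSum_eq S y, eventually_nhdsLT_logSum_lt hS heq]
        with x hx hxlog
      exact eventually_errorSlope_neg_of_logSum_neg (by linarith) (by linarith)
  obtain ⟨z, hz, hxz⟩ := (key.and (Ioo_mem_nhdsLT hxy)).exists
  filter_upwards [hz, self_mem_nhdsWithin] with q hq hq0
  exact (errorSlope_strictMono hq0 hS hxz.1).trans hq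

theorem lt_of_eventually_errorSlope (hS : IsPosFamily S)
    (hx : ∀ᶠ q in 𝓝[>] (0 : ℝ), errorSlope q S x < 0)
    (hy : ∀ᶠ q in 𝓝[>] (0 : ℝ), 0 < errorSlope q S y) : x < y := by
  obtain ⟨q, ⟨hqx, hqy⟩, hq0⟩ := ((hx.and hy).and self_mem_nhdsWithin).exists
  exact (errorSlope_strictMono hq0 hS).lt_iff_lt.1 (hqx.trans hqy)

theorem exists_forall_errorSlope_pos (hS : IsPosFamily S) : ∃ y, ∀ q, 0 < errorSlope q S y := by
  obtain ⟨M, hM⟩ := (S.map Prod.fst).toFinset.bddAbove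
  refine ⟨M + 1, fun q => weightedSum_pos hS fun r hr => signPow_pos ?_⟩
  have := hM (List.mem_toFinset.2 (List.mem_map_of_mem hr))
  linarith

theorem exists_forall_errorSlope_neg (hS : IsPosFamily S) : ∃ y, ∀ q, errorSlope q S y < 0 := by
  obtain ⟨y, hy⟩ := exists_forall_errorSlope_pos hS.reflect
  refine ⟨-y, fun q => ?_⟩
  rw [← neg_pos, ← errorSlope_reflect, neg_neg]
  exact hy q

theorem le_limMean (hS : IsPosFamily S) (hx : ∀ᶠ q in 𝓝[>] (0 : ℝ), errorSlope q S x < 0) :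
    x ≤ limMean S := by
  obtain ⟨y, hy⟩ := exists_forall_errorSlope_pos hS
  exact le_csSup ⟨y, fun z hz => (lt_of_eventually_errorSlope hS hz (.of_forall hy)).le⟩ hx

theorem limMean_le (hS : IsPosFamily S) (hy : ∀ᶠ q in 𝓝[>] (0 : ℝ), 0 < errorSlope q S y) :
    limMean S ≤ y := by
  obtain ⟨x, hx⟩ := exists_forall_errorSlope_neg hS
  exact csSup_le ⟨x, Eventually.of_forall (f := 𝓝[>] 0) hx⟩ fun z hz =>
    (lt_of_eventually_errorSlope hS hz hy).le

theorem LiesBelow.limMean_lt (hS : IsPosFamily S) (h : LiesBelow S y) : limMean S < y := by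
  obtain ⟨x, hxy, hx⟩ := h.exists_errorSlope_pos hS.weight_pos
  exact (limMean_le hS hx).trans_lt hxy

theorem LiesBelow.lt_limMean_of_reflect (hS : IsPosFamily S) (h : LiesBelow (reflect S) (-y)) :
    y < limMean S := by
  obtain ⟨x, hxy, hx⟩ := h.exists_errorSlope_pos hS.reflect.weight_pos
  rw [← neg_neg x] at hx
  exact (lt_neg.2 hxy).trans_le (le_limMean hS (eventually_errorSlope_neg_of_reflect hx))

theorem liesAt_limMean (hS : IsPosFamily S) : LiesAt S (limMean S) := by
  rcases liesBelow_or_liesAt_or_liesBelow_reflect hS.weight_pos (limMean S) with h | h | h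
  · exact absurd (h.limMean_lt hS) (lt_irrefl _)
  · exact h
  · exact absurd (h.lt_limMean_of_reflect hS) (lt_irrefl _)

theorem eventually_errorSlope_neg_of_lt_limMean (hS : IsPosFamily S) (hx : x < limMean S) :
    ∀ᶠ q in 𝓝[>] (0 : ℝ), errorSlope q S x < 0 :=
  (liesAt_limMean hS).eventually_errorSlope_neg hS hx

theorem LiesAt.eventually_errorSlope_pos (hS : IsPosFamily S) (h : LiesAt S y) (hxy : y < x) :
    ∀ᶠ q in 𝓝[>] (0 : ℝ), 0 < errorSlope q S x := by
  simpa only [errorSlope_reflect, neg_lt_zero] using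
    h.reflect.eventually_errorSlope_neg hS.reflect (neg_lt_neg hxy)

theorem eventually_errorSlope_pos_of_limMean_lt (hS : IsPosFamily S) (hx : limMean S < x) :
    ∀ᶠ q in 𝓝[>] (0 : ℝ), 0 < errorSlope q S x :=
  (liesAt_limMean hS).eventually_errorSlope_pos hS hx

theorem LiesAt.limMean_eq (hS : IsPosFamily S) (h : LiesAt S y) : limMean S = y :=
  le_antisymm
    (le_of_forall_gt_imp_ge_of_dense fun _ hx => limMean_le hS (h.eventually_errorSlope_pos hS hx))
    (le_of_forall_lt_imp_le_of_dense fun _ hx => le_limMean hS (h.eventually_errorSlope_neg hS hx))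

theorem limMean_reflect (hS : IsPosFamily S) : limMean (reflect S) = -limMean S :=
  (liesAt_limMean hS).reflect.limMean_eq hS.reflect

theorem limMean_eq_of_perm {T : List (ℝ × ℝ)} (h : S.Perm T) : limMean S = limMean T := by
  simp only [limMean, errorSlope, weightedSum, (h.map _).sum_eq]

theorem limMean_le_of_forall_le (hS : IsPosFamily S) (h : ∀ r ∈ S, r.1 ≤ y) : limMean S ≤ y := by
  refine le_of_forall_gt_imp_ge_of_dense fun z hz => limMean_le hS (.of_forall fun q => ?_)
  exact weightedSum_pos hS fun r hr => signPow_pos (sub_pos.2 ((h r hr).trans_lt hz))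

theorem le_limMean_of_forall_le (hS : IsPosFamily S) (h : ∀ r ∈ S, y ≤ r.1) : y ≤ limMean S := by
  rw [← neg_le_neg_iff, ← limMean_reflect hS]
  refine limMean_le_of_forall_le hS.reflect (List.forall_mem_map.2 fun r hr => ?_)
  exact neg_le_neg (h r hr)

theorem tendsto_sub_one_nhdsGT : Tendsto (fun p : ℝ => p - 1) (𝓝[>] 1) (𝓝[>] 0) := by
  refine tendsto_nhdsWithin_iff.2 ⟨?_, eventually_mem_nhdsWithin.mono fun p hp => ?_⟩
  · exact ((continuous_sub_right (1 : ℝ)).tendsto' _ _ (sub_self 1)).mono_left nhdsWithin_le_nhds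
  · exact sub_pos.2 (Set.mem_Ioi.1 hp)

theorem eventually_lt_of_errorSlope_nonpos (hS : IsPosFamily S) {m : ℝ → ℝ}
    (hm : ∀ p > 1, errorSlope (p - 1) S (m p) ≤ 0) (hy : limMean S < y) :
    ∀ᶠ p in 𝓝[>] 1, m p < y := by
  filter_upwards [tendsto_sub_one_nhdsGT.eventually
    (eventually_errorSlope_pos_of_limMean_lt hS hy), self_mem_nhdsWithin] with p hp hp1
  exact (errorSlope_strictMono (sub_pos.2 hp1) hS).lt_iff_lt.1 ((hm p hp1).trans_lt hp)

theorem eventually_lt_of_errorSlope_nonneg (hS : IsPosFamily S) {m : ℝ → ℝ}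
    (hm : ∀ p > 1, 0 ≤ errorSlope (p - 1) S (m p)) (hy : y < limMean S) :
    ∀ᶠ p in 𝓝[>] 1, y < m p := by
  filter_upwards [tendsto_sub_one_nhdsGT.eventually
    (eventually_errorSlope_neg_of_lt_limMean hS hy), self_mem_nhdsWithin] with p hp hp1
  exact (errorSlope_strictMono (sub_pos.2 hp1) hS).lt_iff_lt.1 (hp.trans_le (hm p hp1))

end LimMean

/-! ### Minimizers of the `L_p` error -/

section Minimizers

variable {V : Type*} [Fintype V] {p : ℝ} {f w h : V → ℝ}

theorem continuous_lpError (hp : 0 ≤ p) (f w : V → ℝ) : Continuous (lpError p f w) :=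
  continuous_finsetSum _ fun _ _ => continuous_const.mul <|
    Continuous.rpow_const (by fun_prop) fun _ => Or.inr hp

theorem abs_sub_le_of_lpError_le (hp : 0 < p) (hw : ∀ v, 0 < w v) {E : ℝ}
    (hE : lpError p f w h ≤ E) (v : V) : |h v - f v| ≤ (E / w v) ^ p⁻¹ := by
  have hterm : w v * |f v - h v| ^ p ≤ E :=
    (Finset.single_le_sum (f := fun v => w v * |f v - h v| ^ p)
      (fun u _ => mul_nonneg (hw u).le (by positivity)) (Finset.mem_univ v)).trans hE
  rw [abs_sub_comm, ← Real.rpow_rpow_inv (abs_nonneg (f v - h v)) hp.ne']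
  gcongr
  rwa [le_div_iff₀ (hw v), mul_comm]

theorem exists_isMinOn_lpError (hp : 0 < p) (f : V → ℝ) (hw : ∀ v, 0 < w v) {K : Set (V → ℝ)}
    (hK : IsClosed K) (hne : K.Nonempty) : ∃ g ∈ K, IsMinOn (lpError p f w) K g := by
  obtain ⟨h₀, hh₀⟩ := hne
  set R : V → ℝ := fun v => (lpError p f w h₀ / w v) ^ p⁻¹
  refine (continuous_lpError hp.le f w).continuousOn.exists_isMinOn' hK hh₀ ?_
  rw [Filter.eventually_inf_principal]
  refine Filter.mem_cocompact.2 ⟨Set.Icc (f - R) (f + R), isCompact_Icc, fun h hh _ => ?_⟩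
  by_contra! hlt
  refine hh (Set.mem_Icc.2 ⟨fun v => ?_, fun v => ?_⟩) <;>
    · have := abs_le.1 (abs_sub_le_of_lpError_le hp hw hlt.le v)
      simp only [Pi.sub_apply, Pi.add_apply, R]
      linarith

theorem exists_isLpRegression [Preorder V] (hp : 0 < p) (f : V → ℝ) (hw : ∀ v, 0 < w v) :
    ∃ g, IsLpRegression p f w g :=
  exists_isMinOn_lpError hp f hw isClosed_monotone ⟨0, monotone_const⟩

end Minimizers

section Means

variable {S : List (ℝ × ℝ)}

theorem exists_isLpMean {p : ℝ} (hp : 0 < p) (hw : ∀ r ∈ S, 0 < r.2) : ∃ c, IsLpMean p S c := by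
  let K : Submodule ℝ (Fin S.length → ℝ) := ℝ ∙ 1
  obtain ⟨_, hgK, hmin⟩ := exists_isMinOn_lpError hp (fun i : Fin S.length => S[i].1)
    (w := fun i => S[i].2) (fun i => hw _ (List.getElem_mem _))
    K.closed_of_finiteDimensional ⟨0, K.zero_mem⟩
  obtain ⟨c, rfl⟩ := Submodule.mem_span_singleton.1 hgK
  have hconst (z : ℝ) : lpError p (fun i : Fin S.length => S[i].1) (fun i => S[i].2)
      (z • 1) = (S.map fun r => r.2 * |r.1 - z| ^ p).sum := by
    simpa [lpError] using Fin.sum_univ_fun_getElem S fun r => r.2 * |r.1 - z| ^ p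
  refine ⟨c, fun z => ?_⟩
  rw [← hconst, ← hconst]
  exact hmin (Submodule.smul_mem _ z (Submodule.mem_span_singleton_self 1))

theorem hasDerivAt_blockError {q : ℝ} (hq : 0 < q) (S : List (ℝ × ℝ)) (c : ℝ) :
    HasDerivAt (fun z => (S.map fun r => r.2 * |r.1 - z| ^ (q + 1)).sum)
      ((q + 1) * errorSlope q S c) c := by
  convert hasDerivAt_weightedSum (S := S) (hasDerivAt_abs_rpow_add_one hq) c using 1
  · simp only [weightedSum, abs_sub_comm, funext_iff, implies_true]
  · simp only [errorSlope, weightedSum, ← List.sum_map_mul_left, mul_left_comm]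

theorem IsLpMean.errorSlope_eq_zero {p c : ℝ} (hp : 1 < p) (h : IsLpMean p S c) :
    errorSlope (p - 1) S c = 0 := by
  have hderiv := hasDerivAt_blockError (sub_pos.2 hp) S c
  rw [sub_add_cancel] at hderiv
  have hmin : IsLocalMin (fun z => (S.map fun r => r.2 * |r.1 - z| ^ p).sum) c := .of_forall h
  exact (mul_eq_zero.1 (hmin.hasDerivAt_eq_zero hderiv)).resolve_left (by linarith)

theorem tendsto_limMean (hS : IsPosFamily S) {m : ℝ → ℝ} (hm : ∀ p, 1 < p → IsLpMean p S (m p)) :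
    Tendsto m (𝓝[>] 1) (𝓝 (limMean S)) := by
  have hslope : ∀ p > 1, errorSlope (p - 1) S (m p) = 0 := fun p hp =>
    (hm p hp).errorSlope_eq_zero hp
  exact tendsto_order.2
    ⟨fun _ => eventually_lt_of_errorSlope_nonneg hS fun p hp => (hslope p hp).ge,
      fun _ => eventually_lt_of_errorSlope_nonpos hS fun p hp => (hslope p hp).le⟩

theorem isMeanDownOne_iff (hS : IsPosFamily S) (c : ℝ) : IsMeanDownOne S c ↔ c = limMean S := by
  constructor
  · rintro ⟨m, hm, hlim⟩
    exact tendsto_nhds_unique hlim (tendsto_limMean hS hm)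
  · rintro rfl
    have hmean (p : ℝ) : ∃ c, 1 < p → IsLpMean p S c := by
      by_cases hp : 1 < p
      · exact (exists_isLpMean (by linarith) hS.weight_pos).imp fun c hc _ => hc
      · exact ⟨0, fun h => absurd h hp⟩
    choose m hm using hmean
    exact ⟨m, hm, tendsto_limMean hS hm⟩

end Means

/-! ### The limit of the isotonic regressions -/

section Regression

variable {V : Type*} {f w g g' : V → ℝ} {A : Finset V} {c : ℝ}

/-- The values and weights on the set `A`, as a family. -/
noncomputable def family (f w : V → ℝ) (A : Finset V) : List (ℝ × ℝ) :=
  A.toList.map fun v => (f v, w v)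

theorem weightedSum_family (φ : ℝ → ℝ) (y : ℝ) :
    weightedSum φ (family f w A) y = ∑ v ∈ A, w v * φ (y - f v) := by
  simp [weightedSum, family, Function.comp_def]

theorem isPosFamily_family (hw : ∀ v, 0 < w v) (hA : A.Nonempty) : IsPosFamily (family f w A) :=
  ⟨by simpa [family] using hA.ne_empty, by simp [family, hw]⟩

theorem family_neg : family (-f) w A = reflect (family f w A) := by
  simp [family, reflect]

theorem hasDerivAt_lpError_add_smul [Fintype V] {q : ℝ} (hq : 0 < q) (f w r d : V → ℝ) :
    HasDerivAt (fun t : ℝ => lpError (q + 1) f w (r + t • d))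
      ((q + 1) * ∑ v, w v * signPow q (r v - f v) * d v) 0 := by
  rw [Finset.mul_sum]
  refine HasDerivAt.fun_sum fun v _ => ?_
  have hline : HasDerivAt (fun t : ℝ => r v + t * d v - f v) (d v) 0 := by
    simpa using (((hasDerivAt_id (0 : ℝ)).mul_const (d v)).const_add (r v)).sub_const (f v)
  have hterm := ((hasDerivAt_abs_rpow_add_one hq _).comp (0 : ℝ) hline).const_mul (w v)
  refine (hterm.congr_deriv ?_).congr_of_eventuallyEq (.of_forall fun t => ?_)
  · simp only [zero_mul, add_zero]
    ring
  · simp only [Pi.add_apply, Pi.smul_apply, smul_eq_mul, Function.comp_apply, abs_sub_comm (f v)]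

variable [Preorder V]

/-- `A` lies at the lower end of the upper level set `{c ≤ g}`: lowering `g` slightly on `A` keeps
it monotone. -/
def IsLowerBlock (g : V → ℝ) (c : ℝ) (A : Finset V) : Prop :=
  (∀ v ∈ A, c ≤ g v) ∧ ∀ u ∉ A, ∀ v ∈ A, u ≤ v → g u < c

/-- `A` lies at the upper end of the lower level set `{g ≤ c}`. -/
def IsUpperBlock (g : V → ℝ) (c : ℝ) (A : Finset V) : Prop :=
  (∀ v ∈ A, g v ≤ c) ∧ ∀ u ∉ A, ∀ v ∈ A, v ≤ u → c < g u

/-- The order-theoretic characterization of the limit of the `L_p` regressions as `p ↘ 1`. -/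
structure IsStable (f w g : V → ℝ) : Prop where
  mono : Monotone g
  le_limMean : ∀ {A : Finset V} {c : ℝ}, A.Nonempty → IsLowerBlock g c A →
    c ≤ limMean (family f w A)
  limMean_le : ∀ {A : Finset V} {c : ℝ}, A.Nonempty → IsUpperBlock g c A →
    limMean (family f w A) ≤ c

theorem IsUpperBlock.neg (h : IsUpperBlock g c A) : IsLowerBlock (V := Vᵒᵈ) (-g) (-c) A :=
  ⟨fun v hv => neg_le_neg (h.1 v hv), fun u hu v hv huv => neg_lt_neg (h.2 u hu v hv huv)⟩

section Uniqueness

variable [Finite V]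

open Classical in
/-- Compare the means of the block `{g ≤ g v < g'}`, which is an upper block for `g` and a lower
block for `g'`. -/
theorem IsStable.le (hg : IsStable f w g) (hg' : IsStable f w g') : g' ≤ g := by
  have := Fintype.ofFinite V
  intro v
  by_contra! hlt
  set A : Finset V := {u | g u ≤ g v ∧ g v < g' u} with hA
  have hAne : A.Nonempty := ⟨v, by simpa [hA] using hlt⟩
  obtain ⟨m, hmA, hm⟩ := A.exists_min_image g' hAne
  simp only [hA, Finset.mem_filter_univ] at hmA hm
  have hupper : IsUpperBlock g (g v) A := by
    simp only [IsUpperBlock, hA, Finset.mem_filter_univ]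
    refine ⟨fun u hu => hu.1, fun u hu z hz hzu => ?_⟩
    by_contra! hle
    exact hu ⟨hle, hz.2.trans_le (hg'.mono hzu)⟩
  have hlower : IsLowerBlock g' (g' m) A := by
    simp only [IsLowerBlock, hA, Finset.mem_filter_univ]
    refine ⟨hm, fun u hu z hz huz => ?_⟩
    by_contra! hle
    exact hu ⟨(hg.mono huz).trans hz.1, hmA.2.trans_le hle⟩
  exact (hmA.2.trans_le ((hg'.le_limMean hAne hlower).trans (hg.limMean_le hAne hupper))).false

theorem IsStable.unique (hg : IsStable f w g) (hg' : IsStable f w g') : g = g' :=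
  le_antisymm (hg'.le hg) (hg.le hg')

end Uniqueness

theorem IsLowerBlock.eventually_monotone_add_smul [Finite V] (hA : IsLowerBlock g c A)
    (hg : Monotone g) :
    ∀ᶠ t in 𝓝[>] (0 : ℝ), Monotone (g + t • (A : Set V).indicator (-1)) := by
  have hsmall : ∀ᶠ t in 𝓝[>] (0 : ℝ), ∀ u v, u ∉ A → v ∈ A → u ≤ v → t ≤ g v - g u := by
    simp only [eventually_all]
    intro u v hu hv huv
    have hlt : g u < g v := (hA.2 u hu v hv huv).trans_le (hA.1 v hv)
    filter_upwards [Ioc_mem_nhdsGT (sub_pos.2 hlt)] with t ht using ht.2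
  filter_upwards [hsmall, self_mem_nhdsWithin] with t ht ht0 u v huv
  have ht0 : 0 < t := ht0
  have hguv := hg huv
  classical
  have heval (z : V) :
      (g + t • (A : Set V).indicator (-1 : V → ℝ)) z = g z - if z ∈ A then t else 0 := by
    by_cases hz : z ∈ A <;> simp [hz, sub_eq_add_neg]
  rw [heval, heval]
  split_ifs with hu hv hv
  · linarith
  · linarith
  · linarith [ht u v hu hv huv]
  · linarith

section FirstVariation

variable [Fintype V] {p q : ℝ} {r : V → ℝ}

theorem IsLpRegression.neg (hr : IsLpRegression p f w r) :
    IsLpRegression (V := Vᵒᵈ) p (-f) w (-r) := by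
  have herr (h : V → ℝ) : lpError p (-f) w (-h) = lpError p f w h := by
    simp only [lpError, Pi.neg_apply, neg_sub_neg, abs_sub_comm (f _)]
  refine ⟨fun u v huv => neg_le_neg (hr.1 huv), fun h hh => ?_⟩
  have hle : lpError p f w r ≤ lpError p f w (-h) :=
    hr.2 (-h) fun u v huv => neg_le_neg (hh huv)
  calc lpError p (-f) w (-r) = lpError p f w r := herr r
    _ ≤ lpError p f w (-h) := hle
    _ = lpError p (-f) w (- -h) := (herr (-h)).symm
    _ = lpError p (-f) w h := by rw [neg_neg]

theorem IsLpRegression.first_variation_nonneg (hq : 0 < q) (hr : IsLpRegression (q + 1) f w r)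
    {d : V → ℝ} (hd : ∀ᶠ t in 𝓝[>] (0 : ℝ), Monotone (r + t • d)) :
    0 ≤ ∑ v, w v * signPow q (r v - f v) * d v := by
  have hslope := (hasDerivAt_lpError_add_smul hq f w r d).tendsto_slope.mono_left
    (nhdsWithin_mono (0 : ℝ) (s := Set.Ioi 0) fun t ht => ht.ne')
  refine nonneg_of_mul_nonneg_right (ge_of_tendsto hslope ?_) (by linarith : 0 < q + 1)
  filter_upwards [hd, self_mem_nhdsWithin] with t ht ht0
  rw [slope_def_field, sub_zero, zero_smul, add_zero]
  exact div_nonneg (sub_nonneg.2 (hr.2 _ ht)) (le_of_lt ht0)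

theorem IsLpRegression.errorSlope_nonpos (hq : 0 < q) (hw : ∀ v, 0 < w v)
    (hr : IsLpRegression (q + 1) f w r) (hA : IsLowerBlock r c A) :
    errorSlope q (family f w A) c ≤ 0 := by
  have hvar := hr.first_variation_nonneg hq (hA.eventually_monotone_add_smul hr.1)
  have hsum : ∑ v ∈ A, w v * signPow q (r v - f v) ≤ 0 := by
    classical
    simpa [Set.indicator_apply, Finset.sum_ite_mem] using hvar
  rw [errorSlope, weightedSum_family]
  refine (Finset.sum_le_sum fun v hv => ?_).trans hsum
  have := (signPow_strictMono hq).monotone (sub_le_sub_right (hA.1 v hv) (f v))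
  exact mul_le_mul_of_nonneg_left this (hw v).le

end FirstVariation

theorem IsLowerBlock.eventually_nhdsLT [Finite V] (hA : IsLowerBlock g c A) :
    ∀ᶠ c' in 𝓝[<] c, ∀ᶠ h in 𝓝 g, IsLowerBlock h c' A := by
  have hbelow : ∀ᶠ c' in 𝓝[<] c, ∀ u v, u ∉ A → v ∈ A → u ≤ v → g u < c' := by
    simp only [eventually_all]
    exact fun u v hu hv huv => (lt_mem_nhds (hA.2 u hu v hv huv)).filter_mono nhdsWithin_le_nhds
  have hcoord (u : V) : Tendsto (fun h : V → ℝ => h u) (𝓝 g) (𝓝 (g u)) :=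
    (continuous_apply u).tendsto g
  filter_upwards [hbelow, self_mem_nhdsWithin] with c' hc' hlt
  simp only [IsLowerBlock, eventually_and, eventually_all]
  refine ⟨fun v hv => ?_, fun u hu v hv huv => ?_⟩
  · exact (hcoord v).eventually ((lt_mem_nhds (hlt.trans_le (hA.1 v hv))).mono fun _ => le_of_lt)
  · exact (hcoord u).eventually (gt_mem_nhds (hc' u v hu hv huv))

section Limit

variable [Fintype V] {r : ℝ → V → ℝ} {F : Filter ℝ}

theorem le_limMean_of_tendsto (hw : ∀ v, 0 < w v) (hr : ∀ p, 1 < p → IsLpRegression p f w (r p))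
    [F.NeBot] (hF : F ≤ 𝓝[>] 1) (hg : Tendsto r F (𝓝 g)) (hA : A.Nonempty)
    (hlow : IsLowerBlock g c A) : c ≤ limMean (family f w A) := by
  have hS := isPosFamily_family (f := f) hw hA
  by_contra! hlt
  obtain ⟨c', hblock, hc'⟩ := (hlow.eventually_nhdsLT.and (Ioo_mem_nhdsLT hlt)).exists
  have hpos : ∀ᶠ p in F, 0 < errorSlope (p - 1) (family f w A) c' := hF <|
    tendsto_sub_one_nhdsGT.eventually (eventually_errorSlope_pos_of_limMean_lt hS hc'.1)
  have hp1 : ∀ᶠ p in F, 1 < p := hF self_mem_nhdsWithin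
  obtain ⟨p, ⟨hp, hp1⟩, hpos⟩ := (((hg.eventually hblock).and hp1).and hpos).exists
  have hreg : IsLpRegression (p - 1 + 1) f w (r p) := by simpa using hr p hp1
  exact hpos.not_ge (hreg.errorSlope_nonpos (sub_pos.2 hp1) hw hp)

theorem isStable_of_tendsto (hw : ∀ v, 0 < w v) (hr : ∀ p, 1 < p → IsLpRegression p f w (r p))
    [F.NeBot] (hF : F ≤ 𝓝[>] 1) (hg : Tendsto r F (𝓝 g)) : IsStable f w g where
  mono := isClosed_monotone.mem_of_tendsto hg <|
    (show ∀ᶠ p in F, 1 < p from hF self_mem_nhdsWithin).mono fun p hp => (hr p hp).1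
  le_limMean := le_limMean_of_tendsto hw hr hF hg
  limMean_le {A c} hA hup := by
    rw [← neg_le_neg_iff, ← limMean_reflect (isPosFamily_family hw hA), ← family_neg]
    exact le_limMean_of_tendsto (V := Vᵒᵈ) hw (fun p hp => (hr p hp).neg) hF hg.neg hA hup.neg

theorem IsLpRegression.le_of_forall_le {p : ℝ} (hp : 0 < p) (hw : ∀ v, 0 < w v)
    (hg : IsLpRegression p f w g) {b : ℝ} (hf : ∀ v, f v ≤ b) (v : V) : g v ≤ b := by
  by_contra! hlt
  have habs (u : V) : |f u - min (g u) b| ≤ |f u - g u| := by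
    rcases le_total (g u) b with h | h
    · rw [min_eq_left h]
    · rw [min_eq_right h, abs_of_nonpos (by linarith [hf u]), abs_of_nonpos (by linarith [hf u])]
      linarith
  have habs_lt : |f v - min (g v) b| < |f v - g v| := by
    rw [min_eq_right hlt.le, abs_of_nonpos (by linarith [hf v]),
      abs_of_nonpos (by linarith [hf v])]
    linarith
  refine (hg.2 _ (hg.1.min (monotone_const (c := b)))).not_gt ?_
  refine Finset.sum_lt_sum (fun u _ => ?_) ⟨v, Finset.mem_univ v, ?_⟩
  · exact mul_le_mul_of_nonneg_left (Real.rpow_le_rpow (abs_nonneg _) (habs u) hp.le) (hw u).le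
  · exact mul_lt_mul_of_pos_left (Real.rpow_lt_rpow (abs_nonneg _) habs_lt hp) (hw v)

theorem IsLpRegression.norm_le {p : ℝ} (hp : 0 < p) (hw : ∀ v, 0 < w v)
    (hg : IsLpRegression p f w g) : ‖g‖ ≤ ‖f‖ := by
  have hf (v : V) := abs_le.1 (norm_le_pi_norm f v)
  refine (pi_norm_le_iff_of_nonneg (norm_nonneg f)).2 fun v => abs_le.2 ⟨?_, ?_⟩
  · exact neg_le.1 <|
      IsLpRegression.le_of_forall_le (V := Vᵒᵈ) hp hw hg.neg (fun u => neg_le.1 (hf u).1) v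
  · exact hg.le_of_forall_le hp hw (fun u => (hf u).2) v

theorem eventually_mem_closedBall (hw : ∀ v, 0 < w v)
    (hr : ∀ p, 1 < p → IsLpRegression p f w (r p)) :
    ∀ᶠ p in 𝓝[>] (1 : ℝ), r p ∈ Metric.closedBall 0 ‖f‖ := by
  filter_upwards [self_mem_nhdsWithin] with p hp
  exact mem_closedBall_zero_iff.2 ((hr p hp).norm_le (zero_lt_one.trans hp) hw)

theorem isStable_of_mapClusterPt (hw : ∀ v, 0 < w v)
    (hr : ∀ p, 1 < p → IsLpRegression p f w (r p)) (hg : MapClusterPt g (𝓝[>] 1) r) :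
    IsStable f w g :=
  have ⟨_, hF, hlim⟩ := mapClusterPt_iff_ultrafilter.1 hg
  isStable_of_tendsto hw hr hF hlim

theorem IsStable.tendsto (hw : ∀ v, 0 < w v) (hg : IsStable f w g)
    (hr : ∀ p, 1 < p → IsLpRegression p f w (r p)) : Tendsto r (𝓝[>] 1) (𝓝 g) :=
  (isCompact_closedBall 0 ‖f‖).tendsto_nhds_of_unique_mapClusterPt
    (eventually_mem_closedBall hw hr) fun _ _ hg' =>
      (isStable_of_mapClusterPt hw hr hg').unique hg

theorem exists_forall_isLpRegression (f : V → ℝ) (hw : ∀ v, 0 < w v) :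
    ∃ r : ℝ → V → ℝ, ∀ p, 1 < p → IsLpRegression p f w (r p) := by
  have hreg (p : ℝ) : ∃ g, 1 < p → IsLpRegression p f w g := by
    by_cases hp : 1 < p
    · exact (exists_isLpRegression (zero_lt_one.trans hp) f hw).imp fun g hg _ => hg
    · exact ⟨0, fun h => absurd h hp⟩
  exact ⟨_, fun p => (hreg p).choose_spec⟩

theorem IsStable.isStrictDownOne_iff (hw : ∀ v, 0 < w v) (hg : IsStable f w g) :
    IsStrictDownOne f w g' ↔ g' = g := by
  constructor
  · rintro ⟨r, hr, hlim⟩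
    exact tendsto_nhds_unique hlim (hg.tendsto hw hr)
  · rintro rfl
    obtain ⟨r, hr⟩ := exists_forall_isLpRegression f hw
    exact ⟨r, hr, hg.tendsto hw hr⟩

end Limit

theorem exists_isStable [Finite V] (f : V → ℝ) (hw : ∀ v, 0 < w v) : ∃ g, IsStable f w g := by
  have := Fintype.ofFinite V
  obtain ⟨r, hr⟩ := exists_forall_isLpRegression f hw
  obtain ⟨g, -, hg⟩ := (isCompact_closedBall 0 ‖f‖).exists_mapClusterPt
    (tendsto_principal.2 (eventually_mem_closedBall hw hr))
  exact ⟨g, isStable_of_mapClusterPt hw hr hg⟩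

end Regression

/-! ### Blocks of consecutive vertices -/

/-- A vertex of a linear order as a triple ((value, weight), regression value); a block of
consecutive vertices is a list of cells. -/
abbrev Cell := (ℝ × ℝ) × ℝ

/-- The limit mean of the data of a block, regardless of its regression values. -/
noncomputable def cellMean (Q : List Cell) : ℝ := limMean (Q.map Prod.fst)

/-- The regression values on a block agree. -/
def IsConstant (Q : List Cell) : Prop := ∀ x ∈ Q, ∀ y ∈ Q, x.2 = y.2

/-- The counterpart of `IsStable` for a linear order that is given as the list `E` of its
vertices. -/
structure StableCells (E : List Cell) : Prop where
  pos : ∀ e ∈ E, 0 < e.1.2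
  mono : E.Pairwise fun e e' => e.2 ≤ e'.2
  le_cellMean : ∀ {P Q R : List Cell} {c : ℝ}, E = P ++ Q ++ R → Q ≠ [] → (∀ e ∈ P, e.2 < c) →
    (∀ e ∈ Q, c ≤ e.2) → c ≤ cellMean Q
  cellMean_le : ∀ {P Q R : List Cell} {c : ℝ}, E = P ++ Q ++ R → Q ≠ [] → (∀ e ∈ Q, e.2 ≤ c) →
    (∀ e ∈ R, c < e.2) → cellMean Q ≤ c

/-- The vertices of a weighted function `(f, w)` on `Fin n` with regression `g`, in order. -/
def cellsOf {n : ℕ} (f w g : Fin n → ℝ) : List Cell :=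
  (List.finRange n).map fun i => ((f i, w i), g i)

section CellsOf

variable {n : ℕ} {f w g : Fin n → ℝ}

theorem map_fst_cellsOf : (cellsOf f w g).map Prod.fst = dataOf f w := by
  simp [cellsOf, dataOf, List.ofFn_eq_map]

theorem length_cellsOf : (cellsOf f w g).length = n := by
  simp [cellsOf]

theorem cellMean_map_eq_limMean_family {q : List (Fin n)} (hq : q.Nodup) :
    cellMean (q.map fun i => ((f i, w i), g i)) = limMean (family f w q.toFinset) := by
  rw [cellMean, List.map_map]
  exact limMean_eq_of_perm ((List.toFinset_toList hq).map _).symm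

theorem isLowerBlock_of_finRange_eq {p q r : List (Fin n)} (hpqr : List.finRange n = p ++ q ++ r)
    {c : ℝ} (hp : ∀ i ∈ p, g i < c) (hq : ∀ i ∈ q, c ≤ g i) : IsLowerBlock g c q.toFinset := by
  have hsorted := (List.sortedLT_finRange n).pairwise
  rw [hpqr, List.pairwise_append] at hsorted
  simp only [IsLowerBlock, List.mem_toFinset]
  refine ⟨hq, fun u hu v hv huv => hp u ?_⟩
  have hmem : u ∈ p ++ q ++ r := hpqr ▸ List.mem_finRange u
  have hur : u ∉ r := fun hur =>
    (hsorted.2.2 v (List.mem_append_right p hv) u hur).not_ge huv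
  simpa [hu, hur] using hmem

theorem isUpperBlock_of_finRange_eq {p q r : List (Fin n)} (hpqr : List.finRange n = p ++ q ++ r)
    {c : ℝ} (hq : ∀ i ∈ q, g i ≤ c) (hr : ∀ i ∈ r, c < g i) : IsUpperBlock g c q.toFinset := by
  have hsorted := (List.sortedLT_finRange n).pairwise
  rw [hpqr, List.append_assoc, List.pairwise_append] at hsorted
  simp only [IsUpperBlock, List.mem_toFinset]
  refine ⟨hq, fun u hu v hv hvu => hr u ?_⟩
  have hmem : u ∈ p ++ q ++ r := hpqr ▸ List.mem_finRange u
  have hup : u ∉ p := fun hup =>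
    (hsorted.2.2 u hup v (List.mem_append_left r hv)).not_ge hvu
  simpa [hu, hup] using hmem

theorem exists_finRange_eq_append {P Q R : List Cell} (h : cellsOf f w g = P ++ Q ++ R) :
    ∃ p q r : List (Fin n), List.finRange n = p ++ q ++ r ∧
      P = p.map (fun i => ((f i, w i), g i)) ∧ Q = q.map (fun i => ((f i, w i), g i)) ∧
      R = r.map (fun i => ((f i, w i), g i)) := by
  obtain ⟨pq, r, hpqr, hPQ, rfl⟩ := List.map_eq_append_iff.1 h
  obtain ⟨p, q, rfl, rfl, rfl⟩ := List.map_eq_append_iff.1 hPQ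
  exact ⟨p, q, r, hpqr, rfl, rfl, rfl⟩

theorem IsStable.stableCells (hw : ∀ i, 0 < w i) (hg : IsStable f w g) :
    StableCells (cellsOf f w g) where
  pos := by simp [cellsOf, hw]
  mono := List.pairwise_map.2 <|
    (List.sortedLT_finRange n).pairwise.imp fun hij => hg.mono hij.le
  le_cellMean {P Q R c} hPQR hQ hPc hQc := by
    obtain ⟨p, q, r, hpqr, rfl, rfl, rfl⟩ := exists_finRange_eq_append hPQR
    rw [List.forall_mem_map] at hPc hQc
    have hnodup := hpqr ▸ List.nodup_finRange n
    rw [cellMean_map_eq_limMean_family hnodup.of_append_left.of_append_right]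
    exact hg.le_limMean (by simpa using hQ) (isLowerBlock_of_finRange_eq hpqr hPc hQc)
  cellMean_le {P Q R c} hPQR hQ hQc hRc := by
    obtain ⟨p, q, r, hpqr, rfl, rfl, rfl⟩ := exists_finRange_eq_append hPQR
    rw [List.forall_mem_map] at hQc hRc
    have hnodup := hpqr ▸ List.nodup_finRange n
    rw [cellMean_map_eq_limMean_family hnodup.of_append_left.of_append_right]
    exact hg.limMean_le (by simpa using hQ) (isUpperBlock_of_finRange_eq hpqr hQc hRc)

end CellsOf

namespace StableCells

variable {E P Q Q' R : List Cell} {L : List (List Cell)}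

theorem isPosFamily (hE : StableCells E) (hne : Q ≠ []) (hsub : Q ⊆ E) :
    IsPosFamily (Q.map Prod.fst) :=
  ⟨by simpa using hne, List.forall_mem_map.2 fun e he => hE.pos e (hsub he)⟩

/-- For the first block, if any, whose regression values leave `S`, stability bounds them by the
mean of that block. -/
theorem forall_mem_of_isLowerSet (hE : StableCells E) {S : Set ℝ} (hS : IsLowerSet S)
    (hLR : E = L.flatten ++ R) (hne : ∀ Q ∈ L, Q ≠ []) (hconst : ∀ Q ∈ L, IsConstant Q)
    (hL : ∀ Q ∈ L, cellMean Q ∈ S ∨ ∀ e ∈ Q, e.2 ∈ S) : ∀ Q ∈ L, ∀ e ∈ Q, e.2 ∈ S := by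
  induction L using List.reverseRecOn generalizing R with
  | nil => simp
  | append_singleton L Q ih =>
    simp only [List.forall_mem_append, List.forall_mem_singleton] at hne hconst hL ⊢
    have hbefore : ∀ Q ∈ L, ∀ e ∈ Q, e.2 ∈ S :=
      ih (R := Q ++ R) (by simpa using hLR) hne.1 hconst.1 hL.1
    refine ⟨hbefore, hL.2.elim (fun hmean e he => ?_) id⟩
    by_contra heS
    have hlt : ∀ e' ∈ L.flatten, e'.2 < e.2 := fun e' he' => by
      obtain ⟨Q', hQ', he'⟩ := List.mem_flatten.1 he'
      by_contra! hle
      exact heS (hS hle (hbefore Q' hQ' e' he'))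
    have hle := hE.le_cellMean (by simpa using hLR) hne.2 hlt fun e' he' =>
      (hconst.2 e he e' he').le
    exact heS (hS hle hmean)

theorem forall_mem_of_isUpperSet (hE : StableCells E) {S : Set ℝ} (hS : IsUpperSet S)
    (hRL : E = R ++ L.flatten) (hne : ∀ Q ∈ L, Q ≠ []) (hconst : ∀ Q ∈ L, IsConstant Q)
    (hL : ∀ Q ∈ L, cellMean Q ∈ S ∨ ∀ e ∈ Q, e.2 ∈ S) : ∀ Q ∈ L, ∀ e ∈ Q, e.2 ∈ S := by
  induction L generalizing R with
  | nil => simp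
  | cons Q L ih =>
    simp only [List.forall_mem_cons] at hne hconst hL ⊢
    have hafter : ∀ Q ∈ L, ∀ e ∈ Q, e.2 ∈ S :=
      ih (R := R ++ Q) (by simpa using hRL) hne.2 hconst.2 hL.2
    refine ⟨hL.1.elim (fun hmean e he => ?_) id, hafter⟩
    by_contra heS
    have hlt : ∀ e' ∈ L.flatten, e.2 < e'.2 := fun e' he' => by
      obtain ⟨Q', hQ', he'⟩ := List.mem_flatten.1 he'
      by_contra! hle
      exact heS (hS hle (hafter Q' hQ' e' he'))
    have hle := hE.cellMean_le (by simpa using hRL) hne.1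
      (fun e' he' => (hconst.1 e' he' e he).le) hlt
    exact heS (hS hle hmean)

theorem le_of_forall_le (hE : StableCells E) {b : ℝ} (h : ∀ e ∈ E, e.1.1 ≤ b) :
    ∀ e ∈ E, e.2 ≤ b := fun e he =>
  hE.forall_mem_of_isLowerSet (isLowerSet_Iic b) (L := E.map fun e => [e]) (R := [])
    (by simp [← List.flatMap_def]) (List.forall_mem_map.2 fun _ _ => List.cons_ne_nil _ _)
    (List.forall_mem_map.2 fun _ _ => by simp [IsConstant])
    (List.forall_mem_map.2 fun e he => Or.inl <| limMean_le_of_forall_le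
      (hE.isPosFamily (List.cons_ne_nil _ _) (by simpa using he)) (by simpa using h e he))
    [e] (List.mem_map_of_mem he) e (List.mem_singleton_self e)

theorem ge_of_forall_ge (hE : StableCells E) {a : ℝ} (h : ∀ e ∈ E, a ≤ e.1.1) :
    ∀ e ∈ E, a ≤ e.2 := fun e he =>
  hE.forall_mem_of_isUpperSet (isUpperSet_Ici a) (L := E.map fun e => [e]) (R := [])
    (by simp [← List.flatMap_def]) (List.forall_mem_map.2 fun _ _ => List.cons_ne_nil _ _)
    (List.forall_mem_map.2 fun _ _ => by simp [IsConstant])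
    (List.forall_mem_map.2 fun e he => Or.inl <| le_limMean_of_forall_le
      (hE.isPosFamily (List.cons_ne_nil _ _) (by simpa using he)) (by simpa using h e he))
    [e] (List.mem_map_of_mem he) e (List.mem_singleton_self e)

theorem isConstant_append (hE : StableCells E) (hPQ : E = P ++ Q ++ Q' ++ R) (hQ : Q ≠ [])
    (hQ' : Q' ≠ []) (hc : IsConstant Q) (hc' : IsConstant Q') (hm : cellMean Q' < cellMean Q) :
    IsConstant (Q ++ Q') := by
  have hmono := hE.mono
  simp only [hPQ, List.pairwise_append, List.forall_mem_append] at hmono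
  obtain ⟨⟨⟨-, -, hPQ_le⟩, -, -, hQQ'_le⟩, -, -, hQ'R_le⟩ := hmono
  have heq : ∀ e ∈ Q, ∀ e' ∈ Q', e.2 = e'.2 := by
    intro e he e' he'
    refine (hQQ'_le e he e' he').eq_of_not_lt fun hlt => hm.not_ge ?_
    have hmean : cellMean Q ≤ e.2 :=
      hE.cellMean_le (R := Q' ++ R) (by simpa using hPQ) hQ (fun x hx => (hc x hx e he).le) <|
        List.forall_mem_append.2 ⟨fun x hx => hlt.trans_eq (hc' e' he' x hx),
          fun x hx => hlt.trans_le (hQ'R_le e' he' x hx)⟩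
    have hmean' : e'.2 ≤ cellMean Q' :=
      hE.le_cellMean (P := P ++ Q) hPQ hQ'
        (List.forall_mem_append.2 ⟨fun x hx => (hPQ_le x hx e he).trans_lt hlt,
          fun x hx => (hc x hx e he).trans_lt hlt⟩) fun x hx => (hc' e' he' x hx).le
    exact hmean.trans (hlt.le.trans hmean')
  simp only [IsConstant, List.forall_mem_append]
  exact ⟨fun e he => ⟨hc e he, heq e he⟩,
    fun e he => ⟨fun e' he' => (heq e' he' e he).symm, hc' e he⟩⟩

end StableCells

/-! ### Programs and their running times -/

/-- The program `c` halts with result `x`, and its number of steps is between `lo` and `hi`. -/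
def RunsIn {α : Type} (c : RAM α) (x : α) (lo hi : ℕ) : Prop :=
  ∃ t, lo ≤ t ∧ t ≤ hi ∧ ∀ s, c.run s = some (x, s + t)

namespace RunsIn

variable {α β : Type} {c : RAM α} {x : α} {k : α → RAM β} {y : β} {lo hi lo' hi' : ℕ}

theorem mono (h : RunsIn c x lo hi) (hlo : lo' ≤ lo) (hhi : hi ≤ hi') : RunsIn c x lo' hi' := by
  obtain ⟨t, hlo_t, hhi_t, ht⟩ := h
  exact ⟨t, hlo.trans hlo_t, hhi_t.trans hhi, ht⟩

theorem pure (x : α) : RunsIn (pure x : RAM α) x 0 0 :=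
  ⟨0, le_rfl, le_rfl, fun _ => rfl⟩

theorem bind (h : RunsIn c x lo hi) (hk : RunsIn (k x) y lo' hi') :
    RunsIn (c >>= k) y (lo + lo') (hi + hi') := by
  obtain ⟨t, hlo_t, hhi_t, ht⟩ := h
  obtain ⟨u, hlo_u, hhi_u, hu⟩ := hk
  refine ⟨t + u, add_le_add hlo_t hlo_u, add_le_add hhi_t hhi_u, fun s => ?_⟩
  rw [StateT.run_bind, ht]
  simp only [Option.bind_eq_bind, Option.bind_some, hu, add_assoc]

theorem tick_bind {k : Unit → RAM β} (hk : RunsIn (k ()) y lo hi) :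
    RunsIn (tick >>= k) y (1 + lo) (1 + hi) :=
  RunsIn.bind (x := ()) ⟨1, le_rfl, le_rfl, fun _ => rfl⟩ hk

theorem exists_haltsWith_between (h : RunsIn c x lo hi) :
    ∃ t, lo ≤ t ∧ t ≤ hi ∧ HaltsWith c x t := by
  obtain ⟨t, hlo_t, hhi_t, ht⟩ := h
  exact ⟨t, hlo_t, hhi_t, by simpa only [HaltsWith, zero_add] using ht 0⟩

theorem exists_haltsWith (h : RunsIn c x lo hi) : ∃ t, HaltsWith c x t :=
  h.exists_haltsWith_between.imp fun _ ht => ht.2.2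

theorem of_run (t : ℕ) (h : ∀ s, c.run s = some (x, s + t)) : RunsIn c x t t :=
  ⟨t, le_rfl, le_rfl, h⟩

end RunsIn

theorem run_tick (s : ℕ) : StateT.run tick s = some ((), s + 1) := rfl

theorem run_addR (x y : ℝ) (s : ℕ) : (addR x y).run s = some (x + y, s + 1) := rfl

theorem run_subR (x y : ℝ) (s : ℕ) : (subR x y).run s = some (x - y, s + 1) := rfl

theorem run_mulR (x y : ℝ) (s : ℕ) : (mulR x y).run s = some (x * y, s + 1) := rfl

theorem run_halfR (x : ℝ) (s : ℕ) : (halfR x).run s = some (x / 2, s + 1) := rfl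

theorem run_powR (x y : ℝ) (s : ℕ) : (powR x y).run s = some (x ^ y, s + 1) := rfl

theorem run_ltR (x y : ℝ) (s : ℕ) : (ltR x y).run s = some (decide (x < y), s + 1) := rfl

theorem run_leR (x y : ℝ) (s : ℕ) : (leR x y).run s = some (decide (x ≤ y), s + 1) := rfl

/-! ### Statistics of a block -/

namespace Stats

/-- The statistics of the union of two disjoint families with statistics `s` and `t`. -/
noncomputable def combine (s t : Stats) : Stats :=
  ⟨s.W + t.W, s.Slt + t.Slt, s.Seq + t.Seq, s.Sgt + t.Sgt, s.Plt * t.Plt, s.Pgt * t.Pgt⟩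

theorem combine_assoc (s t u : Stats) : (s.combine t).combine u = s.combine (t.combine u) := by
  simp only [combine, add_assoc, mul_assoc]

theorem empty_combine (s : Stats) : empty.combine s = s := by simp [combine, empty]

theorem combine_empty (s : Stats) : s.combine empty = s := by simp [combine, empty]

theorem of_nil (y : ℝ) : of y [] = empty := by simp [of, empty]

theorem of_append (y : ℝ) (S T : List (ℝ × ℝ)) : of y (S ++ T) = (of y S).combine (of y T) := by
  simp [of, combine]

theorem of_cons (y : ℝ) (r : ℝ × ℝ) (S : List (ℝ × ℝ)) :
    of y (r :: S) = (of y [r]).combine (of y S) :=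
  of_append y [r] S

theorem of_singleton_of_lt {y : ℝ} {r : ℝ × ℝ} (h : r.1 < y) :
    of y [r] = ⟨r.2, r.2, 0, 0, (y - r.1) ^ r.2, 1⟩ := by
  simp [of, h, h.ne, h.not_gt, abs_of_pos (sub_pos.2 h)]

theorem of_singleton_self (r : ℝ × ℝ) : of r.1 [r] = ⟨r.2, 0, r.2, 0, 1, 1⟩ := by
  simp [of]

theorem of_singleton_of_gt {y : ℝ} {r : ℝ × ℝ} (h : y < r.1) :
    of y [r] = ⟨r.2, 0, 0, r.2, 1, (r.1 - y) ^ r.2⟩ := by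
  simp [of, h, h.ne', h.not_gt, abs_of_neg (sub_neg.2 h)]

theorem of_W (y : ℝ) (S : List (ℝ × ℝ)) :
    (of y S).W = (of y S).Slt + (of y S).Seq + (of y S).Sgt := by
  induction S with
  | nil => simp [of_nil, empty]
  | cons r S ih =>
    rw [of_cons, combine, ih]
    rcases lt_trichotomy r.1 y with h | rfl | h
    · simp only [of_singleton_of_lt h]; ring
    · simp only [of_singleton_self]; ring
    · simp only [of_singleton_of_gt h]; ring

theorem of_Seq (y : ℝ) (S : List (ℝ × ℝ)) : (of y S).Seq = eqSum S y := by
  induction S with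
  | nil => simp [of_nil, empty, eqSum, weightedSum_nil]
  | cons r S ih =>
    rw [of_cons, combine, ih, eqSum, weightedSum_cons]
    rcases lt_trichotomy r.1 y with h | rfl | h
    · simp [of_singleton_of_lt h, (sub_pos.2 h).ne']
    · simp [of_singleton_self]
    · simp [of_singleton_of_gt h, (sub_neg.2 h).ne]

theorem of_Slt_sub_Sgt (y : ℝ) (S : List (ℝ × ℝ)) :
    (of y S).Slt - (of y S).Sgt = signSum S y := by
  induction S with
  | nil => simp [of_nil, empty, signSum, weightedSum_nil]
  | cons r S ih =>
    rw [of_cons, combine, signSum, weightedSum_cons, ← signSum, ← ih]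
    rcases lt_trichotomy r.1 y with h | rfl | h
    · simp [of_singleton_of_lt h, sign_pos (sub_pos.2 h), add_sub_assoc]
    · simp [of_singleton_self]
    · simp [of_singleton_of_gt h, sign_neg (sub_neg.2 h)]; ring

theorem of_Plt_pos (y : ℝ) (S : List (ℝ × ℝ)) : 0 < (of y S).Plt := by
  refine List.prod_pos fun a ha => ?_
  obtain ⟨r, hr, rfl⟩ := List.mem_map.1 ha
  exact Real.rpow_pos_of_pos
    (abs_pos.2 (sub_pos.2 (of_decide_eq_true (List.mem_filter.1 hr).2)).ne') _

theorem of_Pgt_pos (y : ℝ) (S : List (ℝ × ℝ)) : 0 < (of y S).Pgt := by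
  refine List.prod_pos fun a ha => ?_
  obtain ⟨r, hr, rfl⟩ := List.mem_map.1 ha
  exact Real.rpow_pos_of_pos
    (abs_pos.2 (sub_neg.2 (of_decide_eq_true (List.mem_filter.1 hr).2)).ne) _

theorem log_of_Plt_sub_log_of_Pgt (y : ℝ) (S : List (ℝ × ℝ)) :
    Real.log (of y S).Plt - Real.log (of y S).Pgt = logSum S y := by
  induction S with
  | nil => simp [of_nil, empty, logSum, weightedSum_nil]
  | cons r S ih =>
    rw [of_cons, combine, Real.log_mul (of_Plt_pos y [r]).ne' (of_Plt_pos y S).ne',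
      Real.log_mul (of_Pgt_pos y [r]).ne' (of_Pgt_pos y S).ne', logSum, weightedSum_cons,
      ← logSum, ← ih]
    rcases lt_trichotomy r.1 y with h | rfl | h
    · have hpos := sub_pos.2 h
      simp [of_singleton_of_lt h, signLog, sign_pos hpos, Real.log_rpow hpos, add_sub_assoc]
    · simp [of_singleton_self, signLog]
    · have hneg := sub_neg.2 h
      simp [of_singleton_of_gt h, signLog, sign_neg hneg, Real.log_rpow (sub_pos.2 h),
        abs_of_neg hneg]
      ring

/-- The decision of `locate`: the position of the regression value of a block relative to the
splitting value, read off the statistics of the block. -/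
noncomputable def position (s : Stats) : Ordering :=
  if 0 < s.Seq then
    if s.Slt < s.W / 2 ∧ s.Sgt < s.W / 2 then .eq else if s.W / 2 ≤ s.Slt then .lt else .gt
  else if s.Slt = s.Sgt then
    if s.Pgt < s.Plt then .lt else if s.Plt < s.Pgt then .gt else .eq
  else if s.W / 2 < s.Slt then .lt else .gt

variable {S : List (ℝ × ℝ)} {y : ℝ}

theorem position_of_liesBelow (h0 : 0 ≤ eqSum S y) (h : LiesBelow S y) :
    (of y S).position = .lt := by
  rw [← of_Seq] at h0
  rw [LiesBelow, ← of_Seq, ← of_Slt_sub_Sgt, ← log_of_Plt_sub_log_of_Pgt] at h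
  have hW := of_W y S
  have hlog := Real.log_lt_log_iff (of_Pgt_pos y S) (of_Plt_pos y S)
  unfold position
  grind

theorem position_of_liesBelow_reflect (h0 : 0 ≤ eqSum S y) (h : LiesBelow (reflect S) (-y)) :
    (of y S).position = .gt := by
  rw [← of_Seq] at h0
  rw [LiesBelow, eqSum_reflect, signSum_reflect, logSum_reflect, ← of_Seq, ← of_Slt_sub_Sgt,
    ← log_of_Plt_sub_log_of_Pgt] at h
  have hW := of_W y S
  have hlog := Real.log_lt_log_iff (of_Plt_pos y S) (of_Pgt_pos y S)
  unfold position
  grind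

theorem position_of_liesAt (h : LiesAt S y) : (of y S).position = .eq := by
  rw [LiesAt, ← of_Seq, ← of_Slt_sub_Sgt, ← log_of_Plt_sub_log_of_Pgt,
    sub_eq_zero (a := Real.log _)] at h
  have hW := of_W y S
  have hlog := fun hl => Real.log_injOn_pos (of_Plt_pos y S) (of_Pgt_pos y S) hl
  unfold position
  grind

theorem position_of (hS : IsPosFamily S) (y : ℝ) : (of y S).position = cmp (limMean S) y := by
  have h0 := eqSum_nonneg hS.weight_pos y
  rcases liesBelow_or_liesAt_or_liesBelow_reflect hS.weight_pos y with h | h | h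
  · rw [position_of_liesBelow h0 h, (cmp_eq_lt_iff _ _).2 (h.limMean_lt hS)]
  · rw [position_of_liesAt h, (cmp_eq_eq_iff _ _).2 (h.limMean_eq hS)]
  · rw [position_of_liesBelow_reflect h0 h, (cmp_eq_gt_iff _ _).2 (h.lt_limMean_of_reflect hS)]

end Stats

theorem mergeStats_runs (s t : Stats) : RunsIn (mergeStats s t) (s.combine t) 7 7 :=
  RunsIn.of_run 7 fun _ => rfl

theorem addPoint_runs (y v w : ℝ) (s : Stats) :
    RunsIn (addPoint y v w s) (s.combine (Stats.of y [(v, w)])) 1 8 := by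
  rcases lt_trichotomy v y with h | rfl | h
  · refine ⟨7, by norm_num, by norm_num, fun t => ?_⟩
    simp [addPoint, run_tick, run_addR, run_subR, run_mulR, run_powR, run_ltR, h,
      Stats.of_singleton_of_lt (r := (v, w)) h, Stats.combine]
  · refine ⟨5, by norm_num, by norm_num, fun t => ?_⟩
    simp [addPoint, run_tick, run_addR, run_ltR, Stats.of_singleton_self (v, w), Stats.combine]
  · refine ⟨8, by norm_num, by norm_num, fun t => ?_⟩
    simp [addPoint, run_tick, run_addR, run_subR, run_mulR, run_powR, run_ltR, h, h.not_gt,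
      Stats.of_singleton_of_gt (r := (v, w)) h, Stats.combine]

theorem scan_runs (y : ℝ) (S rest : List (ℝ × ℝ)) (s : Stats) :
    RunsIn (scan y S.length (S ++ rest) s) (s.combine (Stats.of y S), rest)
      S.length (9 * S.length + 1) := by
  induction S generalizing s with
  | nil =>
    rw [Stats.of_nil, Stats.combine_empty]
    exact ⟨1, by simp, by simp, fun t => by cases rest <;> rfl⟩
  | cons r S ih =>
    have h := (addPoint_runs y r.1 r.2 s).bind (ih (s.combine (Stats.of y [r])))
    rw [Stats.combine_assoc, ← Stats.of_cons] at h
    exact h.tick_bind.mono (by rw [List.length_cons]; lia) (by rw [List.length_cons]; lia)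

theorem skip_runs (S rest : List (ℝ × ℝ)) :
    RunsIn (skip S.length (S ++ rest)) rest S.length (9 * S.length + 1) := by
  induction S with
  | nil => exact ⟨1, by simp, by simp, fun t => by cases rest <;> rfl⟩
  | cons r S ih =>
    exact ih.tick_bind.mono (by rw [List.length_cons]; lia) (by rw [List.length_cons]; lia)

theorem locate_runs (s : Stats) : RunsIn (locate s) s.position 1 8 := by
  unfold Stats.position
  split_ifs with hE hmid hlow heq hP hP' hlow
  · exact ⟨5, by simp, by simp, fun t => by simp [locate, run_tick, run_halfR, run_ltR, hE, hmid]⟩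
  · exact ⟨6, by simp, by simp, fun t => by
      simp [locate, run_tick, run_halfR, run_ltR, run_leR, hE, hlow, hlow.not_gt]⟩
  · have hgt : ¬ s.Sgt < s.W / 2 := fun h => hmid ⟨not_le.1 hlow, h⟩
    exact ⟨6, by simp, by simp, fun t => by
      simp [locate, run_tick, run_halfR, run_ltR, run_leR, hE, hlow, hgt]⟩
  · exact ⟨6, by simp, by simp, fun t => by
      simp [locate, run_tick, run_halfR, run_ltR, run_leR, hE, heq, hP]⟩
  · exact ⟨7, by simp, by simp, fun t => by
      simp [locate, run_tick, run_halfR, run_ltR, run_leR, hE, heq, hP, hP']⟩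
  · exact ⟨7, by simp, by simp, fun t => by
      simp [locate, run_tick, run_halfR, run_ltR, run_leR, hE, heq, hP, hP']⟩
  all_goals
    have hne : ¬ (s.Slt ≤ s.Sgt ∧ s.Sgt ≤ s.Slt) := fun h => heq (le_antisymm h.1 h.2)
    exact ⟨6, by simp, by simp, fun t => by
      simp [locate, run_tick, run_halfR, run_ltR, run_leR, hE, hne, hlow]⟩

/-! ### Sorting, input and output -/

/-- `zs` lists the elements of `l` without repetition in increasing order. -/
structure SortsDistinct (zs l : List ℝ) : Prop where
  pairwise : zs.Pairwise (· < ·)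
  mem_iff : ∀ x, x ∈ zs ↔ x ∈ l

namespace SortsDistinct

variable {zs l l' : List ℝ} {x : ℝ}

theorem congr (h : SortsDistinct zs l) (hl : ∀ x, x ∈ l ↔ x ∈ l') : SortsDistinct zs l' :=
  ⟨h.pairwise, fun x => (h.mem_iff x).trans (hl x)⟩

theorem cons (h : SortsDistinct zs l) (hx : ∀ y ∈ l, x < y) : SortsDistinct (x :: zs) (x :: l) :=
  ⟨List.pairwise_cons.2 ⟨fun y hy => hx y ((h.mem_iff y).1 hy), h.pairwise⟩, fun y => by
    simp only [List.mem_cons, h.mem_iff]⟩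

theorem length_le (h : SortsDistinct zs l) : zs.length ≤ l.length :=
  (List.subperm_of_subset (h.pairwise.imp ne_of_lt) fun x => (h.mem_iff x).1).length_le

end SortsDistinct

theorem split_runs (l : List ℝ) : ∃ p q, RunsIn (split l) (p, q) (l.length + 1) (l.length + 1) ∧
    p.length = (l.length + 1) / 2 ∧ q.length = l.length / 2 ∧ ∀ x, x ∈ l ↔ x ∈ p ++ q := by
  induction l with
  | nil => exact ⟨[], [], RunsIn.of_run 1 fun _ => rfl, by simp, by simp, by simp⟩
  | cons x l ih =>
    obtain ⟨p, q, h, hp, hq, hmem⟩ := ih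
    refine ⟨x :: q, p, ?_, ?_, ?_, fun y => ?_⟩
    · exact (h.bind (RunsIn.pure (x :: q, p))).tick_bind.mono
        (by rw [List.length_cons]; lia) (by rw [List.length_cons]; lia)
    · simp only [List.length_cons]; lia
    · simp only [List.length_cons]; lia
    · simp only [List.mem_append, List.mem_cons, hmem]; tauto

theorem merge_runs (xs ys : List ℝ) (hx : xs.Pairwise (· < ·)) (hy : ys.Pairwise (· < ·)) :
    ∃ zs, RunsIn (merge xs ys) zs 1 (3 * (xs.length + ys.length) + 1) ∧
      SortsDistinct zs (xs ++ ys) := by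
  match xs, ys with
  | [], ys => exact ⟨ys, ⟨1, le_rfl, by lia, fun s => by rw [merge]; rfl⟩, hy, fun _ => Iff.rfl⟩
  | x :: xs, [] =>
    exact ⟨x :: xs, ⟨1, le_rfl, by lia, fun s => by rw [merge]; rfl⟩, hx, by simp⟩
  | x :: xs, y :: ys =>
    have hx' := List.pairwise_cons.1 hx
    have hy' := List.pairwise_cons.1 hy
    rcases lt_trichotomy x y with hxy | rfl | hyx
    · obtain ⟨zs, ⟨t, -, ht, hrun⟩, hzs⟩ := merge_runs xs (y :: ys) hx'.2 hy
      refine ⟨x :: zs, ⟨t + 2, by lia, by simp only [List.length_cons] at ht ⊢; lia,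
        fun s => ?_⟩, hzs.cons fun z hz => ?_⟩
      · rw [merge]
        simp [run_tick, run_ltR, hxy, hrun]
        lia
      · rcases List.mem_append.1 hz with h | h
        exacts [hx'.1 z h, (List.mem_cons.1 h).elim (· ▸ hxy) fun h => hxy.trans (hy'.1 z h)]
    · obtain ⟨zs, ⟨t, -, ht, hrun⟩, hzs⟩ := merge_runs xs (x :: ys) hx'.2 hy
      refine ⟨zs, ⟨t + 3, by lia, by simp only [List.length_cons] at ht ⊢; lia, fun s => ?_⟩,
        hzs.congr fun z => by simp; tauto⟩
      rw [merge]
      simp [run_tick, run_ltR, hrun]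
      lia
    · obtain ⟨zs, ⟨t, -, ht, hrun⟩, hzs⟩ := merge_runs (x :: xs) ys hx hy'.2
      refine ⟨y :: zs, ⟨t + 3, by lia, by simp only [List.length_cons] at ht ⊢; lia,
        fun s => ?_⟩, (hzs.cons fun z hz => ?_).congr fun z => by simp; tauto⟩
      · rw [merge]
        simp [run_tick, run_ltR, hyx, hyx.not_gt, hrun]
        lia
      · rcases List.mem_append.1 hz with h | h
        exacts [(List.mem_cons.1 h).elim (· ▸ hyx) fun h => hyx.trans (hx'.1 z h), hy'.1 z h]
termination_by xs.length + ys.length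

theorem mul_log_le_of_halves {n p q : ℕ} (hn : 2 ≤ n) (hp : p = (n + 1) / 2)
    (hq : q = n / 2) :
    n * Nat.log 2 n ≤ p * Nat.log 2 p + q * Nat.log 2 q + n := by
  have hlog : Nat.log 2 n = Nat.log 2 q + 1 := hq ▸ Nat.log_of_one_lt_of_le (by norm_num) hn
  have hle : Nat.log 2 q ≤ Nat.log 2 p := Nat.log_mono_right (by lia)
  have hpq : n = p + q := by lia
  calc n * Nat.log 2 n = p * Nat.log 2 q + q * Nat.log 2 q + n := by rw [hlog, hpq]; ring
    _ ≤ p * Nat.log 2 p + q * Nat.log 2 q + n := by gcongr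

theorem mul_clog_add_le_of_halves {n p q : ℕ} (hn : 2 ≤ n) (hp : p = (n + 1) / 2)
    (hq : q = n / 2) :
    p * Nat.clog 2 p + q * Nat.clog 2 q + n ≤ n * Nat.clog 2 n := by
  have hlog : Nat.clog 2 n = Nat.clog 2 p + 1 := hp ▸ Nat.clog_of_two_le (by norm_num) hn
  have hle : Nat.clog 2 q ≤ Nat.clog 2 p := Nat.clog_mono_right _ (by lia)
  have hpq : n = p + q := by lia
  calc p * Nat.clog 2 p + q * Nat.clog 2 q + n
      ≤ p * Nat.clog 2 p + q * Nat.clog 2 p + n := by gcongr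
    _ = n * Nat.clog 2 n := by rw [hlog, hpq]; ring

theorem sortDistinct_runs (l : List ℝ) :
    ∃ zs, RunsIn (sortDistinct l) zs (l.length * Nat.log 2 l.length)
      (8 * (l.length * Nat.clog 2 l.length) + 1) ∧ SortsDistinct zs l := by
  match l with
  | [] => exact ⟨[], ⟨1, by simp, by simp, fun s => by rw [sortDistinct]; rfl⟩, by simp, by simp⟩
  | [x] => exact ⟨[x], ⟨1, by simp, by simp, fun s => by rw [sortDistinct]; rfl⟩, by simp, by simp⟩
  | x :: y :: l =>
    obtain ⟨p, q, hsplit, hp, hq, hmem⟩ := split_runs (x :: y :: l)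
    have hlen : 2 ≤ (x :: y :: l).length := by simp
    have : p.length < l.length + 2 := by simp only [List.length_cons] at hp; lia
    have : q.length < l.length + 2 := by simp only [List.length_cons] at hq; lia
    obtain ⟨p', hprun, hp'⟩ := sortDistinct_runs p
    obtain ⟨q', hqrun, hq'⟩ := sortDistinct_runs q
    obtain ⟨zs, hmerge, hzs⟩ := merge_runs p' q' hp'.pairwise hq'.pairwise
    refine ⟨zs, ?_, hzs.congr fun z => by simp only [hmem, List.mem_append, hp'.mem_iff,
      hq'.mem_iff]⟩
    have hrun := (hsplit.bind (k := fun r => sortDistinct r.1 >>= fun p' =>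
      sortDistinct r.2 >>= fun q' => merge p' q') (hprun.bind (hqrun.bind hmerge))).tick_bind
        (k := fun _ => _)
    have hlog := mul_log_le_of_halves hlen hp hq
    have hclog := mul_clog_add_le_of_halves hlen hp hq
    have hp'len := hp'.length_le
    have hq'len := hq'.length_le
    rw [sortDistinct]
    exact hrun.mono (by lia) (by lia)
termination_by l.length

theorem values_runs (data : List (ℝ × ℝ)) :
    RunsIn (values data) (data.map Prod.fst) 1 (data.length + 1) := by
  induction data with
  | nil => exact ⟨1, by simp, by simp, fun _ => rfl⟩
  | cons r data ih =>
    exact (ih.bind (RunsIn.pure (r.1 :: data.map Prod.fst))).tick_bind.mono (by simp)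
      (by rw [List.length_cons]; lia)

theorem fillArray_runs (l : List ℝ) (A : Array ℝ) :
    RunsIn (fillArray l A) (A ++ l.toArray) 1 (l.length + 1) := by
  induction l generalizing A with
  | nil => exact ⟨1, by simp, by simp, fun _ => by simp; rfl⟩
  | cons x l ih =>
    rw [show A ++ (x :: l).toArray = A.push x ++ l.toArray by apply Array.ext'; simp]
    exact (ih (A.push x)).tick_bind.mono (by simp) (by rw [List.length_cons]; lia)

theorem initBoxes_runs (a b : ℝ) (m : ℕ) (data : List (ℝ × ℝ)) :
    RunsIn (initBoxes a b m data) (List.replicate data.length ⟨1, a, b, 0, m⟩)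
      1 (data.length + 1) := by
  induction data with
  | nil => exact ⟨1, by simp, by simp, fun _ => rfl⟩
  | cons r data ih =>
    exact (ih.bind (RunsIn.pure (List.replicate (data.length + 1) _))).tick_bind.mono
      (by simp) (by rw [List.length_cons]; lia)

theorem replicateOnto_runs (z : ℝ × ℝ) (l : List (ℝ × ℝ)) (k : ℕ) :
    RunsIn (replicateOnto z l k) (List.replicate k z ++ l) 1 (k + 1) := by
  induction k with
  | zero => exact ⟨1, by simp, by simp, fun _ => rfl⟩
  | succ k ih =>
    exact (ih.bind (RunsIn.pure (z :: (List.replicate k z ++ l)))).tick_bind.mono (by simp)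
      (by lia)

theorem output_runs (boxes : List Box) :
    RunsIn (output boxes) (boxes.flatMap fun X => List.replicate X.len (X.a, X.b)) 1
      ((boxes.map Box.len).sum + 2 * boxes.length + 1) := by
  induction boxes with
  | nil => exact ⟨1, by simp, by simp, fun _ => rfl⟩
  | cons X boxes ih =>
    exact (ih.bind (replicateOnto_runs (X.a, X.b) _ X.len)).tick_bind.mono (by simp)
      (by simp only [List.map_cons, List.sum_cons, List.length_cons]; lia)

/-! ### Extents and their partitioning -/

/-- The vertical extent of a box together with the ranks `lo ≤ k < hi` of its candidates. -/
structure Extent where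
  a : ℝ
  b : ℝ
  lo : ℕ
  hi : ℕ

/-- The extent of a box of the program, without its number of vertices. -/
def Box.extent (X : Box) : Extent := ⟨X.a, X.b, X.lo, X.hi⟩

namespace Extent

/-- The part of an extent below, at or above a splitting value. -/
def restrict (X : Extent) (c : Cut) : SignType → Extent
  | .neg => { X with b := c.y, hi := c.hiBelow }
  | .zero => ⟨c.y, c.y, 0, 0⟩
  | .pos => { X with a := c.y, lo := c.loAbove }

/-- The relation of the extent of a block to that of a later one. -/
def Precedes (X Y : Extent) : Prop := X.b ≤ Y.a ∨ X = Y

/-- The test of `isAbove`. Two equal extents that consist of one point are not above each other. -/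
def Above (Y X : Extent) : Prop := X.b ≤ Y.a ∧ X.a < Y.b

variable {X : Extent} {c : Cut} {s t : SignType}

theorem precedes_restrict (X : Extent) (c : Cut) (h : s ≤ t) :
    (X.restrict c s).Precedes (X.restrict c t) := by
  cases s <;> cases t <;>
    first | exact Or.inr rfl | exact Or.inl le_rfl | exact absurd h (by decide)

theorem above_restrict_iff (hs : s = .pos → c.y < X.b) (ht : t = .neg → X.a < c.y) :
    (X.restrict c s).Above (X.restrict c t) ↔ t < s := by
  cases s <;> cases t <;> simp only [restrict, Above] <;> simp at hs ht <;> simp <;> grind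

end Extent

/-- A block of consecutive vertices with its extent. -/
structure Item where
  extent : Extent
  cells : List Cell

namespace Item

/-- The box by which the program represents a block. -/
def box (p : Item) : Box := ⟨p.cells.length, p.extent.a, p.extent.b, p.extent.lo, p.extent.hi⟩

/-- The position of the limit mean of a block relative to a splitting value. -/
noncomputable def side (p : Item) (c : Cut) : SignType := SignType.sign (cellMean p.cells - c.y)

/-- The unpartitioned union of two adjacent blocks with the same extent. -/
def merge (p q : Item) : Item := ⟨q.extent, p.cells ++ q.cells⟩

/-- The block after partitioning, where `cutOf` chooses the splitting value of each extent. -/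
noncomputable def next (cutOf : Extent → Option Cut) (p : Item) : Item :=
  match cutOf p.extent with
  | none => p
  | some c => ⟨p.extent.restrict c (p.side c), p.cells⟩

/-- The statistics that the program keeps for a block. -/
noncomputable def stats (cutOf : Extent → Option Cut) (p : Item) : Stats :=
  match cutOf p.extent with
  | none => Stats.empty
  | some c => Stats.of c.y (p.cells.map Prod.fst)

/-- The block `p`, not yet partitioned, as the program represents it. -/
noncomputable def block (cutOf : Extent → Option Cut) (p : Item) : Block :=
  ⟨p.box, cutOf p.extent, p.stats cutOf⟩

/-- The stack entry that represents a block. -/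
noncomputable def entry (cutOf : Extent → Option Cut) (p : Item) : Block × Box :=
  (p.block cutOf, (p.next cutOf).box)

variable {cutOf : Extent → Option Cut} {p : Item} {c : Cut}

theorem next_of_eq_none (h : cutOf p.extent = none) : p.next cutOf = p := by
  simp only [next, h]

theorem next_of_eq_some (h : cutOf p.extent = some c) :
    p.next cutOf = ⟨p.extent.restrict c (p.side c), p.cells⟩ := by
  simp only [next, h]

theorem cells_next (cutOf : Extent → Option Cut) (p : Item) : (p.next cutOf).cells = p.cells := by
  unfold next
  split <;> rfl

end Item

/-- The block `p` of the vertices `E` is a level set of the regression, with its value in the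
extent. Moreover, if the value is a data value, it is still a candidate; `arr k` is the data value
of rank `k`. -/
structure Fits (E : List Cell) (arr : ℕ → ℝ) (p : Item) : Prop where
  ne_nil : p.cells ≠ []
  subset : p.cells ⊆ E
  le : p.extent.a ≤ p.extent.b
  isConstant : IsConstant p.cells
  mem_Icc : ∀ e ∈ p.cells, e.2 ∈ Set.Icc p.extent.a p.extent.b
  candidate : ∀ e ∈ p.cells, (∃ e' ∈ E, e'.1.1 = e.2) →
    p.extent.a = p.extent.b ∨ ∃ k, p.extent.lo ≤ k ∧ k < p.extent.hi ∧ arr k = e.2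

/-- A valid splitting value of the extent `X`: an end of `X` is allowed only if it bounds all
data values, and no candidate other than the splitting value is lost. -/
structure ValidCut (E : List Cell) (arr : ℕ → ℝ) (X : Extent) (c : Cut) : Prop where
  ge : X.a ≤ c.y
  le : c.y ≤ X.b
  le_data : c.y = X.a → ∀ e ∈ E, c.y ≤ e.1.1
  data_le : c.y = X.b → ∀ e ∈ E, e.1.1 ≤ c.y
  lt_hiBelow : ∀ k, X.lo ≤ k → k < X.hi → arr k < c.y → k < c.hiBelow
  loAbove_le : ∀ k, X.lo ≤ k → k < X.hi → c.y < arr k → c.loAbove ≤ k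

/-- The cuts `cutOf` are valid for the extents with the property `J`, and partitioning turns these
into extents with the property `J'`. -/
structure IsStep (E : List Cell) (arr : ℕ → ℝ) (cutOf : Extent → Option Cut)
    (J J' : Extent → Prop) : Prop where
  validCut : ∀ X c, J X → cutOf X = some c → ValidCut E arr X c
  keep : ∀ X, J X → cutOf X = none → J' X
  restrict : ∀ X c s, J X → cutOf X = some c → (s = .neg → X.a < c.y) → (s = .pos → c.y < X.b) →
    J' (X.restrict c s)

/-- The invariant of a block during an iteration. -/
structure ItemOK (E : List Cell) (arr : ℕ → ℝ) (J : Extent → Prop) (p : Item) : Prop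
    extends Fits E arr p where
  inv : J p.extent

/-- The relation between a block and a later one when no violators are left. -/
def Ordered (cutOf : Extent → Option Cut) (p q : Item) : Prop :=
  p.extent.b ≤ q.extent.a ∨
    p.extent = q.extent ∧ ∀ c, cutOf p.extent = some c → p.side c ≤ q.side c

section Partition

variable {E P R : List Cell} {arr : ℕ → ℝ} {cutOf : Extent → Option Cut} {J J' : Extent → Prop}
  {p q r : Item} {c : Cut}

theorem Fits.isPosFamily (hE : StableCells E) (hp : Fits E arr p) :
    IsPosFamily (p.cells.map Prod.fst) :=
  hE.isPosFamily hp.ne_nil hp.subset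

theorem partitionBlock_runs (hp : IsPosFamily (p.cells.map Prod.fst)) :
    RunsIn (partitionBlock (p.block cutOf)) (p.next cutOf).box 1 9 := by
  cases hc : cutOf p.extent with
  | none =>
    refine ⟨1, le_rfl, by lia, fun s => ?_⟩
    simp only [partitionBlock, Item.block, hc, Item.next, StateT.run_bind, run_tick]
    rfl
  | some c =>
    obtain ⟨t, -, ht, hrun⟩ := locate_runs (Stats.of c.y (p.cells.map Prod.fst))
    refine ⟨1 + t, by lia, by lia, fun s => ?_⟩
    simp only [partitionBlock, Item.block, Item.stats, hc, Item.next, Item.side, StateT.run_bind,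
      run_tick, Option.bind_eq_bind, Option.bind_some, hrun, ← add_assoc, Stats.position_of hp,
      cellMean]
    rcases lt_trichotomy (limMean (p.cells.map Prod.fst)) c.y with h | h | h
    · rw [(cmp_eq_lt_iff _ _).2 h, sign_neg (sub_neg.2 h)]; rfl
    · rw [(cmp_eq_eq_iff _ _).2 h, sub_eq_zero.2 h, sign_zero]; rfl
    · rw [(cmp_eq_gt_iff _ _).2 h, sign_pos (sub_pos.2 h)]; rfl

theorem Item.side_mono (h : cellMean p.cells ≤ cellMean q.cells) (c : Cut) :
    p.side c ≤ q.side c :=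
  SignType.sign.monotone (sub_le_sub_right h c.y)

theorem Fits.lt_of_side_eq_neg (hE : StableCells E) (hp : Fits E arr p)
    (hc : ValidCut E arr p.extent c) (h : p.side c = .neg) : p.extent.a < c.y := by
  refine hc.ge.lt_of_ne fun heq => (sub_neg.1 (sign_eq_neg_one_iff.1 h)).not_ge ?_
  exact le_limMean_of_forall_le (hp.isPosFamily hE)
    (List.forall_mem_map.2 fun e he => hc.le_data heq.symm e (hp.subset he))

theorem Fits.lt_of_side_eq_pos (hE : StableCells E) (hp : Fits E arr p)
    (hc : ValidCut E arr p.extent c) (h : p.side c = .pos) : c.y < p.extent.b := by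
  refine hc.le.lt_of_ne fun heq => (sub_pos.1 (sign_eq_one_iff.1 h)).not_ge ?_
  exact limMean_le_of_forall_le (hp.isPosFamily hE)
    (List.forall_mem_map.2 fun e he => hc.data_le heq e (hp.subset he))

theorem Ordered.trans (hq : q.extent.a ≤ q.extent.b) (h : Ordered cutOf p q)
    (h' : Ordered cutOf q r) : Ordered cutOf p r := by
  rcases h with h | ⟨hpq, h⟩ <;> rcases h' with h' | ⟨hqr, h'⟩
  · exact Or.inl (h.trans (hq.trans h'))
  · exact Or.inl (hqr ▸ h)
  · exact Or.inl (hpq ▸ h')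
  · exact Or.inr ⟨hpq.trans hqr, fun c hc => (h c hc).trans (h' c (hpq ▸ hc))⟩

theorem isAbove_runs (Y X : Box) [Decidable (Y.extent.Above X.extent)] :
    RunsIn (isAbove Y X) (decide (Y.extent.Above X.extent)) 3 3 := by
  refine RunsIn.of_run 3 fun s => ?_
  rw [show decide (Y.extent.Above X.extent) = (decide (X.b ≤ Y.a) && decide (X.a < Y.b)) by
    rw [← Bool.decide_and]; congr]
  rfl

theorem ItemOK.next_extent_le (hP : IsStep E arr cutOf J J') (hp : ItemOK E arr J p) :
    p.extent.a ≤ (p.next cutOf).extent.a ∧ (p.next cutOf).extent.b ≤ p.extent.b := by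
  cases hc : cutOf p.extent with
  | none => simp [Item.next_of_eq_none hc]
  | some c =>
    have hval := hP.validCut _ c hp.inv hc
    rw [Item.next_of_eq_some hc]
    cases p.side c <;> simp [Extent.restrict, hval.ge, hval.le]

theorem above_next_iff (hE : StableCells E) (hP : IsStep E arr cutOf J J')
    (hp : ItemOK E arr J p) (hq : ItemOK E arr J q) (hpq : p.extent = q.extent)
    (hc : cutOf q.extent = some c) :
    (p.next cutOf).extent.Above (q.next cutOf).extent ↔ q.side c < p.side c := by
  have hval := hP.validCut _ c hq.inv hc
  rw [Item.next_of_eq_some (hpq ▸ hc), Item.next_of_eq_some hc, hpq]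
  exact Extent.above_restrict_iff
    (fun h => hpq ▸ hp.lt_of_side_eq_pos hE (hpq ▸ hval) h) (hq.lt_of_side_eq_neg hE hval)

theorem exists_cut_of_above (hE : StableCells E) (hP : IsStep E arr cutOf J J')
    (hp : ItemOK E arr J p) (hq : ItemOK E arr J q) (hpq : p.extent.Precedes q.extent)
    (h : (p.next cutOf).extent.Above (q.next cutOf).extent) :
    p.extent = q.extent ∧ (∃ c, cutOf q.extent = some c) ∧
      cellMean q.cells < cellMean p.cells := by
  have hlt : p.extent ≠ q.extent ∨ cutOf q.extent = none → False := by
    rintro hne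
    have hp' := hp.next_extent_le hP
    have hq' := hq.next_extent_le hP
    rcases hpq with hpq | heq
    · linarith [h.2]
    · have hnone := hne.resolve_left (not_not.2 heq)
      rw [Item.next_of_eq_none hnone, Item.next_of_eq_none (heq ▸ hnone), heq] at h
      exact h.1.not_gt h.2
  have heq : p.extent = q.extent := by_contra fun hne => hlt (Or.inl hne)
  obtain ⟨c, hc⟩ := Option.ne_none_iff_exists'.1 fun hnone => hlt (Or.inr hnone)
  refine ⟨heq, ⟨c, hc⟩, lt_of_not_ge fun hle => ?_⟩
  exact ((above_next_iff hE hP hp hq heq hc).1 h).not_ge (Item.side_mono hle c)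

theorem ordered_of_not_above (hE : StableCells E) (hP : IsStep E arr cutOf J J')
    (hp : ItemOK E arr J p) (hq : ItemOK E arr J q) (hpq : p.extent.Precedes q.extent)
    (h : ¬ (p.next cutOf).extent.Above (q.next cutOf).extent) : Ordered cutOf p q :=
  hpq.imp id fun heq => ⟨heq, fun _ hc =>
    not_lt.1 fun hlt => h ((above_next_iff hE hP hp hq heq (heq ▸ hc)).2 hlt)⟩

theorem ItemOK.precedes_next (hP : IsStep E arr cutOf J J') (hp : ItemOK E arr J p)
    (hq : ItemOK E arr J q) (h : Ordered cutOf p q) :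
    (p.next cutOf).extent.Precedes (q.next cutOf).extent := by
  rcases h with h | ⟨heq, h⟩
  · exact Or.inl (((hp.next_extent_le hP).2.trans h).trans (hq.next_extent_le hP).1)
  · cases hc : cutOf p.extent with
    | none =>
      rw [Item.next_of_eq_none hc, Item.next_of_eq_none (heq ▸ hc)]
      exact Or.inr heq
    | some c =>
      rw [Item.next_of_eq_some hc, Item.next_of_eq_some (heq ▸ hc), ← heq]
      exact Extent.precedes_restrict _ _ (h c hc)

theorem ItemOK.merge (hE : StableCells E) (hp : ItemOK E arr J p) (hq : ItemOK E arr J q)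
    (hPR : E = P ++ p.cells ++ q.cells ++ R) (heq : p.extent = q.extent)
    (hm : cellMean q.cells < cellMean p.cells) : ItemOK E arr J (p.merge q) where
  ne_nil := List.append_ne_nil_of_left_ne_nil hp.ne_nil _
  subset := List.append_subset.2 ⟨hp.subset, hq.subset⟩
  le := hq.le
  isConstant := hE.isConstant_append hPR hp.ne_nil hq.ne_nil hp.isConstant hq.isConstant hm
  mem_Icc := List.forall_mem_append.2 ⟨heq ▸ hp.mem_Icc, hq.mem_Icc⟩
  candidate := List.forall_mem_append.2 ⟨heq ▸ hp.candidate, hq.candidate⟩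
  inv := hq.inv

end Partition

/-! ### Pool adjacent violators -/

section Pool

variable {E rest : List Cell} {arr : ℕ → ℝ} {cutOf : Extent → Option Cut} {J J' : Extent → Prop}
  {items : List Item} {it p q : Item} {c : Cut}

theorem run_addN (x y s : ℕ) : (addN x y).run s = some (x + y, s + 1) := rfl

theorem mergeBlocks_runs (heq : p.extent = q.extent) (hc : cutOf q.extent = some c) :
    RunsIn (mergeBlocks (p.block cutOf) (q.block cutOf)) ((p.merge q).block cutOf) 9 9 := by
  have hmerge : (p.stats cutOf).combine (q.stats cutOf) = (p.merge q).stats cutOf := by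
    simp only [Item.stats, Item.merge, heq, hc, List.map_append, Stats.of_append]
  obtain ⟨t, ht, ht', hrun⟩ := mergeStats_runs (p.stats cutOf) (q.stats cutOf)
  obtain rfl : t = 7 := by lia
  refine RunsIn.of_run 9 fun s => ?_
  simp only [mergeBlocks, Item.block, StateT.run_bind, run_tick, Option.bind_eq_bind,
    Option.bind_some, hrun, run_addN, hmerge, Item.box, Item.merge, List.length_append]
  rfl

/-- The invariant of pooling: the blocks on the stack, nearest first, contain no violators, and
`rest` are the vertices that have not been pooled yet. -/
structure Stack (E : List Cell) (arr : ℕ → ℝ) (cutOf : Extent → Option Cut) (J : Extent → Prop)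
    (items : List Item) (rest : List Cell) : Prop where
  ok : ∀ p ∈ items, ItemOK E arr J p
  ordered : items.Pairwise fun q p => Ordered cutOf p q
  cover : E = items.reverse.flatMap Item.cells ++ rest

theorem Stack.push (h : Stack E arr cutOf J items (it.cells ++ rest)) (hit : ItemOK E arr J it)
    (hord : ∀ p ∈ items.head?, Ordered cutOf p it) : Stack E arr cutOf J (it :: items) rest where
  ok := List.forall_mem_cons.2 ⟨hit, h.ok⟩
  ordered := by
    refine List.pairwise_cons.2 ⟨fun r hr => ?_, h.ordered⟩
    cases items with
    | nil => exact absurd hr List.not_mem_nil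
    | cons p items =>
      have hp := hord p rfl
      rcases List.mem_cons.1 hr with rfl | hr
      · exact hp
      · exact ((List.pairwise_cons.1 h.ordered).1 r hr).trans (h.ok p List.mem_cons_self).le hp
  cover := by simpa using h.cover

theorem Stack.pop (h : Stack E arr cutOf J (p :: items) (q.cells ++ rest)) :
    Stack E arr cutOf J items ((p.merge q).cells ++ rest) where
  ok := (List.forall_mem_cons.1 h.ok).2
  ordered := (List.pairwise_cons.1 h.ordered).2
  cover := by simpa [Item.merge] using h.cover

theorem Stack.itemOK_merge (hE : StableCells E)
    (h : Stack E arr cutOf J (p :: items) (q.cells ++ rest)) (hq : ItemOK E arr J q)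
    (heq : p.extent = q.extent) (hm : cellMean q.cells < cellMean p.cells) :
    ItemOK E arr J (p.merge q) := by
  refine (h.ok p List.mem_cons_self).merge hE hq (P := items.reverse.flatMap Item.cells)
    (R := rest) ?_ heq hm
  simpa using h.cover

/-- A merge removes a block from the stack, which pays for the time of the merge. -/
theorem pool_runs (hE : StableCells E) (hP : IsStep E arr cutOf J J')
    (hst : Stack E arr cutOf J items (it.cells ++ rest)) (hit : ItemOK E arr J it)
    (hprec : ∀ p ∈ items, p.extent.Precedes it.extent) :
    ∃ items' hi, RunsIn (pool (it.block cutOf) (items.map (Item.entry cutOf)))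
        (items'.map (Item.entry cutOf)) 1 hi ∧
      hi + 30 * items'.length ≤ 30 * (items.length + 2) ∧ Stack E arr cutOf J items' rest ∧
      ∀ p ∈ items', p.extent = it.extent ∨ p ∈ items := by
  have hpart := partitionBlock_runs (cutOf := cutOf) (hit.isPosFamily hE)
  induction items generalizing it with
  | nil =>
    refine ⟨[it], 10, ?_, by simp, hst.push hit (by simp), by simp⟩
    exact (RunsIn.tick_bind (hpart.bind
      (RunsIn.pure [it.entry cutOf]))).mono (by lia) (by lia)
  | cons p items ih =>
    have hp := hst.ok p List.mem_cons_self
    have hpit := hprec p List.mem_cons_self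
    classical
    have habove : RunsIn (isAbove (p.next cutOf).box (it.next cutOf).box)
        (decide ((p.next cutOf).extent.Above (it.next cutOf).extent)) 3 3 := isAbove_runs _ _
    by_cases hab : (p.next cutOf).extent.Above (it.next cutOf).extent
    · obtain ⟨heq, ⟨c, hc⟩, hm⟩ := exists_cut_of_above hE hP hp hit hpit hab
      have hmerge := hst.itemOK_merge hE hit heq hm
      obtain ⟨items', hi, hrun, hhi, hst', hmem⟩ := ih hst.pop hmerge
        (List.forall_mem_cons.1 hprec).2 (partitionBlock_runs (hmerge.isPosFamily hE))
      refine ⟨items', 1 + (9 + (3 + (9 + hi))), ?_, ?_, hst',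
        fun r hr => (hmem r hr).imp id (List.mem_cons_of_mem p)⟩
      · rw [decide_eq_true hab] at habove
        exact (RunsIn.tick_bind (hpart.bind (habove.bind
          ((mergeBlocks_runs heq hc).bind hrun)))).mono (by lia) le_rfl
      · simp only [List.length_cons]; lia
    · refine ⟨it :: p :: items, 1 + (9 + (3 + 0)), ?_, by simp only [List.length_cons]; lia,
        hst.push hit ?_, fun r hr => (List.mem_cons.1 hr).imp (congrArg Item.extent) id⟩
      · rw [decide_eq_false hab] at habove
        exact (RunsIn.tick_bind (hpart.bind (habove.bind
          (RunsIn.pure ((it :: p :: items).map (Item.entry cutOf)))))).mono (by lia) le_rfl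
      · simpa using ordered_of_not_above hE hP hp hit hpit hab

theorem poolAll_runs (hE : StableCells E) (hP : IsStep E arr cutOf J J') {todo : List Item}
    (hst : Stack E arr cutOf J items (todo.flatMap Item.cells))
    (htodo : ∀ p ∈ todo, ItemOK E arr J p)
    (hprec : todo.Pairwise fun p q => p.extent.Precedes q.extent)
    (hprec' : ∀ p ∈ items, ∀ q ∈ todo, p.extent.Precedes q.extent) :
    ∃ items' hi, RunsIn (poolAll (todo.map (Item.block cutOf)) (items.map (Item.entry cutOf)))
        (items'.map (Item.entry cutOf)) 1 hi ∧
      hi + 30 * items'.length ≤ 30 * items.length + 61 * todo.length + 1 ∧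
      Stack E arr cutOf J items' [] := by
  induction todo generalizing items with
  | nil => exact ⟨items, 1, RunsIn.of_run 1 fun _ => rfl, by simp; lia, hst⟩
  | cons it todo ih =>
    obtain ⟨hit, htodo⟩ := List.forall_mem_cons.1 htodo
    obtain ⟨hprec_it, hprec⟩ := List.pairwise_cons.1 hprec
    obtain ⟨items₁, hi₁, hrun₁, hhi₁, hst₁, hmem⟩ := pool_runs hE hP hst hit
      fun p hp => hprec' p hp it List.mem_cons_self
    obtain ⟨items', hi, hrun, hhi, hst'⟩ := ih hst₁ htodo hprec fun p hp q hq =>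
      (hmem p hp).elim (fun h => h ▸ hprec_it q hq)
        fun h => hprec' p h q (List.mem_cons_of_mem it hq)
    refine ⟨items', 1 + (hi₁ + hi), (RunsIn.tick_bind (hrun₁.bind hrun)).mono (by lia) le_rfl,
      ?_, hst'⟩
    simp only [List.length_cons]; lia

theorem unstack_runs (items : List Item) (acc : List Box) :
    RunsIn (unstack (items.map (Item.entry cutOf)) acc)
      ((items.map fun p => (p.next cutOf).box).reverse ++ acc) 1 (items.length + 1) := by
  induction items generalizing acc with
  | nil => exact ⟨1, le_rfl, by simp, fun _ => rfl⟩
  | cons it items ih =>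
    simp only [List.map_cons, List.reverse_cons, List.append_assoc, List.singleton_append]
    exact (RunsIn.tick_bind (ih ((it.next cutOf).box :: acc))).mono (by lia)
      (by simp only [List.length_cons]; lia)

end Pool

/-! ### One iteration -/

section Partitioned

variable {E : List Cell} {arr : ℕ → ℝ} {cutOf : Extent → Option Cut} {J J' : Extent → Prop}
  {L₁ L₂ : List Item} {it p : Item} {c : Cut} {S : Set ℝ}

theorem forall_mem_of_isLowerSet (hE : StableCells E)
    (hok : ∀ p ∈ L₁ ++ it :: L₂, ItemOK E arr J p)
    (hord : (L₁ ++ it :: L₂).Pairwise (Ordered cutOf))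
    (hcov : (L₁ ++ it :: L₂).flatMap Item.cells = E) (hc : cutOf it.extent = some c)
    (hS : IsLowerSet S) (ha : it.extent.a ∈ S)
    (hm : ∀ p : Item, p.side c ≤ it.side c → cellMean p.cells ∈ S) :
    ∀ e ∈ it.cells, e.2 ∈ S := by
  have hok' : ∀ p ∈ L₁ ++ [it], ItemOK E arr J p := fun p hp => hok p (by simp at hp ⊢; tauto)
  refine hE.forall_mem_of_isLowerSet (L := (L₁ ++ [it]).map Item.cells)
    (R := L₂.flatMap Item.cells) hS ?_ (List.forall_mem_map.2 fun p hp => (hok' p hp).ne_nil)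
    (List.forall_mem_map.2 fun p hp => (hok' p hp).isConstant)
    (List.forall_mem_map.2 fun p hp => ?_) _ (by simp)
  · rw [← hcov]
    simp [List.flatMap_def]
  · rcases List.mem_append.1 hp with hp₁ | hp₁
    · rcases (List.pairwise_append.1 hord).2.2 p hp₁ it List.mem_cons_self with h | ⟨heq, h⟩
      · exact Or.inr fun e he => hS (((hok' p hp).mem_Icc e he).2.trans h) ha
      · exact Or.inl (hm p (h c (heq ▸ hc)))
    · exact Or.inl (hm p (by rw [List.mem_singleton.1 hp₁]))

theorem forall_mem_of_isUpperSet (hE : StableCells E)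
    (hok : ∀ p ∈ L₁ ++ it :: L₂, ItemOK E arr J p)
    (hord : (L₁ ++ it :: L₂).Pairwise (Ordered cutOf))
    (hcov : (L₁ ++ it :: L₂).flatMap Item.cells = E) (hc : cutOf it.extent = some c)
    (hS : IsUpperSet S) (hb : it.extent.b ∈ S)
    (hm : ∀ p : Item, it.side c ≤ p.side c → cellMean p.cells ∈ S) :
    ∀ e ∈ it.cells, e.2 ∈ S := by
  have hok' : ∀ p ∈ it :: L₂, ItemOK E arr J p := fun p hp => hok p (List.mem_append_right _ hp)
  refine hE.forall_mem_of_isUpperSet (L := (it :: L₂).map Item.cells)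
    (R := L₁.flatMap Item.cells) hS ?_ (List.forall_mem_map.2 fun p hp => (hok' p hp).ne_nil)
    (List.forall_mem_map.2 fun p hp => (hok' p hp).isConstant)
    (List.forall_mem_map.2 fun p hp => ?_) _ (by simp)
  · rw [← hcov]
    simp [List.flatMap_def]
  · rcases List.mem_cons.1 hp with rfl | hp₂
    · exact Or.inl (hm p le_rfl)
    · rcases (List.pairwise_cons.1 (List.pairwise_append.1 hord).2.1).1 p hp₂ with h | ⟨-, h⟩
      · exact Or.inr fun e he => hS (h.trans ((hok' p hp).mem_Icc e he).1) hb
      · exact Or.inl (hm p (h c hc))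

/-- Once no violators are left, the rule applied to a whole block is right for the regression. -/
theorem sign_regression_eq_side (hE : StableCells E) (hP : IsStep E arr cutOf J J')
    (hok : ∀ p ∈ L₁ ++ it :: L₂, ItemOK E arr J p)
    (hord : (L₁ ++ it :: L₂).Pairwise (Ordered cutOf))
    (hcov : (L₁ ++ it :: L₂).flatMap Item.cells = E) (hc : cutOf it.extent = some c) :
    ∀ e ∈ it.cells, SignType.sign (e.2 - c.y) = it.side c := by
  have hit := hok it (List.mem_append_right _ List.mem_cons_self)
  have hcut := hP.validCut _ c hit.inv hc
  intro e he
  cases hside : it.side c with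
  | neg =>
    refine sign_eq_neg_one_iff.2 (sub_neg.2 ?_)
    refine forall_mem_of_isLowerSet hE hok hord hcov hc (isLowerSet_Iio c.y)
      (hit.lt_of_side_eq_neg hE hcut hside) (fun p hp => ?_) e he
    exact sub_neg.1 (sign_eq_neg_one_iff.1
      (le_antisymm (hp.trans_eq hside) (SignType.neg_one_le _)))
  | zero =>
    refine sign_eq_zero_iff.2 (sub_eq_zero.2 (le_antisymm ?_ ?_))
    · refine forall_mem_of_isLowerSet hE hok hord hcov hc (isLowerSet_Iic c.y) hcut.ge
        (fun p hp => ?_) e he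
      exact sub_nonpos.1 (sign_nonpos_iff.1 (hp.trans_eq hside))
    · refine forall_mem_of_isUpperSet hE hok hord hcov hc (isUpperSet_Ici c.y) hcut.le
        (fun p hp => ?_) e he
      exact sub_nonneg.1 (sign_nonneg_iff.1 (hside.symm.trans_le hp))
  | pos =>
    refine sign_eq_one_iff.2 (sub_pos.2 ?_)
    refine forall_mem_of_isUpperSet hE hok hord hcov hc (isUpperSet_Ioi c.y)
      (hit.lt_of_side_eq_pos hE hcut hside) (fun p hp => ?_) e he
    exact sub_pos.1 (sign_eq_one_iff.1 (le_antisymm (SignType.le_one _) (hside.symm.trans_le hp)))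

theorem Fits.restrict (hp : Fits E arr p) (hc : ValidCut E arr p.extent c) {s : SignType}
    (hs : ∀ e ∈ p.cells, SignType.sign (e.2 - c.y) = s) :
    Fits E arr ⟨p.extent.restrict c s, p.cells⟩ := by
  have hcand : ∀ e ∈ p.cells, e.2 ≠ c.y → (∃ e' ∈ E, e'.1.1 = e.2) →
      ∃ k, p.extent.lo ≤ k ∧ k < p.extent.hi ∧ arr k = e.2 := fun e he hne hex =>
    (hp.candidate e he hex).resolve_left fun hab => hne (le_antisymm
      ((hp.mem_Icc e he).2.trans (hab ▸ hc.ge)) (hc.le.trans (hab ▸ (hp.mem_Icc e he).1)))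
  cases s with
  | neg =>
    have hlt : ∀ e ∈ p.cells, e.2 < c.y := fun e he => sub_neg.1 (sign_eq_neg_one_iff.1 (hs e he))
    refine ⟨hp.ne_nil, hp.subset, hc.ge, hp.isConstant,
      fun e he => ⟨(hp.mem_Icc e he).1, (hlt e he).le⟩, fun e he hex => Or.inr ?_⟩
    obtain ⟨k, hlo, hhi, hk⟩ := hcand e he (hlt e he).ne hex
    exact ⟨k, hlo, hc.lt_hiBelow k hlo hhi (hk ▸ hlt e he), hk⟩
  | zero =>
    have heq : ∀ e ∈ p.cells, e.2 = c.y := fun e he => sub_eq_zero.1 (sign_eq_zero_iff.1 (hs e he))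
    exact ⟨hp.ne_nil, hp.subset, le_rfl, hp.isConstant,
      fun e he => ⟨(heq e he).ge, (heq e he).le⟩, fun _ _ _ => Or.inl rfl⟩
  | pos =>
    have hlt : ∀ e ∈ p.cells, c.y < e.2 := fun e he => sub_pos.1 (sign_eq_one_iff.1 (hs e he))
    refine ⟨hp.ne_nil, hp.subset, hc.le, hp.isConstant,
      fun e he => ⟨(hlt e he).le, (hp.mem_Icc e he).2⟩, fun e he hex => Or.inr ?_⟩
    obtain ⟨k, hlo, hhi, hk⟩ := hcand e he (hlt e he).ne' hex
    exact ⟨k, hc.loAbove_le k hlo hhi (hk ▸ hlt e he), hhi, hk⟩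

theorem ItemOK.next (hE : StableCells E) (hP : IsStep E arr cutOf J J')
    (hok : ∀ p ∈ L₁ ++ it :: L₂, ItemOK E arr J p)
    (hord : (L₁ ++ it :: L₂).Pairwise (Ordered cutOf))
    (hcov : (L₁ ++ it :: L₂).flatMap Item.cells = E) : ItemOK E arr J' (it.next cutOf) := by
  have hit := hok it (List.mem_append_right _ List.mem_cons_self)
  cases hc : cutOf it.extent with
  | none =>
    rw [Item.next_of_eq_none hc]
    exact ⟨hit.toFits, hP.keep _ hit.inv hc⟩
  | some c =>
    have hcut := hP.validCut _ c hit.inv hc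
    rw [Item.next_of_eq_some hc]
    exact ⟨hit.restrict hcut (sign_regression_eq_side hE hP hok hord hcov hc),
      hP.restrict _ c _ hit.inv hc (hit.lt_of_side_eq_neg hE hcut)
        (hit.lt_of_side_eq_pos hE hcut)⟩

end Partitioned

/-- The invariant of the blocks `L` between two iterations: they partition the vertices, and their
extents increase. -/
structure State (E : List Cell) (arr : ℕ → ℝ) (J : Extent → Prop) (L : List Item) : Prop where
  ok : ∀ p ∈ L, ItemOK E arr J p
  prec : L.Pairwise fun p q => p.extent.Precedes q.extent
  cover : L.flatMap Item.cells = E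

section Iteration

variable {E : List Cell} {arr : ℕ → ℝ} {cutOf : Extent → Option Cut} {J J' : Extent → Prop}
  {L : List Item} {pick : Box → RAM (Option Cut)}

theorem State.length_le (h : State E arr J L) : L.length ≤ E.length := by
  rw [← h.cover, List.length_flatMap, ← List.length_map (f := fun p : Item => p.cells.length)]
  exact List.length_le_sum_of_one_le _
    (List.forall_mem_map.2 fun p hp => List.length_pos_iff.2 (h.ok p hp).ne_nil)

theorem Stack.state (hE : StableCells E) (hP : IsStep E arr cutOf J J')
    (h : Stack E arr cutOf J L []) : State E arr J' (L.reverse.map (Item.next cutOf)) := by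
  have hcov : L.reverse.flatMap Item.cells = E := by rw [h.cover, List.append_nil]
  have hok : ∀ p ∈ L.reverse, ItemOK E arr J p := fun p hp => h.ok p (List.mem_reverse.1 hp)
  have hord : L.reverse.Pairwise (Ordered cutOf) := List.pairwise_reverse.2 h.ordered
  refine ⟨List.forall_mem_map.2 fun it hit => ?_, ?_, ?_⟩
  · obtain ⟨L₁, L₂, heq⟩ := List.append_of_mem hit
    rw [heq] at hok hord hcov
    exact ItemOK.next hE hP hok hord hcov
  · rw [List.pairwise_map]
    exact hord.imp_of_mem fun hp hq h => (hok _ hp).precedes_next hP (hok _ hq) h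
  · simp only [List.flatMap_map, Item.cells_next, hcov]

theorem prepare_runs (hpick : ∀ X : Box, RunsIn (pick X) (cutOf X.extent) 1 6) (L : List Item) :
    RunsIn (prepare pick (L.map Item.box) ((L.flatMap Item.cells).map Prod.fst))
      (L.map (Item.block cutOf)) (L.flatMap Item.cells).length
      (8 * L.length + 9 * (L.flatMap Item.cells).length + 1) := by
  induction L with
  | nil => exact ⟨1, by simp, by simp, fun _ => rfl⟩
  | cons p L ih =>
    have hpk := hpick p.box
    have hskip := skip_runs (p.cells.map Prod.fst) ((L.flatMap Item.cells).map Prod.fst)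
    have hscan := fun y =>
      scan_runs y (p.cells.map Prod.fst) ((L.flatMap Item.cells).map Prod.fst) Stats.empty
    simp only [Stats.empty_combine, List.length_map] at hskip hscan
    simp only [List.map_cons, List.flatMap_cons, List.map_append, List.length_append,
      List.length_cons]
    change RunsIn (pick p.box) (cutOf p.extent) 1 6 at hpk
    cases hc : cutOf p.extent with
    | none =>
      rw [hc] at hpk
      have hb : p.block cutOf = ⟨p.box, none, Stats.empty⟩ := by
        simp only [Item.block, Item.stats, hc]
      rw [hb]
      exact (RunsIn.tick_bind (hpk.bind (hskip.bind (ih.bind (RunsIn.pure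
        ((⟨p.box, none, Stats.empty⟩ : Block) :: L.map (Item.block cutOf))))))).mono
        (by lia) (by lia)
    | some c =>
      rw [hc] at hpk
      have hb : p.block cutOf = ⟨p.box, some c, Stats.of c.y (p.cells.map Prod.fst)⟩ := by
        simp only [Item.block, Item.stats, hc]
      rw [hb]
      exact (RunsIn.tick_bind (hpk.bind ((hscan c.y).bind (ih.bind (RunsIn.pure
        ((⟨p.box, some c, Stats.of c.y (p.cells.map Prod.fst)⟩ : Block) ::
          L.map (Item.block cutOf))))))).mono (by lia) (by lia)

theorem anyActive_runs (hpick : ∀ X : Box, RunsIn (pick X) (cutOf X.extent) 1 6)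
    (boxes : List Box) :
    RunsIn (anyActive pick boxes) (boxes.any fun X => (cutOf X.extent).isSome) 1
      (7 * boxes.length + 1) := by
  induction boxes with
  | nil => exact ⟨1, by simp, by simp, fun _ => rfl⟩
  | cons X boxes ih =>
    have hpk := hpick X
    simp only [List.any_cons, List.length_cons]
    cases hc : cutOf X.extent with
    | none =>
      rw [hc] at hpk
      exact (RunsIn.tick_bind (hpk.bind ih)).mono (by lia) (by lia)
    | some c =>
      rw [hc] at hpk
      exact (RunsIn.tick_bind (hpk.bind (RunsIn.pure true))).mono (by lia) (by lia)

theorem iteration_runs (hE : StableCells E) (hP : IsStep E arr cutOf J J')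
    (hpick : ∀ X : Box, RunsIn (pick X) (cutOf X.extent) 1 6) (hL : State E arr J L) :
    ∃ L', State E arr J' L' ∧
      RunsIn (do
        let blocks ← prepare pick (L.map Item.box) (E.map Prod.fst)
        let stack ← poolAll blocks []
        unstack stack []) (L'.map Item.box) E.length (79 * E.length + 3) := by
  obtain ⟨items, hi, hpool, hhi, hst⟩ := poolAll_runs hE hP (items := []) (todo := L)
    ⟨by simp, List.Pairwise.nil, by simpa using hL.cover.symm⟩ hL.ok hL.prec (by simp)
  have hstate := hst.state hE hP
  have hprep := prepare_runs hpick L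
  have hun := unstack_runs (cutOf := cutOf) items []
  rw [hL.cover] at hprep
  refine ⟨_, hstate, ?_⟩
  have hout : (items.map fun p => (p.next cutOf).box).reverse ++ [] =
      (items.reverse.map (Item.next cutOf)).map Item.box := by
    simp only [List.append_nil, List.map_reverse, List.map_map, Function.comp_def]
  rw [hout] at hun
  have hlen := hL.length_le
  have : items.length ≤ E.length := by simpa using hstate.length_le
  simp only [List.length_nil, mul_zero, zero_add] at hhi
  exact (hprep.bind (hpool.bind hun)).mono (by lia) (by lia)

theorem iterations_runs_of_forall_eq_none
    (hpick : ∀ X : Box, RunsIn (pick X) (cutOf X.extent) 1 6)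
    (hnone : ∀ p ∈ L, cutOf p.extent = none) {data : List (ℝ × ℝ)} :
    RunsIn (iterations pick data (L.map Item.box)) (L.map Item.box) 0 (7 * L.length + 2) := by
  have hany := anyActive_runs hpick (L.map Item.box)
  have hfalse : ((L.map Item.box).any fun X => (cutOf X.extent).isSome) = false :=
    List.any_eq_false.2 (List.forall_mem_map.2 fun p hp =>
      by rw [show cutOf p.box.extent = none from hnone p hp]; simp)
  rw [List.length_map, hfalse] at hany
  rw [iterations]
  exact (RunsIn.tick_bind (hany.bind (RunsIn.pure (L.map Item.box)))).mono (by simp) (by lia)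

theorem iterations_runs_of_exists_ne_none (hE : StableCells E) (hP : IsStep E arr cutOf J J')
    (hpick : ∀ X : Box, RunsIn (pick X) (cutOf X.extent) 1 6) (hL : State E arr J L)
    (hsome : ∃ p ∈ L, cutOf p.extent ≠ none) :
    ∃ L', State E arr J' L' ∧ ∀ boxes lo hi,
      RunsIn (iterations pick (E.map Prod.fst) (L'.map Item.box)) boxes lo hi →
      RunsIn (iterations pick (E.map Prod.fst) (L.map Item.box)) boxes (E.length + lo)
        (86 * E.length + 5 + hi) := by
  obtain ⟨L', hL', hiter⟩ := iteration_runs hE hP hpick hL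
  refine ⟨L', hL', fun boxes lo hi hrun => ?_⟩
  obtain ⟨p, hp, hpc⟩ := hsome
  have hany := anyActive_runs hpick (L.map Item.box)
  have htrue : ((L.map Item.box).any fun X => (cutOf X.extent).isSome) = true :=
    List.any_eq_true.2 ⟨p.box, List.mem_map_of_mem hp, Option.isSome_iff_ne_none.2 hpc⟩
  rw [List.length_map, htrue] at hany
  have hbody := hiter.bind hrun
  simp only [bind_assoc] at hbody
  have hlen := hL.length_le
  rw [iterations]
  exact (RunsIn.tick_bind (hany.bind hbody)).mono (by lia) (by lia)

theorem iterations_runs (hE : StableCells E) {J : ℕ → Extent → Prop} {j : ℕ}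
    (hP : ∀ j, IsStep E arr cutOf (J j) (J (j + 1)))
    (hpick : ∀ X : Box, RunsIn (pick X) (cutOf X.extent) 1 6) (N : ℕ)
    (hN : ∀ X, J (j + N) X → cutOf X = none) (hL : State E arr (J j) L) :
    ∃ k ≤ N, ∃ L', State E arr (J (j + k)) L' ∧ (∀ p ∈ L', cutOf p.extent = none) ∧
      RunsIn (iterations pick (E.map Prod.fst) (L.map Item.box)) (L'.map Item.box)
        (k * E.length) ((N + 1) * (86 * E.length + 5)) := by
  induction N generalizing j L with
  | zero =>
    have hnone : ∀ p ∈ L, cutOf p.extent = none := fun p hp => hN p.extent (hL.ok p hp).inv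
    exact ⟨0, le_rfl, L, hL, hnone, (iterations_runs_of_forall_eq_none hpick hnone).mono
      (by simp) (by linarith [hL.length_le])⟩
  | succ N ih =>
    by_cases hnone : ∀ p ∈ L, cutOf p.extent = none
    · exact ⟨0, Nat.zero_le _, L, hL, hnone, (iterations_runs_of_forall_eq_none hpick hnone).mono
        (by simp) (by nlinarith [hL.length_le])⟩
    · push Not at hnone
      obtain ⟨L₁, hL₁, hrun₁⟩ := iterations_runs_of_exists_ne_none hE (hP j) hpick hL hnone
      obtain ⟨k, hk, L', hL', hnone', hrun⟩ :=
        ih (fun X hX => hN X (by rwa [← add_assoc, add_right_comm])) hL₁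
      refine ⟨k + 1, Nat.succ_le_succ hk, L', by rwa [← add_assoc, add_right_comm], hnone',
        (hrun₁ _ _ _ hrun).mono ?_ ?_⟩ <;> rw [add_mul] <;> lia

end Iteration

/-! ### The two phases -/

theorem run_halfN (a s : ℕ) : (halfN a).run s = some (a / 2, s + 1) := rfl

theorem run_ltN (a b s : ℕ) : (ltN a b).run s = some (decide (a < b), s + 1) := rfl

theorem run_readA (A : Array ℝ) (i s : ℕ) : (readA A i).run s = some (A.getD i 0, s + 1) := rfl

/-- The cut at the median of the candidates. -/
noncomputable def medianCut (arr : ℕ → ℝ) (X : Extent) : Option Cut :=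
  if X.lo < X.hi then some ⟨arr ((X.lo + X.hi) / 2), (X.lo + X.hi) / 2, (X.lo + X.hi) / 2 + 1⟩
  else none

/-- The cut at the midpoint of an extent longer than `δ`. -/
noncomputable def midCut (δ : ℝ) (X : Extent) : Option Cut :=
  if δ < X.b - X.a then some ⟨(X.a + X.b) / 2, X.hi, X.lo⟩ else none

section Cuts

variable {arr : ℕ → ℝ} {δ : ℝ} {X : Extent} {c : Cut}

theorem medianCut_eq_none_iff : medianCut arr X = none ↔ X.hi ≤ X.lo := by
  simp [medianCut]

theorem medianCut_eq_some_iff : medianCut arr X = some c ↔ X.lo < X.hi ∧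
    ⟨arr ((X.lo + X.hi) / 2), (X.lo + X.hi) / 2, (X.lo + X.hi) / 2 + 1⟩ = c := by
  simp [medianCut]

theorem midCut_eq_none_iff : midCut δ X = none ↔ X.b - X.a ≤ δ := by
  simp [midCut]

theorem midCut_eq_some_iff :
    midCut δ X = some c ↔ δ < X.b - X.a ∧ ⟨(X.a + X.b) / 2, X.hi, X.lo⟩ = c := by
  simp [midCut]

theorem pickData_runs (A : Array ℝ) (X : Box) :
    RunsIn (pickData A X) (medianCut (fun k => A.getD k 0) X.extent) 1 6 := by
  by_cases h : X.lo < X.hi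
  · refine ⟨6, by simp, le_rfl, fun s => ?_⟩
    simp [pickData, medianCut, Box.extent, h, run_tick, run_ltN, run_addN, run_halfN, run_readA]
  · refine ⟨2, by simp, by simp, fun s => ?_⟩
    simp [pickData, medianCut, Box.extent, h, run_tick, run_ltN]

theorem pickMid_runs (δ : ℝ) (X : Box) : RunsIn (pickMid δ X) (midCut δ X.extent) 1 6 := by
  by_cases h : δ < X.b - X.a
  · refine ⟨5, by simp, by simp, fun s => ?_⟩
    simp [pickMid, midCut, Box.extent, h, run_tick, run_ltR, run_addR, run_halfR, run_subR]
  · refine ⟨3, by simp, by simp, fun s => ?_⟩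
    simp [pickMid, midCut, Box.extent, h, run_tick, run_ltR, run_subR]

end Cuts

/-- `arr 0 < ⋯ < arr (m - 1)` are the data values of `E`. -/
structure Ranks (E : List Cell) (arr : ℕ → ℝ) (m : ℕ) : Prop where
  strictMonoOn : StrictMonoOn arr (Set.Iio m)
  image_eq : arr '' Set.Iio m = {x | ∃ e ∈ E, e.1.1 = x}

/-- The invariant of the first phase after `j` iterations; `m` is the number of distinct data
values. The ends of an extent with candidates are data values next to the candidates, or the
least or the greatest data value. -/
structure MedianInv (arr : ℕ → ℝ) (m j : ℕ) (X : Extent) : Prop where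
  a_mem : X.a ∈ arr '' Set.Iio m
  b_mem : X.b ∈ arr '' Set.Iio m
  hi_le : X.hi ≤ m
  sub_mul_le : (X.hi - X.lo) * 2 ^ j ≤ m
  a_eq : X.lo < X.hi → X.a = arr (X.lo - 1)
  b_eq : X.lo < X.hi → X.b = arr (min X.hi (m - 1))

/-- The invariant of the second phase after `j` iterations: the ends of an extent are dyadic
multiples of elements of `G`, and the extent is short enough. -/
structure MidInv (G : AddSubgroup ℝ) (δ D : ℝ) (j : ℕ) (X : Extent) : Prop where
  a_mem : 2 ^ j * X.a ∈ G
  b_mem : 2 ^ j * X.b ∈ G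
  hi_le_lo : X.hi ≤ X.lo
  length_le : X.b - X.a ≤ δ ∨ (X.b - X.a) * 2 ^ j ≤ D

section Steps

variable {E : List Cell} {arr : ℕ → ℝ} {m j : ℕ} {X : Extent} {c : Cut}

theorem Ranks.exists_eq (hr : Ranks E arr m) {e : Cell} (he : e ∈ E) : ∃ k < m, arr k = e.1.1 :=
  hr.image_eq.ge ⟨e, he, rfl⟩

theorem medianCut_validCut (hr : Ranks E arr m) (hX : MedianInv arr m j X)
    (hc : medianCut arr X = some c) : ValidCut E arr X c := by
  obtain ⟨hlt, rfl⟩ := medianCut_eq_some_iff.1 hc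
  have hm := hX.hi_le
  have hle : ∀ {i k}, i < m → k < m → (arr i ≤ arr k ↔ i ≤ k) := hr.strictMonoOn.le_iff_le
  have hlt_iff : ∀ {i k}, i < m → k < m → (arr i < arr k ↔ i < k) := hr.strictMonoOn.lt_iff_lt
  refine ⟨?_, ?_, fun heq e he => ?_, fun heq e he => ?_, fun k _ hhi h => ?_,
    fun k _ hhi h => ?_⟩
  · rw [hX.a_eq hlt, hle (by lia) (by lia)]
    lia
  · rw [hX.b_eq hlt, hle (by lia) (by lia)]
    lia
  · obtain ⟨k, hk, hke⟩ := hr.exists_eq he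
    have := (hle (by lia) (by lia)).1 (heq.trans (hX.a_eq hlt)).le
    rw [← hke, hle (by lia) hk]
    lia
  · obtain ⟨k, hk, hke⟩ := hr.exists_eq he
    have := (hle (by lia) (by lia)).1 (heq.trans (hX.b_eq hlt)).ge
    rw [← hke, hle hk (by lia)]
    lia
  · exact (hlt_iff (by lia) (by lia)).1 h
  · exact (hlt_iff (by lia) (by lia)).1 h

theorem medianCut_isStep (hr : Ranks E arr m) (j : ℕ) :
    IsStep E arr (medianCut arr) (MedianInv arr m j) (MedianInv arr m (j + 1)) := by
  have hpow : ∀ {d d' : ℕ}, d * 2 ^ j ≤ m → 2 * d' ≤ d → d' * 2 ^ (j + 1) ≤ m := fun h h' => by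
    rw [pow_succ', ← mul_assoc, mul_comm _ 2]
    exact (Nat.mul_le_mul_right _ h').trans h
  refine ⟨fun X c hX hc => medianCut_validCut hr hX hc, fun X hX hc => ?_,
    fun X c s hX hc _ _ => ?_⟩
  · have hle := medianCut_eq_none_iff.1 hc
    exact ⟨hX.a_mem, hX.b_mem, hX.hi_le, hpow hX.sub_mul_le (by lia),
      fun h => absurd h hle.not_gt, fun h => absurd h hle.not_gt⟩
  · obtain ⟨hlt, rfl⟩ := medianCut_eq_some_iff.1 hc
    have hm := hX.hi_le
    have hmem : arr ((X.lo + X.hi) / 2) ∈ arr '' Set.Iio m :=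
      Set.mem_image_of_mem arr (Set.mem_Iio.2 (by lia))
    cases s with
    | neg =>
      refine ⟨hX.a_mem, hmem, by dsimp only [Extent.restrict]; lia,
        hpow hX.sub_mul_le (by dsimp only [Extent.restrict]; lia), fun _ => hX.a_eq hlt,
        fun _ => ?_⟩
      dsimp only [Extent.restrict]
      rw [min_eq_left (by lia)]
    | zero => exact ⟨hmem, hmem, Nat.zero_le _, by simp [Extent.restrict],
        by simp [Extent.restrict], by simp [Extent.restrict]⟩
    | pos => exact ⟨hmem, hX.b_mem, hm,
        hpow hX.sub_mul_le (by dsimp only [Extent.restrict]; lia), fun _ => rfl,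
        fun _ => hX.b_eq hlt⟩

theorem midCut_validCut {δ : ℝ} (hδ : 0 < δ) (hc : midCut δ X = some c) : ValidCut E arr X c := by
  obtain ⟨hlt, rfl⟩ := midCut_eq_some_iff.1 hc
  refine ⟨?_, ?_, fun h => ?_, fun h => ?_, fun _ _ h _ => h, fun _ h _ _ => h⟩ <;>
    dsimp only at * <;> linarith

theorem midCut_isStep {G : AddSubgroup ℝ} {δ D : ℝ} (hδ : 0 < δ) (j : ℕ) :
    IsStep E arr (midCut δ) (MidInv G δ D j) (MidInv G δ D (j + 1)) := by
  have hdouble : ∀ {x : ℝ}, 2 ^ j * x ∈ G → 2 ^ (j + 1) * x ∈ G := fun {x} hx => by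
    rw [show 2 ^ (j + 1) * x = 2 ^ j * x + 2 ^ j * x by ring]
    exact add_mem hx hx
  refine ⟨fun X c _ hc => midCut_validCut hδ hc, fun X hX hc =>
    ⟨hdouble hX.a_mem, hdouble hX.b_mem, hX.hi_le_lo, Or.inl (midCut_eq_none_iff.1 hc)⟩,
    fun X c s hX hc _ _ => ?_⟩
  obtain ⟨hlt, rfl⟩ := midCut_eq_some_iff.1 hc
  have hmid : 2 ^ (j + 1) * ((X.a + X.b) / 2) ∈ G := by
    rw [show 2 ^ (j + 1) * ((X.a + X.b) / 2) = 2 ^ j * X.a + 2 ^ j * X.b by ring]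
    exact add_mem hX.a_mem hX.b_mem
  have hD := hX.length_le.resolve_left hlt.not_ge
  cases s with
  | neg =>
    refine ⟨hdouble hX.a_mem, hmid, hX.hi_le_lo, Or.inr (hD.trans_eq' ?_)⟩
    dsimp only [Extent.restrict]
    ring
  | zero => exact ⟨hmid, hmid, le_rfl, Or.inl (by simpa [Extent.restrict] using hδ.le)⟩
  | pos =>
    refine ⟨hmid, hdouble hX.b_mem, hX.hi_le_lo, Or.inr (hD.trans_eq' ?_)⟩
    dsimp only [Extent.restrict]
    ring

end Steps

theorem MedianInv.medianCut_eq_none {arr : ℕ → ℝ} {m j : ℕ} {X : Extent}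
    (hX : MedianInv arr m j X) (hm : m < 2 ^ j) : medianCut arr X = none := by
  refine medianCut_eq_none_iff.2 (Nat.sub_eq_zero_iff_le.1 ?_)
  by_contra hne
  exact hm.not_ge ((Nat.le_mul_of_pos_left _ (Nat.pos_of_ne_zero hne)).trans hX.sub_mul_le)

theorem MidInv.midCut_eq_none {G : AddSubgroup ℝ} {δ D : ℝ} {j : ℕ} {X : Extent}
    (hX : MidInv G δ D j X) (hD : D ≤ δ * 2 ^ j) : midCut δ X = none :=
  midCut_eq_none_iff.2 <| hX.length_le.elim id fun h =>
    le_of_mul_le_mul_right (h.trans hD) (by positivity)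

theorem SortsDistinct.ranks {zs : List ℝ} {E : List Cell}
    (h : SortsDistinct zs (E.map fun e => e.1.1)) :
    Ranks E (fun k => zs.toArray.getD k 0) zs.length := by
  have hget : ∀ {k : ℕ} (hk : k < zs.length), zs.toArray.getD k 0 = zs[k] := fun hk => by
    simp [Array.getD, hk]
  refine ⟨fun i hi k hk hik => ?_, ?_⟩
  · rw [hget hi, hget hk]
    exact List.pairwise_iff_getElem.1 h.pairwise i k hi hk hik
  · ext x
    rw [Set.mem_ofPred_eq, ← List.mem_map, ← h.mem_iff, List.mem_iff_getElem]
    constructor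
    · rintro ⟨k, hk, rfl⟩
      exact ⟨k, hk, (hget hk).symm⟩
    · rintro ⟨k, hk, rfl⟩
      exact ⟨k, hk, hget hk⟩

/-- At the start every vertex is a block, and all data values are candidates. -/
def initialItems (E : List Cell) (arr : ℕ → ℝ) (m : ℕ) : List Item :=
  E.map fun e => ⟨⟨arr 0, arr (m - 1), 0, m⟩, [e]⟩

/-- The output for the blocks `L`. -/
def outputOf (L : List Item) : List (ℝ × ℝ) :=
  L.flatMap fun p => List.replicate p.cells.length (p.extent.a, p.extent.b)

section Algorithm

variable {E : List Cell} {arr : ℕ → ℝ} {m k : ℕ} {J J' : Extent → Prop} {L : List Item}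
  {G : AddSubgroup ℝ} {δ U : ℝ}

theorem Ranks.mem_Icc (hr : Ranks E arr m) {e : Cell} (he : e ∈ E) :
    0 < m ∧ e.1.1 ∈ Set.Icc (arr 0) (arr (m - 1)) := by
  obtain ⟨k, hk, hke⟩ := hr.exists_eq he
  have hle : ∀ {i k}, i < m → k < m → (arr i ≤ arr k ↔ i ≤ k) := hr.strictMonoOn.le_iff_le
  rw [← hke]
  exact ⟨by lia, (hle (by lia) hk).2 (Nat.zero_le _), (hle hk (by lia)).2 (by lia)⟩

theorem State.initial (hE : StableCells E) (hr : Ranks E arr m) :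
    State E arr (MedianInv arr m 0) (initialItems E arr m) := by
  have hreg : ∀ e ∈ E, e.2 ∈ Set.Icc (arr 0) (arr (m - 1)) := fun e he =>
    ⟨hE.ge_of_forall_ge (fun e' he' => (hr.mem_Icc he').2.1) e he,
      hE.le_of_forall_le (fun e' he' => (hr.mem_Icc he').2.2) e he⟩
  refine ⟨List.forall_mem_map.2 fun e he => ?_, ?_, ?_⟩
  · obtain ⟨hm, hle⟩ := hr.mem_Icc he
    refine ⟨⟨by simp, by simpa using he, hle.1.trans hle.2, by simp [IsConstant],
      by simpa using hreg e he, ?_⟩, ⟨Set.mem_image_of_mem arr hm, Set.mem_image_of_mem arr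
      (Set.mem_Iio.2 (by lia)), le_rfl, by simp, fun _ => rfl, fun _ => by simp⟩⟩
    rintro e' - ⟨e'', he'', heq⟩
    obtain ⟨k, hk, hke⟩ := hr.exists_eq he''
    exact Or.inr ⟨k, Nat.zero_le _, hk, hke.trans heq⟩
  · exact List.pairwise_map.2 (List.pairwise_of_forall fun _ _ => Or.inr rfl)
  · simp [initialItems, List.flatMap_map]

theorem State.imp (hL : State E arr J L) (h : ∀ p ∈ L, J p.extent → J' p.extent) :
    State E arr J' L :=
  ⟨fun p hp => ⟨(hL.ok p hp).toFits, h p hp (hL.ok p hp).inv⟩, hL.prec, hL.cover⟩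

theorem MedianInv.midInv {X : Extent} (hr : Ranks E arr m) (hU : ∀ e ∈ E, |e.1.1| ≤ U)
    (hG : ∀ e ∈ E, e.1.1 ∈ G) (hX : MedianInv arr m k X) (hnone : medianCut arr X = none) :
    MidInv G δ (2 * U) 0 X := by
  obtain ⟨e, he, ha⟩ := hr.image_eq.le hX.a_mem
  obtain ⟨e', he', hb⟩ := hr.image_eq.le hX.b_mem
  refine ⟨by simpa [← ha] using hG e he, by simpa [← hb] using hG e' he',
    medianCut_eq_none_iff.1 hnone, Or.inr ?_⟩
  rw [← ha, ← hb]
  linarith [abs_le.1 (hU e he), abs_le.1 (hU e' he')]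

theorem initialItems_runs (E : List Cell) (arr : ℕ → ℝ) (m : ℕ) :
    RunsIn (initBoxes (arr 0) (arr (m - 1)) m (E.map Prod.fst))
      ((initialItems E arr m).map Item.box) 1 (E.length + 1) := by
  have hboxes : (initialItems E arr m).map Item.box =
      List.replicate E.length ⟨1, arr 0, arr (m - 1), 0, m⟩ := by
    simp [initialItems, Item.box, Function.comp_def]
  rw [hboxes, ← List.length_map (f := Prod.fst)]
  exact initBoxes_runs _ _ _ _

theorem outputOf_runs (hL : State E arr J L) :
    RunsIn (output (L.map Item.box)) (outputOf L) 1 (3 * E.length + 1) := by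
  have hout := output_runs (L.map Item.box)
  have hlen : ((L.map Item.box).map Box.len).sum = E.length := by
    rw [← hL.cover, List.length_flatMap, List.map_map]
    rfl
  rw [hlen, List.length_map, List.flatMap_map] at hout
  exact hout.mono le_rfl (by have := hL.length_le; lia)

theorem strictAlg_runs (hE : StableCells E) (hδ : 0 < δ) (hU : ∀ e ∈ E, |e.1.1| ≤ U)
    (hG : ∀ e ∈ E, e.1.1 ∈ G) (N : ℕ) (hN : 2 * U ≤ δ * 2 ^ N) :
    ∃ arr k L, State E arr (MidInv G δ (2 * U) k) L ∧ (∀ p ∈ L, p.extent.b - p.extent.a ≤ δ) ∧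
      RunsIn (strictAlg (E.map Prod.fst) δ) (outputOf L)
        (E.length * Nat.log 2 E.length + k * E.length)
        (8 * E.length * Nat.clog 2 E.length +
          (Nat.log 2 E.length + N + 3) * (86 * E.length + 5) + 6 * E.length + 10) := by
  obtain ⟨zs, hsort, hzs⟩ := sortDistinct_runs ((E.map Prod.fst).map Prod.fst)
  have hm := hzs.length_le
  rw [List.map_map] at hzs
  have hr := SortsDistinct.ranks hzs
  set A : Array ℝ := zs.toArray
  set arr : ℕ → ℝ := fun k => A.getD k 0
  obtain ⟨k₁, -, L₁, hL₁, hnone₁, hphase₁⟩ := iterations_runs hE (medianCut_isStep hr)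
    (pickData_runs A) (Nat.log 2 E.length + 1) (fun X hX => hX.medianCut_eq_none (by
      simpa using hm.trans_lt (Nat.lt_pow_succ_log_self one_lt_two _))) (State.initial hE hr)
  obtain ⟨k, -, L, hL, hnone, hphase₂⟩ := iterations_runs hE (midCut_isStep hδ)
    (pickMid_runs δ) N (fun X hX => hX.midCut_eq_none (by simpa using hN))
    (hL₁.imp fun p hp hX => hX.midInv (δ := δ) hr hU hG (hnone₁ p hp))
  rw [zero_add] at hL
  refine ⟨arr, k, L, hL, fun p hp => midCut_eq_none_iff.1 (hnone p hp), ?_⟩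
  have hvalues := values_runs (E.map Prod.fst)
  have hfill := fillArray_runs zs #[]
  have hread : ∀ i, RunsIn (readA A i) (arr i) 1 1 := fun i => RunsIn.of_run 1 fun _ => rfl
  have hpred : RunsIn (predN A.size) (zs.length - 1) 1 1 := RunsIn.of_run 1 fun _ => rfl
  rw [Array.empty_append] at hfill
  simp only [List.length_map] at hvalues hsort hm
  refine (RunsIn.tick_bind (hvalues.bind (hsort.bind (hfill.bind ((hread 0).bind (hpred.bind
    ((hread _).bind ((initialItems_runs E arr zs.length).bind
      (hphase₁.bind (hphase₂.bind (outputOf_runs hL))))))))))).mono (by lia) ?_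
  rw [show (Nat.log 2 E.length + N + 3) * (86 * E.length + 5) =
    (Nat.log 2 E.length + 1 + 1) * (86 * E.length + 5) + (N + 1) * (86 * E.length + 5) by ring]
  lia

end Algorithm

/-! ### Correctness -/

theorem forall₂_outputOf {R : Cell → ℝ × ℝ → Prop} {L : List Item}
    (h : ∀ p ∈ L, ∀ e ∈ p.cells, R e (p.extent.a, p.extent.b)) :
    List.Forall₂ R (L.flatMap Item.cells) (outputOf L) := by
  induction L with
  | nil => exact List.Forall₂.nil
  | cons p L ih =>
    rw [List.forall_mem_cons] at h
    refine List.rel_append ?_ (ih h.2)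
    dsimp only
    rw [← List.map_const', List.forall₂_map_right_iff, List.forall₂_same]
    exact h.1

theorem State.pairwise_outputOf {E : List Cell} {arr : ℕ → ℝ} {J : Extent → Prop} {L : List Item}
    (hL : State E arr J L) : (outputOf L).Pairwise (· ≤ ·) := by
  rw [outputOf, List.pairwise_flatMap]
  refine ⟨fun p _ => List.pairwise_replicate.2 (Or.inr le_rfl),
    hL.prec.imp_of_mem fun {p q} hp hq hpq z hz z' hz' => ?_⟩
  rw [List.eq_of_mem_replicate hz, List.eq_of_mem_replicate hz']
  have hp_le := (hL.ok p hp).le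
  have hq_le := (hL.ok q hq).le
  rcases hpq with h | h
  · exact ⟨hp_le.trans h, h.trans hq_le⟩
  · rw [h]

theorem exists_le_mul_two_pow {δ : ℝ} (hδ : 0 < δ) (x : ℝ) : ∃ N : ℕ, x ≤ δ * 2 ^ N := by
  obtain ⟨N, hN⟩ := pow_unbounded_of_one_lt (x / δ) one_lt_two
  exact ⟨N, ((div_lt_iff₀' hδ).1 hN).le⟩

section Run

variable {n : ℕ} {f w g : Fin n → ℝ} {δ : ℝ} {G : AddSubgroup ℝ}

theorem strictAlg_dataOf_runs (hw : ∀ i, 0 < w i) (hg : IsStable f w g) (hδ : 0 < δ)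
    (hG : ∀ i, f i ∈ G) (N : ℕ) (hN : 2 * ‖f‖ ≤ δ * 2 ^ N) :
    ∃ arr k L, State (cellsOf f w g) arr (MidInv G δ (2 * ‖f‖) k) L ∧
      (∀ p ∈ L, p.extent.b - p.extent.a ≤ δ) ∧
      RunsIn (strictAlg (dataOf f w) δ) (outputOf L) (n * Nat.log 2 n + k * n)
        (8 * n * Nat.clog 2 n + (Nat.log 2 n + N + 3) * (86 * n + 5) + 6 * n + 10) := by
  simpa only [map_fst_cellsOf, length_cellsOf] using strictAlg_runs (hg.stableCells hw) hδ
    (List.forall_mem_map.2 fun i _ => norm_le_pi_norm f i)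
    (List.forall_mem_map.2 fun i _ => hG i) N hN

theorem exists_outputOf_eq_ofFn {arr : ℕ → ℝ} {J : Extent → Prop} {L : List Item}
    (hL : State (cellsOf f w g) arr J L) {R : Cell → ℝ × ℝ → Prop}
    (h : ∀ p ∈ L, ∀ e ∈ p.cells, R e (p.extent.a, p.extent.b)) :
    ∃ z : Fin n → ℝ × ℝ, outputOf L = List.ofFn z ∧ Monotone z ∧
      ∀ i, R ((f i, w i), g i) (z i) := by
  have hcells := forall₂_outputOf h
  have hmono := hL.pairwise_outputOf
  rw [hL.cover] at hcells
  have hlen : (outputOf L).length = n := by rw [← hcells.length_eq, length_cellsOf]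
  obtain ⟨z, hz⟩ : ∃ z : Fin n → ℝ × ℝ, outputOf L = List.ofFn z :=
    ⟨fun i => (outputOf L)[i], by subst hlen; exact List.ofFn_getElem.symm⟩
  rw [hz] at hmono hcells
  rw [cellsOf, List.ofFn_eq_map, List.forall₂_map_left_iff, List.forall₂_map_right_iff,
    List.forall₂_same] at hcells
  exact ⟨z, hz, monotone_iff_forall_lt.2 fun i j hij => List.pairwise_ofFn.1 hmono hij,
    fun i => hcells i (List.mem_finRange i)⟩

theorem strictAlg_correct (hw : ∀ i, 0 < w i) (hg : IsStable f w g) (hδ : 0 < δ) :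
    ∃ (lower upper : Fin n → ℝ) (t : ℕ),
      HaltsWith (strictAlg (dataOf f w) δ) (List.ofFn fun i => (lower i, upper i)) t ∧
      Monotone lower ∧ Monotone upper ∧
      (∀ i, lower i ≤ g i ∧ g i ≤ upper i ∧ upper i - lower i ≤ δ) ∧
      (∀ i, g i ∈ Set.range f → lower i = g i ∧ upper i = g i) := by
  obtain ⟨N, hN⟩ := exists_le_mul_two_pow hδ (2 * ‖f‖)
  obtain ⟨arr, k, L, hL, hLδ, hrun⟩ :=
    strictAlg_dataOf_runs hw hg hδ (G := ⊤) (fun _ => trivial) N hN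
  obtain ⟨t, -, -, ht⟩ := hrun.exists_haltsWith_between
  have hdata : ∀ p ∈ L, ∀ e ∈ p.cells, e.2 ∈ Set.range f → p.extent.a = p.extent.b := by
    rintro p hp e he ⟨i, hi⟩
    have hdatum : ∃ e' ∈ cellsOf f w g, e'.1.1 = e.2 :=
      ⟨_, List.mem_map_of_mem (List.mem_finRange i), hi⟩
    refine ((hL.ok p hp).candidate e he hdatum).resolve_right ?_
    rintro ⟨r, hlo, hhi, -⟩
    exact (hlo.trans_lt hhi).not_ge (hL.ok p hp).inv.hi_le_lo
  obtain ⟨z, hz, hz_mono, hz_mem⟩ := exists_outputOf_eq_ofFn hL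
    (R := fun e z => e.2 ∈ Set.Icc z.1 z.2 ∧ z.2 - z.1 ≤ δ ∧ (e.2 ∈ Set.range f → z.1 = z.2))
    fun p hp e he => ⟨(hL.ok p hp).mem_Icc e he, hLδ p hp, hdata p hp e he⟩
  refine ⟨fun i => (z i).1, fun i => (z i).2, t, hz ▸ ht, fun i j hij => (hz_mono hij).1,
    fun i j hij => (hz_mono hij).2, fun i => ?_, fun i hi => ?_⟩ <;>
    obtain ⟨⟨hlower, hupper⟩, hzδ, heq⟩ := hz_mem i
  · exact ⟨hlower, hupper, hzδ⟩
  · have hpoint := heq hi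
    exact ⟨hlower.antisymm (by rwa [hpoint]), hupper.antisymm' (by rwa [← hpoint])⟩

end Run

/-! ### Running time -/

theorem HaltsWith.time_unique {α : Type} {c : RAM α} {x x' : α} {t t' : ℕ}
    (h : HaltsWith c x t) (h' : HaltsWith c x' t') : t = t' :=
  congrArg Prod.snd (Option.some.inj (h.symm.trans h'))

section UpperBound

variable {n N : ℕ} {x y M δ : ℝ}

theorem one_le_logb_two (hx : 2 ≤ x) : 1 ≤ Real.logb 2 x := by
  rwa [Real.le_logb_iff_rpow_le one_lt_two (by linarith), Real.rpow_one]

theorem clog_two_le_two_mul_logb (hn : 2 ≤ n) : (Nat.clog 2 n : ℝ) ≤ 2 * Real.logb 2 n := by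
  have hlog : 1 ≤ Real.logb 2 n := one_le_logb_two (by exact_mod_cast hn)
  have hceil : (⌈Real.logb 2 n⌉₊ : ℝ) = Nat.clog 2 n := by
    exact_mod_cast Real.natCeil_logb_natCast 2 n
  linarith [Nat.ceil_lt_add_one (zero_le_one.trans hlog)]

theorem two_mul_le_mul_two_pow (hδ : 0 < δ) (hM : 0 < M) (hx : x / δ ≤ M)
    (hN : Real.logb 2 M + 1 ≤ N) : 2 * x ≤ δ * 2 ^ N := by
  have hpow : M * 2 ≤ 2 ^ N := calc
    M * 2 = (2 : ℝ) ^ (Real.logb 2 M + 1) := by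
      rw [Real.rpow_add_one two_ne_zero, Real.rpow_logb two_pos (by norm_num) hM]
    _ ≤ (2 : ℝ) ^ (N : ℝ) := Real.rpow_le_rpow_of_exponent_le one_le_two hN
    _ = 2 ^ N := Real.rpow_natCast 2 N
  calc 2 * x ≤ 2 * (δ * M) := by gcongr; exact (div_le_iff₀' hδ).1 hx
    _ = δ * (M * 2) := by ring
    _ ≤ δ * 2 ^ N := by gcongr

theorem step_count_le {l c k : ℝ} (hy : 1 ≤ y) (hx : 1 ≤ x) (hl : l ≤ x) (hc : c ≤ 2 * x)
    (hk : k ≤ 3 * x) :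
    8 * y * c + (l + k + 3) * (86 * y + 5) + 6 * y + 10 ≤ 700 * (y * x) := calc
  8 * y * c + (l + k + 3) * (86 * y + 5) + 6 * y + 10
    ≤ 8 * y * (2 * x) + 7 * x * (91 * y) + 6 * y + 10 := by gcongr <;> linarith
  _ ≤ 700 * (y * x) := by nlinarith

theorem strictAlg_time_le {f w : Fin n → ℝ} (hn : 2 ≤ n) (hw : ∀ i, 0 < w i) (hδ : 0 < δ)
    {out : List (ℝ × ℝ)} {t : ℕ} (h : HaltsWith (strictAlg (dataOf f w) δ) out t) :
    (t : ℝ) ≤ 700 / Real.log 2 * (n * Real.log (max (n : ℝ) (‖f‖ / δ))) := by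
  obtain ⟨g, hg⟩ := exists_isStable f hw
  set M := max (n : ℝ) (‖f‖ / δ)
  have hn2 : (2 : ℝ) ≤ n := by exact_mod_cast hn
  have hnM : (n : ℝ) ≤ M := le_max_left _ _
  have hM1 : 1 ≤ Real.logb 2 M := one_le_logb_two (hn2.trans hnM)
  have hlogn : Real.logb 2 n ≤ Real.logb 2 M := Real.logb_le_logb_of_le one_lt_two (by linarith) hnM
  obtain ⟨arr, k, L, -, -, hrun⟩ := strictAlg_dataOf_runs hw hg hδ (G := ⊤) (fun _ => trivial)
    ⌈Real.logb 2 M + 1⌉₊ (two_mul_le_mul_two_pow hδ (by linarith) (le_max_right _ _)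
      (Nat.le_ceil _))
  obtain ⟨t', -, ht', h'⟩ := hrun.exists_haltsWith_between
  rw [← h.time_unique h'] at ht'
  have hlog : (Nat.log 2 n : ℝ) ≤ Real.logb 2 n := by exact_mod_cast Real.natLog_le_logb n 2
  have hN := Nat.ceil_lt_add_one (by linarith : 0 ≤ Real.logb 2 M + 1)
  calc (t : ℝ) ≤ 8 * n * Nat.clog 2 n +
        (Nat.log 2 n + ⌈Real.logb 2 M + 1⌉₊ + 3) * (86 * n + 5) + 6 * n + 10 := by
        exact_mod_cast ht'
    _ ≤ 700 * (n * Real.logb 2 M) := step_count_le (by linarith) hM1 (by linarith)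
        (by linarith [clog_two_le_two_mul_logb hn]) (by linarith)
    _ = 700 / Real.log 2 * (n * Real.log M) := by rw [← Real.log_div_log]; ring

end UpperBound

theorem exists_append_of_pairwise_imp {α : Type*} {p : α → Prop} {l : List α}
    (h : l.Pairwise fun x y => p y → p x) :
    ∃ l₁ l₂, l = l₁ ++ l₂ ∧ (∀ x ∈ l₁, p x) ∧ ∀ x ∈ l₂, ¬p x := by
  induction l with
  | nil => exact ⟨[], [], rfl, by simp, by simp⟩
  | cons x l ih =>
    rw [List.pairwise_cons] at h
    by_cases hx : p x
    · obtain ⟨l₁, l₂, rfl, hl₁, hl₂⟩ := ih h.2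
      exact ⟨x :: l₁, l₂, rfl, List.forall_mem_cons.2 ⟨hx, hl₁⟩, hl₂⟩
    · exact ⟨[], x :: l, rfl, by simp,
        List.forall_mem_cons.2 ⟨hx, fun y hy hpy => hx (h.1 y hy hpy)⟩⟩

namespace StableCells

variable {P R : List Cell} {e : Cell} {y : ℝ}

theorem le_head_of_forall_prefix (hE : StableCells (e :: R))
    (h : ∀ S ≠ [], S <+: (e :: R).map Prod.fst → y ≤ limMean S) : y ≤ e.2 := by
  obtain ⟨Q, Q', hQQ', hQ, hQ'⟩ := exists_append_of_pairwise_imp (p := fun e' => e'.2 ≤ e.2)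
    (hE.mono.imp fun hle => hle.trans)
  have hne : Q ≠ [] := by
    rintro rfl
    rw [List.nil_append] at hQQ'
    exact hQ' e (hQQ' ▸ List.mem_cons_self) le_rfl
  refine (h (Q.map Prod.fst) (by simpa using hne) (hQQ' ▸ (List.prefix_append Q Q').map _)).trans ?_
  exact hE.cellMean_le (P := []) hQQ' hne hQ fun e' he' => not_le.1 (hQ' e' he')

theorem le_of_forall_suffix (hE : StableCells (P ++ e :: R))
    (h : ∀ S ≠ [], S <:+ (P ++ [e]).map Prod.fst → limMean S ≤ y) : e.2 ≤ y := by
  have hPR : P ++ e :: R = P ++ [e] ++ R := by simp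
  have hmono := hE.mono
  rw [hPR] at hmono
  obtain ⟨P', Q, hPQ, hP', hQ⟩ := exists_append_of_pairwise_imp (p := fun e' => e'.2 < e.2)
    ((List.pairwise_append.1 hmono).1.imp fun hle => hle.trans_lt)
  have hne : Q ≠ [] := by
    rintro rfl
    rw [List.append_nil] at hPQ
    exact (hP' e (hPQ ▸ List.mem_concat_self)).false
  refine le_trans ?_ <| h (Q.map Prod.fst) (by simpa using hne)
    (hPQ ▸ (List.suffix_append P' Q).map _)
  exact hE.le_cellMean (hPR.trans (by rw [hPQ])) hne hP' fun e' he' => not_lt.1 (hQ e' he')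

end StableCells

theorem lt_limMean_of_signSum_neg {S : List (ℝ × ℝ)} {y : ℝ} (hS : IsPosFamily S)
    (hy : ∀ r ∈ S, r.1 ≠ y) (h : signSum S y < 0) : y < limMean S := by
  have heq : eqSum S y = 0 := by
    refine (eqSum_nonneg hS.weight_pos y).eq_of_not_lt' fun hpos => ?_
    obtain ⟨r, hr, hry⟩ := (eqSum_pos_iff hS.weight_pos).1 hpos
    exact hy r hr hry
  refine LiesBelow.lt_limMean_of_reflect hS (Or.inl ?_)
  rw [eqSum_reflect, signSum_reflect, heq]
  exact neg_pos.2 h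

section SlowInput

variable {n m : ℕ} {U δ a b : ℝ} {S : List (ℝ × ℝ)}

/-- The values of an input on which the algorithm is slow: the limit mean of the first three
vertices is `U / 3`, which is not a dyadic multiple of `U`. -/
def slowValue (n : ℕ) (U : ℝ) (i : Fin n) : ℝ :=
  if (i : ℕ) = 1 then 0 else if (i : ℕ) = 2 then -U else U

/-- The weights that belong to `slowValue`. -/
def slowWeight (n : ℕ) (i : Fin n) : ℝ := if (i : ℕ) = 0 then 2 else 1

theorem slowWeight_pos (n : ℕ) (i : Fin n) : 0 < slowWeight n i := by
  unfold slowWeight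
  split_ifs <;> norm_num

theorem norm_slowValue (hn : 0 < n) (hU : 0 ≤ U) : ‖slowValue n U‖ = U := by
  refine le_antisymm ((pi_norm_le_iff_of_nonneg hU).2 fun i => ?_) ?_
  · unfold slowValue
    split_ifs <;> simp [abs_of_nonneg hU, hU]
  · simpa [slowValue, abs_of_nonneg hU] using norm_le_pi_norm (slowValue n U) ⟨0, hn⟩

theorem cellsOf_slow (m : ℕ) (U : ℝ) (g : Fin (m + 3) → ℝ) :
    cellsOf (slowValue (m + 3) U) (slowWeight (m + 3)) g = ((U, 2), g 0) :: ((0, 1), g 1) ::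
      ((-U, 1), g 2) :: (List.finRange m).map fun i => ((U, 1), g i.succ.succ.succ) := by
  have hmod : 2 % (m + 3) = 2 := Nat.mod_eq_of_lt (by lia)
  have htwo : (2 : Fin (m + 3)) ≠ 0 := Fin.ne_of_val_ne (by simp [hmod])
  simp [cellsOf, List.finRange_succ, slowValue, slowWeight, Function.comp_def, hmod, htwo]

theorem limMean_slow_triple (hU : 0 < U) : limMean [(U, 2), (0, 1), (-U, 1)] = U / 3 := by
  have hbelow : U / 3 - U = -(2 * (U / 3)) := by ring
  have habove : U / 3 - -U = 2 * (2 * (U / 3)) := by ring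
  have hthird : U / 3 ≠ 0 := by positivity
  have hneg : SignType.sign (U / 3 - U) = -1 := sign_neg (by linarith)
  have hzero : SignType.sign (U / 3 - 0) = 1 := sign_pos (by linarith)
  have hpos : SignType.sign (U / 3 - -U) = 1 := sign_pos (by linarith)
  refine LiesAt.limMean_eq ⟨by simp, by simp⟩ (Or.inr ⟨?_, ?_, ?_⟩)
  · simp [eqSum, hbelow, habove, hthird]
  · simp only [signSum, weightedSum_cons, weightedSum_nil, hneg, hzero, hpos]
    norm_num
  · simp only [logSum, signLog, weightedSum_cons, weightedSum_nil, hneg, hzero, hpos]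
    rw [Real.log_abs, Real.log_abs, Real.log_abs, hbelow, habove, sub_zero, Real.log_neg_eq_log,
      Real.log_mul two_ne_zero (mul_ne_zero two_ne_zero hthird), Real.log_mul two_ne_zero hthird]
    push_cast
    ring

theorem third_le_limMean_of_prefix (hU : 0 < U) (hne : S ≠ [])
    (hS : S <+: (U, 2) :: (0, 1) :: (-U, 1) :: List.replicate m (U, 1)) : U / 3 ≤ limMean S := by
  have hmem : ∀ r ∈ S, 0 < r.2 ∧ r.1 ≠ U / 3 := fun r hr => by
    have := hS.subset hr
    simp only [List.mem_cons, List.mem_replicate] at this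
    rcases this with rfl | rfl | rfl | ⟨-, rfl⟩ <;> exact ⟨by norm_num, by grind⟩
  have hlt : signSum S (U / 3) < 0 → U / 3 ≤ limMean S := fun h =>
    (lt_limMean_of_signSum_neg ⟨hne, fun r hr => (hmem r hr).1⟩ (fun r hr => (hmem r hr).2) h).le
  have hneg : SignType.sign (U / 3 - U) = -1 := sign_neg (by linarith)
  have hzero : SignType.sign (U / 3) = 1 := sign_pos (by linarith)
  have hpos : SignType.sign (U / 3 + U) = 1 := sign_pos (by linarith)
  simp only [List.prefix_cons_iff, List.prefix_replicate_iff] at hS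
  obtain rfl | ⟨_, rfl, rfl | ⟨_, rfl, rfl | ⟨S', rfl, -, hS'⟩⟩⟩ := hS
  · exact absurd rfl hne
  · exact hlt (by simp [signSum, hneg])
  · exact hlt (by simp [signSum, hneg, hzero])
  · rcases S'.length.eq_zero_or_pos with h0 | h0
    · rw [List.length_eq_zero_iff.1 h0, limMean_slow_triple hU]
    · have hsum : signSum ((U, 2) :: (0, 1) :: (-U, 1) :: List.replicate S'.length (U, 1)) (U / 3) =
          -S'.length := by
        simp [signSum, weightedSum, hneg, hzero, hpos]
        ring
      rw [← hS'] at hsum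
      exact hlt (by simpa [hsum] using h0)

theorem limMean_le_third_of_suffix (hU : 0 < U) (hne : S ≠ [])
    (hS : S <:+ [(U, 2), (0, 1), (-U, 1)]) : limMean S ≤ U / 3 := by
  rcases List.suffix_cons_iff.1 hS with rfl | hS
  · exact (limMean_slow_triple hU).le
  · have hmem : ∀ r ∈ S, r = (0, 1) ∨ r = (-U, 1) := fun r hr => by simpa using hS.subset hr
    refine limMean_le_of_forall_le ⟨hne, fun r hr => ?_⟩ fun r hr => ?_ <;>
      rcases hmem r hr with rfl | rfl <;> dsimp only <;> linarith

theorem IsStable.apply_zero_eq_third (hU : 0 < U) {g : Fin (m + 3) → ℝ}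
    (hg : IsStable (slowValue (m + 3) U) (slowWeight (m + 3)) g) : g 0 = U / 3 := by
  have hE := hg.stableCells (slowWeight_pos _)
  rw [cellsOf_slow] at hE
  have hg₂ : g 2 ≤ U / 3 := hE.le_of_forall_suffix (P := [((U, 2), g 0), ((0, 1), g 1)])
    fun S hne hS => limMean_le_third_of_suffix hU hne hS
  refine ((hg.mono (Fin.zero_le _)).trans hg₂).antisymm (hE.le_head_of_forall_prefix ?_)
  exact fun S hne hS => third_le_limMean_of_prefix (m := m) hU hne (by
    simpa [Function.comp_def] using hS)

theorem le_sub_mul_two_pow_of_mem_zmultiples {k : ℕ} (hU : 0 < U)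
    (ha : 2 ^ k * a ∈ AddSubgroup.zmultiples U) (hb : 2 ^ k * b ∈ AddSubgroup.zmultiples U)
    (hab : U / 3 ∈ Set.Icc a b) : U ≤ (b - a) * 2 ^ k := by
  obtain ⟨z, hz⟩ := AddSubgroup.mem_zmultiples_iff.1 ha
  obtain ⟨z', hz'⟩ := AddSubgroup.mem_zmultiples_iff.1 hb
  rw [zsmul_eq_mul] at hz hz'
  have hpow : (0 : ℝ) < 2 ^ k := by positivity
  have hlower : 3 * (z : ℝ) ≤ 2 ^ k := by
    refine le_of_mul_le_mul_right ?_ hU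
    nlinarith [mul_le_mul_of_nonneg_left hab.1 hpow.le]
  have hupper : (2 : ℝ) ^ k ≤ 3 * z' := by
    refine le_of_mul_le_mul_right ?_ hU
    nlinarith [mul_le_mul_of_nonneg_left hab.2 hpow.le]
  have hne : 3 * z ≠ 2 ^ k := fun h => by
    have hdvd : (3 : ℤ) ∣ 2 := Int.prime_three.dvd_of_dvd_pow ⟨z, h.symm⟩
    lia
  have hlower' : 3 * z ≤ 2 ^ k := by exact_mod_cast hlower
  have hupper' : 2 ^ k ≤ 3 * z' := by exact_mod_cast hupper
  have hgap : (z : ℝ) + 1 ≤ z' := by exact_mod_cast (show z + 1 ≤ z' by lia)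
  nlinarith

theorem State.logb_le_of_slow {g : Fin (m + 3) → ℝ} {arr : ℕ → ℝ} {D : ℝ} {k : ℕ} {L : List Item}
    (hU : 0 < U) (hδ : 0 < δ) (hg : IsStable (slowValue (m + 3) U) (slowWeight (m + 3)) g)
    (hL : State (cellsOf (slowValue (m + 3) U) (slowWeight (m + 3)) g) arr
      (MidInv (AddSubgroup.zmultiples U) δ D k) L)
    (hLδ : ∀ p ∈ L, p.extent.b - p.extent.a ≤ δ) : Real.logb 2 (U / δ) ≤ k := by
  have hcell : ((U, 2), g 0) ∈ L.flatMap Item.cells := by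
    rw [hL.cover, cellsOf_slow]
    exact List.mem_cons_self
  obtain ⟨p, hp, hpcell⟩ := List.mem_flatMap.1 hcell
  have hthird := (hL.ok p hp).mem_Icc _ hpcell
  rw [hg.apply_zero_eq_third hU] at hthird
  have hlong := le_sub_mul_two_pow_of_mem_zmultiples hU (hL.ok p hp).inv.a_mem
    (hL.ok p hp).inv.b_mem hthird
  rw [Real.logb_le_iff_le_rpow one_lt_two (by positivity), Real.rpow_natCast, div_le_iff₀' hδ]
  exact hlong.trans (mul_le_mul_of_nonneg_right (hLδ p hp) (by positivity))

theorem half_logb_max_le {x k : ℝ} (hn : 2 ≤ n) (hk : 0 ≤ k)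
    (hx : 0 < x → Real.logb 2 x ≤ k) : Real.logb 2 (max n x) / 2 ≤ Nat.log 2 n + k := by
  rcases le_total x n with hxn | hnx
  · have hfloor : (⌊Real.logb 2 n⌋₊ : ℝ) = Nat.log 2 n := by
      exact_mod_cast Real.natFloor_logb_natCast 2 n
    have hone : (1 : ℝ) ≤ Nat.log 2 n := by exact_mod_cast Nat.log_pos one_lt_two hn
    rw [max_eq_left hxn]
    linarith [Nat.lt_floor_add_one (Real.logb 2 n)]
  · have hx2 : 2 ≤ x := le_trans (by exact_mod_cast hn) hnx
    rw [max_eq_right hnx]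
    linarith [hx (by linarith), (Nat.log 2 n).cast_nonneg (α := ℝ)]

theorem exists_slow_input (hn : 3 ≤ n) (hδ : 0 < δ) :
    ∃ out t, HaltsWith (strictAlg (dataOf (slowValue n U) (slowWeight n)) δ) out t ∧
      1 / (2 * Real.log 2) * (n * Real.log (max (n : ℝ) (U / δ))) ≤ t := by
  obtain ⟨m, rfl⟩ := Nat.exists_eq_add_of_le' hn
  obtain ⟨g, hg⟩ := exists_isStable (slowValue (m + 3) U) (slowWeight_pos (m + 3))
  obtain ⟨N, hN⟩ := exists_le_mul_two_pow hδ (2 * ‖slowValue (m + 3) U‖)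
  have hvalues : ∀ i, slowValue (m + 3) U i ∈ AddSubgroup.zmultiples U := fun i => by
    unfold slowValue
    split_ifs <;> simp
  obtain ⟨arr, k, L, hL, hLδ, hrun⟩ :=
    strictAlg_dataOf_runs (slowWeight_pos _) hg hδ hvalues N hN
  obtain ⟨t, ht, -, hhalts⟩ := hrun.exists_haltsWith_between
  refine ⟨outputOf L, t, hhalts, ?_⟩
  have hlog := half_logb_max_le (n := m + 3) (by lia) k.cast_nonneg
    fun hU => hL.logb_le_of_slow ((div_pos_iff_of_pos_right hδ).1 hU) hδ hg hLδ
  calc 1 / (2 * Real.log 2) * (((m + 3 : ℕ) : ℝ) * Real.log (max ((m + 3 : ℕ) : ℝ) (U / δ)))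
      = (m + 3 : ℕ) * (Real.logb 2 (max (m + 3 : ℕ) (U / δ)) / 2) := by
        rw [← Real.log_div_log]
        ring
    _ ≤ (m + 3 : ℕ) * (Nat.log 2 (m + 3) + k) := by gcongr
    _ = ((m + 3) * Nat.log 2 (m + 3) + k * (m + 3) : ℕ) := by
        push_cast
        ring
    _ ≤ t := by exact_mod_cast ht

end SlowInput

end StrictIso

theorem mainTheorem4 :
    -- The statistics kept for a block are those of its original data values; they are computed
    -- by reading the block, maintained under merging, and they decide the position of the block's
    -- limit mean relative to the splitting value.
    (∀ S : List (ℝ × ℝ), S ≠ [] → (∀ q ∈ S, 0 < q.2) →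
      ∃ c : ℝ, (∀ c', IsMeanDownOne S c' ↔ c' = c) ∧
        ∀ y : ℝ,
          (∀ rest, ∃ t, HaltsWith (scan y S.length (S ++ rest) Stats.empty)
            (Stats.of y S, rest) t) ∧
          (∀ S', ∃ t, HaltsWith (mergeStats (Stats.of y S) (Stats.of y S'))
            (Stats.of y (S ++ S')) t) ∧
          ∃ t, HaltsWith (locate (Stats.of y S)) (cmp c y) t) ∧
    -- Correctness.
    (∀ (n : ℕ) (f w : Fin n → ℝ) (δ : ℝ), (∀ i, 0 < w i) → 0 < δ →
      ∃ g : Fin n → ℝ, (∀ g', IsStrictDownOne f w g' ↔ g' = g) ∧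
        ∃ (lower upper : Fin n → ℝ) (t : ℕ),
          HaltsWith (strictAlg (dataOf f w) δ) (List.ofFn fun i => (lower i, upper i)) t ∧
          Monotone lower ∧ Monotone upper ∧
          (∀ i, lower i ≤ g i ∧ g i ≤ upper i ∧ upper i - lower i ≤ δ) ∧
          (∀ i, g i ∈ Set.range f → lower i = g i ∧ upper i = g i)) ∧
    -- Running time; the sup norm `‖f‖` is the largest absolute value of the data.
    (∃ C : ℝ, 0 < C ∧ ∀ (n : ℕ) (f w : Fin n → ℝ) (δ : ℝ), 2 ≤ n → (∀ i, 0 < w i) → 0 < δ →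
      ∀ out t, HaltsWith (strictAlg (dataOf f w) δ) out t →
        (t : ℝ) ≤ C * (n * Real.log (max (n : ℝ) (‖f‖ / δ)))) ∧
    (∃ c : ℝ, 0 < c ∧ ∀ (n : ℕ) (U δ : ℝ), 3 ≤ n → 0 ≤ U → 0 < δ →
      ∃ f w : Fin n → ℝ, (∀ i, 0 < w i) ∧ ‖f‖ = U ∧
        ∃ out t, HaltsWith (strictAlg (dataOf f w) δ) out t ∧
          c * (n * Real.log (max (n : ℝ) (U / δ))) ≤ t) := by
  have : 0 < Real.log 2 := Real.log_pos one_lt_two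
  refine ⟨fun S hne hw => ?_, fun n f w δ hw hδ => ?_,
    ⟨700 / Real.log 2, by positivity, fun n f w δ hn hw hδ out t => strictAlg_time_le hn hw hδ⟩,
    ⟨1 / (2 * Real.log 2), by positivity, fun n U δ hn hU hδ => ⟨slowValue n U, slowWeight n,
      slowWeight_pos n, norm_slowValue (by lia) hU, exists_slow_input hn hδ⟩⟩⟩
  · have hS : IsPosFamily S := ⟨hne, hw⟩
    refine ⟨limMean S, isMeanDownOne_iff hS, fun y => ⟨fun rest => ?_, fun S' => ?_, ?_⟩⟩
    · rw [← Stats.empty_combine (Stats.of y S)]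
      exact (scan_runs y S rest Stats.empty).exists_haltsWith
    · rw [Stats.of_append]
      exact (mergeStats_runs _ _).exists_haltsWith
    · rw [← Stats.position_of hS]
      exact (locate_runs _).exists_haltsWith
  · obtain ⟨g, hg⟩ := exists_isStable f hw
    exact ⟨g, fun _ => hg.isStrictDownOne_iff hw, strictAlg_correct hw hg hδ⟩
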